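/- **Setting.** Let $k\ge 2$. For each design $i\in\{1,\dots,k\}$ let $X_{i,1},X_{i,2},\dots$ be observations with law $\mathcal N(\mu_i,\sigma_i^2)$, $\sigma_i^2>0$, all observations (across designs and within a design) being independent. Assume that the best design $i^*=\arg\max_i\mu_i$ is unique. For $i\ne i^*$ put $$\mathcal V_i(\alpha_i,\alpha_{i^*})=\min_{\phi\in\mathbb R}\Big(\tfrac{\alpha_i}{2}\log\big(1+\tfrac{(\mu_i-\phi)^2}{\sigma_i^2}\big)+\tfrac{\alpha_{i^*}}{2}\log\big(1+\tfrac{(\mu_{i^*}-\phi)^2}{\sigma_{i^*}^2}\big)\Big).$$ **Prior and posterior.** Let $\pi$ be a prior density for $(\boldsymbol\phi,\boldsymbol\psi)\in D=\mathbb R^k\times(0,\infty)^k$ (means and variances), and let $n_0\ge 1$ be the initial sample size. Assume that one of the following holds. (a) $n_0\ge 6$; $\pi\ge0$ is bounded and uniformly continuous on $D$ and $\int_D\pi=1$; and there are $c>0$ and $0<\bar\epsilon<\sigma_{\min}^2/2$ with $\pi\ge c$ on $[\mu_{\min}-\bar\epsilon,\mu_{\max}+\bar\epsilon]^k\times[\sigma^2_{\min}-\bar\epsilon,\sigma^2_{\max}+\bar\epsilon+(\mu_{\max}-\mu_{\min}+2\bar\epsilon)^2]^k$,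 where $\mu_{\min},\mu_{\max},\sigma^2_{\min},\sigma^2_{\max}$ are the extreme true means and variances. (b) $\pi$ is conjugate: $\pi(\boldsymbol\phi,\boldsymbol\psi)\propto\prod_i\psi_i^{-1/2}e^{-\lambda_i(\phi_i-\mu^0_i)^2/(2\psi_i)}\,\psi_i^{-(a_i+1)}e^{-b_i/\psi_i}$ with $\lambda_i\ge0$, $b_i\ge0$, $a_i+n_0/2>1$, and $b_i>0$ for all $i$ unless $n_0\ge2$. Given that the first $N_i$ observations of each design $i$ have been seen, let $\hat\mu_i$ and $\hat\sigma_i^2$ be the means of $\phi_i$ and $\psi_i$ under the posterior density obtained from $\pi$ and the normal likelihood by Bayes' rule. **The algorithm $\mathcal{OCBA}^{\mathcal U}$.** Take $n_0$ observations of every design. After $m$ further observations, let $N_i^m$ be the number of observations of design $i$, $\hat\alpha_i^m=N_i^m/\sum_jN_j^m$, and $\hat\mu_i^m,(\hat\sigma_i^m)^2$ the posterior estimates. Let $i^{*,m}$ be a maximiser of $\hat\mu_i^m$; if there are several, one with the smallest $N_i^m$. For $i\ne i^{*,m}$ let $$\hat{\mathcal V}_i^m=\min_{\phi}\Big(\tfrac{\hat\alpha_i^m}{2}\log\big(1+\tfrac{(\hat\mu_i^m-\phi)^2}{(\hat\sigma_i^m)^2}\big)+\tfrac{\hat\alpha_{i^{*,m}}^m}{2}\log\big(1+\tfrac{(\hat\mu_{i^{*,m}}^m-\phi)^2}{(\hat\sigma_{i^{*,m}}^m)^2}\big)\Big),$$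 let $\hat\phi_i^m$ be the smallest minimiser, and let $\hat{\mathcal U}_i^m=\log\big(1+(\hat\mu_i^m-\hat\phi_i^m)^2/(\hat\sigma_i^m)^2\big)$, $\hat{\mathcal U}_i^{*,m}=\log\big(1+(\hat\mu_{i^{*,m}}^m-\hat\phi_i^m)^2/(\hat\sigma_{i^{*,m}}^m)^2\big)$, $\hat{\mathcal W}_i^m=2\hat{\mathcal V}_i^m/\hat\alpha^m_{i^{*,m}}$. The next observation is taken from $i^{*,m}$ if the maximiser of $\hat\mu_i^m$ is not unique or if $\sum_{i\ne i^{*,m}}\hat{\mathcal U}_i^{*,m}/\hat{\mathcal U}_i^m>1$; otherwise it is taken from a minimiser of $\hat{\mathcal V}_i^m$ over $i\ne i^{*,m}$. Remaining ties are broken arbitrarily, and the procedure is continued indefinitely. **Theorem.** The problem of maximising $\min_{i\ne i^*}\mathcal V_i(\alpha_i,\alpha_{i^*})$ subject to $\alpha_i\ge0$, $\sum_i\alpha_i=1$ has a unique solution $\boldsymbol\alpha^*$. Almost surely, however the ties are broken, for every $\varepsilon>0$ there are random times $M(\varepsilon)\le M'(\varepsilon)<\infty$ such that $$\max_{i,j\ne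 i^*}|\hat{\mathcal W}_i^m-\hat{\mathcal W}_j^m|\le\varepsilon\ \text{ for all }m\ge M(\varepsilon),\qquad \max_{i=1,\dots,k}|\hat\alpha_i^m-\alpha_i^*|\le\varepsilon\ \text{ for all }m\ge M'(\varepsilon).$$ In particular $\hat{\boldsymbol\alpha}^m\to\boldsymbol\alpha^*$ almost surely. -/

import Mathlib

open MeasureTheory ProbabilityTheory Set

noncomputable section

namespace OCBA

/-! ### The rate functions and the optimal allocation -/

/-- The objective of the inner minimisation, as a function of `φ`: design 1 has proportion `a₁`,
mean `m₁`, variance `v₁`, and design 2 has proportion `a₂`, mean `m₂`, variance `v₂`. -/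
def rateObj (a₁ m₁ v₁ a₂ m₂ v₂ φ : ℝ) : ℝ :=
  a₁ / 2 * Real.log (1 + (m₁ - φ) ^ 2 / v₁) + a₂ / 2 * Real.log (1 + (m₂ - φ) ^ 2 / v₂)

/-- The rate `𝒱`, the minimum over `φ` of the objective. For `a₁, a₂ ≥ 0` and `v₁, v₂ > 0` the
objective is nonnegative and attains its infimum. -/
def rate (a₁ m₁ v₁ a₂ m₂ v₂ : ℝ) : ℝ :=
  ⨅ φ : ℝ, rateObj a₁ m₁ v₁ a₂ m₂ v₂ φ

/-- The smallest minimiser of the objective. For `a₁, a₂, v₁, v₂ > 0` the set of minimisers is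
nonempty and compact, so that this infimum is its least element. -/
def minimizer (a₁ m₁ v₁ a₂ m₂ v₂ : ℝ) : ℝ :=
  sInf {φ : ℝ | ∀ φ' : ℝ, rateObj a₁ m₁ v₁ a₂ m₂ v₂ φ ≤ rateObj a₁ m₁ v₁ a₂ m₂ v₂ φ'}

/-- `α` solves the problem of maximising `min_{i ≠ b} 𝒱_i(α_i, α_b)` over all `α ≥ 0` with
`∑ i, α i = 1`, where `b` is the best design, `m` the vector of means and `v` that of variances. -/
def IsOptimalAllocation {k : ℕ} (m v : Fin k → ℝ) (b : Fin k) (α : Fin k → ℝ) : Prop :=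
  α ∈ stdSimplex ℝ (Fin k) ∧
    IsMaxOn (fun β : Fin k → ℝ =>
      ⨅ i : {i : Fin k // i ≠ b}, rate (β i) (m i) (v i) (β b) (m b) (v b))
      (stdSimplex ℝ (Fin k)) α

/-! ### Priors and posterior estimates

A parameter is a pair `θ = (φ, ψ)` of a vector of means and a vector of variances. -/

/-- The parameter domain `ℝ^k × (0, ∞)^k`. -/
def paramSpace (k : ℕ) : Set ((Fin k → ℝ) × (Fin k → ℝ)) :=
  {θ | ∀ i, 0 < θ.2 i}

/-- The joint normal likelihood of the first `N i` observations of every design `i`, where `x i l`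
is the `l`-th observation of design `i` (counted from `0`). -/
def likelihood {k : ℕ} (x : Fin k → ℕ → ℝ) (N : Fin k → ℕ)
    (θ : (Fin k → ℝ) × (Fin k → ℝ)) : ℝ :=
  ∏ i, ∏ l ∈ Finset.range (N i), gaussianPDFReal (θ.1 i) (θ.2 i).toNNReal (x i l)

/-- The posterior density given by Bayes' rule. -/
def posterior {k : ℕ} (prior : (Fin k → ℝ) × (Fin k → ℝ) → ℝ) (x : Fin k → ℕ → ℝ)
    (N : Fin k → ℕ) (θ : (Fin k → ℝ) × (Fin k → ℝ)) : ℝ :=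
  prior θ * likelihood x N θ / ∫ η in paramSpace k, prior η * likelihood x N η

/-- The posterior mean of the mean of design `i`. -/
def postMean {k : ℕ} (prior : (Fin k → ℝ) × (Fin k → ℝ) → ℝ) (x : Fin k → ℕ → ℝ)
    (N : Fin k → ℕ) (i : Fin k) : ℝ :=
  ∫ θ in paramSpace k, θ.1 i * posterior prior x N θ

/-- The posterior mean of the variance of design `i`. -/
def postVar {k : ℕ} (prior : (Fin k → ℝ) × (Fin k → ℝ) → ℝ) (x : Fin k → ℕ → ℝ)
    (N : Fin k → ℕ) (i : Fin k) : ℝ :=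
  ∫ θ in paramSpace k, θ.2 i * posterior prior x N θ

/-- The region on which a general prior has to be bounded away from zero. It contains the true
means `m` and variances `v`. -/
def trueRegion {k : ℕ} (m v : Fin k → ℝ) (e : ℝ) : Set ((Fin k → ℝ) × (Fin k → ℝ)) :=
  {θ | ∀ i, θ.1 i ∈ Icc ((⨅ j, m j) - e) ((⨆ j, m j) + e) ∧
    θ.2 i ∈ Icc ((⨅ j, v j) - e) ((⨆ j, v j) + e + ((⨆ j, m j) - (⨅ j, m j) + 2 * e) ^ 2)}

/-- The regularity conditions on a general (possibly correlated) prior density. -/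
structure IsRegularPrior {k : ℕ} (m v : Fin k → ℝ)
    (prior : (Fin k → ℝ) × (Fin k → ℝ) → ℝ) : Prop where
  nonneg : ∀ θ ∈ paramSpace k, 0 ≤ prior θ
  integral_eq_one : ∫ θ in paramSpace k, prior θ = 1
  bounded : ∃ C : ℝ, ∀ θ ∈ paramSpace k, prior θ ≤ C
  lower_bound : ∃ c > 0, ∃ e > 0, e < (⨅ j, v j) / 2 ∧ ∀ θ ∈ trueRegion m v e, c ≤ prior θ
  uniformContinuousOn : UniformContinuousOn prior (paramSpace k)

/-- The normal-inverse-gamma density with location `loc`, precision factor `lam`, shape `a` and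
scale `b`, up to a normalising constant, at mean `φ` and variance `ψ`. -/
def nigKernel (loc lam a b φ ψ : ℝ) : ℝ :=
  ψ ^ (-(1 / 2 : ℝ)) * Real.exp (-(lam * (φ - loc) ^ 2) / (2 * ψ)) *
    (ψ ^ (-(a + 1)) * Real.exp (-b / ψ))

/-- A conjugate prior, independent across designs: a product of normal-inverse-gamma densities,
where the noninformative limits `lam i = 0` and `b i = 0` are allowed. After `n₀` observations of
every design the posterior is a proper normal-inverse-gamma distribution (with probability one);
the condition `1 < a i + n₀ / 2` says that the posterior means of the variances are finite. -/
def IsConjugatePrior {k : ℕ} (n₀ : ℕ) (prior : (Fin k → ℝ) × (Fin k → ℝ) → ℝ) : Prop :=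
  ∃ (C : ℝ) (loc lam a b : Fin k → ℝ), 0 < C ∧
    (∀ i, 0 ≤ lam i ∧ 0 ≤ b i ∧ 1 < a i + n₀ / 2 ∧ (0 < b i ∨ 2 ≤ n₀)) ∧
    ∀ θ ∈ paramSpace k,
      prior θ = C * ∏ i, nigKernel (loc i) (lam i) (a i) (b i) (θ.1 i) (θ.2 i)

/-! ### The sequential procedure -/

/-- The number `N_i^t` of observations of design `i` after `t` iterations, where `n₀` observations
of every design are taken initially and `I s` is the design sampled at iteration `s + 1`. -/
def count {k : ℕ} (n₀ : ℕ) (I : ℕ → Fin k) (t : ℕ) (i : Fin k) : ℕ :=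
  n₀ + ((Finset.range t).filter fun s => I s = i).card

/-- The empirical sampling proportion `N_i / ∑ j, N_j`. -/
def proportion {k : ℕ} (N : Fin k → ℕ) (i : Fin k) : ℝ :=
  (N i : ℝ) / ∑ j, (N j : ℝ)

/-- Plug-in estimate of the rate of design `i` against the estimated best design `b`. -/
def estRate {k : ℕ} (prior : (Fin k → ℝ) × (Fin k → ℝ) → ℝ) (x : Fin k → ℕ → ℝ)
    (N : Fin k → ℕ) (b i : Fin k) : ℝ :=
  rate (proportion N i) (postMean prior x N i) (postVar prior x N i)
    (proportion N b) (postMean prior x N b) (postVar prior x N b)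

/-- The rescaled estimate `2 / α̂_b` times the estimated rate. -/
def estScaledRate {k : ℕ} (prior : (Fin k → ℝ) × (Fin k → ℝ) → ℝ) (x : Fin k → ℕ → ℝ)
    (N : Fin k → ℕ) (b i : Fin k) : ℝ :=
  2 / proportion N b * estRate prior x N b i

/-- The smallest minimiser in the definition of the estimated rate. -/
def estMinimizer {k : ℕ} (prior : (Fin k → ℝ) × (Fin k → ℝ) → ℝ) (x : Fin k → ℕ → ℝ)
    (N : Fin k → ℕ) (b i : Fin k) : ℝ :=
  minimizer (proportion N i) (postMean prior x N i) (postVar prior x N i)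
    (proportion N b) (postMean prior x N b) (postVar prior x N b)

/-- The log-term `log (1 + (μ̂_j - φ̂_i)² / σ̂_j²)`; it is `𝒰̂_i` for `j = i` and `𝒰̂*_i` for
`j = b`. -/
def estLogTerm {k : ℕ} (prior : (Fin k → ℝ) × (Fin k → ℝ) → ℝ) (x : Fin k → ℕ → ℝ)
    (N : Fin k → ℕ) (b i j : Fin k) : ℝ :=
  Real.log (1 + (postMean prior x N j - estMinimizer prior x N b i) ^ 2 / postVar prior x N j)

/-- The estimated ratio sum `∑_{i ≠ b} 𝒰̂*_i / 𝒰̂_i`. -/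
def estRatioSum {k : ℕ} (prior : (Fin k → ℝ) × (Fin k → ℝ) → ℝ) (x : Fin k → ℕ → ℝ)
    (N : Fin k → ℕ) (b : Fin k) : ℝ :=
  ∑ i ∈ Finset.univ.erase b, estLogTerm prior x N b i b / estLogTerm prior x N b i i

/-- `b` maximises the posterior mean. -/
def IsPostArgmax {k : ℕ} (prior : (Fin k → ℝ) × (Fin k → ℝ) → ℝ) (x : Fin k → ℕ → ℝ)
    (N : Fin k → ℕ) (b : Fin k) : Prop :=
  ∀ j, postMean prior x N j ≤ postMean prior x N b

/-- `b` is the estimated best design: a maximiser of the posterior mean that has received the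
smallest number of observations among all maximisers. -/
def IsEstBest {k : ℕ} (prior : (Fin k → ℝ) × (Fin k → ℝ) → ℝ) (x : Fin k → ℕ → ℝ)
    (N : Fin k → ℕ) (b : Fin k) : Prop :=
  IsPostArgmax prior x N b ∧ ∀ j, IsPostArgmax prior x N j → N b ≤ N j

/-- `i` is a design that may be sampled next, when `b` is the estimated best design: `b` itself if
the maximiser of the posterior mean is not unique or if the ratio sum exceeds `1`, and otherwise
any minimiser of the estimated rate among the designs other than `b`. -/
def IsNext {k : ℕ} (prior : (Fin k → ℝ) × (Fin k → ℝ) → ℝ) (x : Fin k → ℕ → ℝ)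
    (N : Fin k → ℕ) (b i : Fin k) : Prop :=
  ((¬ (∃! j, IsPostArgmax prior x N j) ∨ 1 < estRatioSum prior x N b) → i = b) ∧
  ((∃! j, IsPostArgmax prior x N j) → estRatioSum prior x N b ≤ 1 →
    i ≠ b ∧ ∀ j, j ≠ b → estRate prior x N b i ≤ estRate prior x N b j)

/-- A run of the procedure on the observations `x`, with initial sample size `n₀`: after `t`
iterations `B t` is the estimated best design, and `I t` is the design sampled at iteration
`t + 1`. The remaining ties are broken arbitrarily. -/
def IsRun {k : ℕ} (prior : (Fin k → ℝ) × (Fin k → ℝ) → ℝ) (n₀ : ℕ) (x : Fin k → ℕ → ℝ)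
    (B I : ℕ → Fin k) : Prop :=
  ∀ t, IsEstBest prior x (count n₀ I t) (B t) ∧ IsNext prior x (count n₀ I t) (B t) (I t)

end OCBA

end

namespace OCBA

open Filter Topology

/-! The proof separates a deterministic statement about a single path of observations from the
probabilistic fact that almost every path satisfies its hypotheses. The deterministic part covers
every way of breaking ties, so one null set serves all runs.

Optimal allocation. By homogeneity, a rate is half of the best design's weight times a function g_i
(`profile`) of the ratio r_i of the two weights. For fixed φ the objective is affine in r, so g_i is
an infimum of lines: it is strictly increasing, strictly concave, bounded, and zero at 0. An optimum
equalises the g_i at a level W and has value W / (2 (1 + ∑ r_i)). Strict concavity gives uniqueness,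
and any other common level V, attained at ratios s_i, satisfies V (1 + ∑ r_i) < W (1 + ∑ s_i)
(`exists_unique_optimal`).

Balancing. No derivative of g_i is used. At any minimiser φ the log-terms u of design i and w of the
best design are the slope and the intercept of a supporting line of g_i, so w / u can be compared
with the same quotient for a chord (`chord_le_logTerm_ratio`, `logTerm_ratio_le_chord`). Summed over
the chords between the levels W and V, the quotients give (W ∑ s_i - V ∑ r_i) / (V - W), and the
inequality above says that this exceeds 1 for V > W and is below 1 for V < W. Hence the ratio test
samples the best design when all g_i are clearly above W, and another design when all are clearly
below. Since among the others the smallest estimated rate is served first, all g_i are driven to W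
(`tendsto_of_balanced_sampling`). Estimation errors only change g_i by a factor near 1, uniformly in
the ratio (`profile_perturb`).

Sampling infinitely often. Suppose some design has a bounded count. Its estimated rate, multiplied
by the total count, stays bounded, so any design that is sampled without being the estimated best
must be statistically close to the latter: the smaller count times the squared gap of posterior
means is bounded. Therefore all designs sampled infinitely often have the same true mean.
Consistency does not exclude this, since inferior designs may have equal means; fluctuations do. At
suitable times s the sample mean of such a design a is far below its true mean on the scale 1 / √s,
while the sample means of the others, once based on at least s / q observations, are not. When a
receives its next observation after s of them, it is either far from the estimated best, or is
itself the estimated best with all other counts small, so that the ratio test forbids sampling it.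
Both are contradictory (`tendsto_count_atTop`).

Consistency. A conjugate prior gives explicit posterior estimates. A general prior lies between a
positive constant near the true parameters and a constant everywhere. Under a flat prior the
posterior is a product of normal-inverse-gamma laws with explicit moments, and the passage to the
general prior costs a factor independent of the sample sizes (`post_expectation_bounds`).

Oscillation. A centred Gaussian walk is below -L √s at time s with a positive probability not
depending on s. By Ville's inequality for the exponential martingale, the other walks stay above a
line of slope -M / √s from time s / q on with probability at least 1/2. Independence and a zero-one
law give infinitely many such times almost surely (`ae_oscillatingMeans`). -/

/-- The log-term of a normal design with mean `m` and variance `v` at `φ`. -/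
noncomputable def logTerm (m v φ : ℝ) : ℝ := Real.log (1 + (m - φ) ^ 2 / v)

lemma rateObj_eq (a₁ m₁ v₁ a₂ m₂ v₂ φ : ℝ) :
    rateObj a₁ m₁ v₁ a₂ m₂ v₂ φ = a₁ / 2 * logTerm m₁ v₁ φ + a₂ / 2 * logTerm m₂ v₂ φ := rfl

lemma logTerm_nonneg {v : ℝ} (hv : 0 < v) (m φ : ℝ) : 0 ≤ logTerm m v φ :=
  Real.log_nonneg (by have : 0 ≤ (m - φ) ^ 2 / v := by positivity
                      linarith)

lemma logTerm_pos {m v φ : ℝ} (hv : 0 < v) (h : m ≠ φ) : 0 < logTerm m v φ :=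
  Real.log_pos (by have : 0 < (m - φ) ^ 2 / v := by
                     have := sub_ne_zero.2 h
                     positivity
                   linarith)

@[simp] lemma logTerm_self (m v : ℝ) : logTerm m v m = 0 := by simp [logTerm]

lemma logTerm_mono {m v φ φ' : ℝ} (hv : 0 < v) (h : (m - φ) ^ 2 ≤ (m - φ') ^ 2) :
    logTerm m v φ ≤ logTerm m v φ' := by
  unfold logTerm
  apply Real.log_le_log
  · positivity
  · gcongr

lemma continuous_logTerm (m : ℝ) {v : ℝ} (hv : 0 < v) : Continuous (logTerm m v) := by
  unfold logTerm
  refine Continuous.log (by fun_prop) fun φ => ?_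
  positivity

lemma logTerm_le {v : ℝ} (hv : 0 < v) (m φ : ℝ) : logTerm m v φ ≤ (m - φ) ^ 2 / v := by
  unfold logTerm
  have : 0 ≤ (m - φ) ^ 2 / v := by positivity
  have := Real.log_le_sub_one_of_pos (x := 1 + (m - φ) ^ 2 / v) (by positivity)
  linarith

lemma le_logTerm {v : ℝ} (hv : 0 < v) (m φ : ℝ) :
    (m - φ) ^ 2 / (v + (m - φ) ^ 2) ≤ logTerm m v φ := by
  unfold logTerm
  have h := Real.one_sub_inv_le_log_of_pos (x := 1 + (m - φ) ^ 2 / v) (by positivity)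
  refine le_trans (le_of_eq ?_) h
  have : 0 < v + (m - φ) ^ 2 := by positivity
  field_simp
  ring

/-! ### Minimisers of the two-design objective -/

section Min

variable {a₁ m₁ v₁ a₂ m₂ v₂ : ℝ}

lemma rateObj_nonneg (ha₁ : 0 ≤ a₁) (hv₁ : 0 < v₁) (ha₂ : 0 ≤ a₂) (hv₂ : 0 < v₂) (φ : ℝ) :
    0 ≤ rateObj a₁ m₁ v₁ a₂ m₂ v₂ φ := by
  rw [rateObj_eq]
  have := logTerm_nonneg hv₁ m₁ φ
  have := logTerm_nonneg hv₂ m₂ φ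
  positivity

lemma rate_le_rateObj (ha₁ : 0 ≤ a₁) (hv₁ : 0 < v₁) (ha₂ : 0 ≤ a₂) (hv₂ : 0 < v₂) (φ : ℝ) :
    rate a₁ m₁ v₁ a₂ m₂ v₂ ≤ rateObj a₁ m₁ v₁ a₂ m₂ v₂ φ :=
  ciInf_le ⟨0, by rintro _ ⟨φ, rfl⟩; exact rateObj_nonneg ha₁ hv₁ ha₂ hv₂ φ⟩ φ

lemma rate_nonneg (ha₁ : 0 ≤ a₁) (hv₁ : 0 < v₁) (ha₂ : 0 ≤ a₂) (hv₂ : 0 < v₂) :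
    0 ≤ rate a₁ m₁ v₁ a₂ m₂ v₂ :=
  le_ciInf fun φ => rateObj_nonneg ha₁ hv₁ ha₂ hv₂ φ

lemma continuous_rateObj (hv₁ : 0 < v₁) (hv₂ : 0 < v₂) :
    Continuous (rateObj a₁ m₁ v₁ a₂ m₂ v₂) := by
  have h₁ := continuous_logTerm m₁ hv₁
  have h₂ := continuous_logTerm m₂ hv₂
  have : rateObj a₁ m₁ v₁ a₂ m₂ v₂ =
      fun φ => a₁ / 2 * logTerm m₁ v₁ φ + a₂ / 2 * logTerm m₂ v₂ φ := rfl
  rw [this]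
  fun_prop

/-- Projecting φ onto the interval between the means increases neither of the two distances, hence
neither log-term, so minimising over a compact interval suffices. -/
lemma exists_rateObj_min (ha₁ : 0 ≤ a₁) (hv₁ : 0 < v₁) (ha₂ : 0 ≤ a₂) (hv₂ : 0 < v₂)
    (hm : m₁ ≤ m₂) :
    ∃ φ ∈ Icc m₁ m₂, ∀ φ', rateObj a₁ m₁ v₁ a₂ m₂ v₂ φ ≤ rateObj a₁ m₁ v₁ a₂ m₂ v₂ φ' := by
  obtain ⟨φ, hφ, hmin⟩ := isCompact_Icc.exists_isMinOn (nonempty_Icc.2 hm)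
    (continuous_rateObj (a₁ := a₁) (m₁ := m₁) (a₂ := a₂) (m₂ := m₂) hv₁ hv₂).continuousOn
  refine ⟨φ, hφ, fun φ' => ?_⟩
  have key : ∀ ψ ∈ Icc m₁ m₂, (m₁ - ψ) ^ 2 ≤ (m₁ - φ') ^ 2 → (m₂ - ψ) ^ 2 ≤ (m₂ - φ') ^ 2 →
      rateObj a₁ m₁ v₁ a₂ m₂ v₂ φ ≤ rateObj a₁ m₁ v₁ a₂ m₂ v₂ φ' := by
    intro ψ hψ h₁ h₂
    refine (hmin hψ).trans ?_
    rw [rateObj_eq, rateObj_eq]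
    have := logTerm_mono hv₁ h₁
    have := logTerm_mono hv₂ h₂
    gcongr
  rcases le_total φ' m₁ with h | h
  · exact key m₁ ⟨le_rfl, hm⟩ (by nlinarith) (by nlinarith)
  rcases le_total φ' m₂ with h' | h'
  · exact key φ' ⟨h, h'⟩ le_rfl le_rfl
  · exact key m₂ ⟨hm, le_rfl⟩ (by nlinarith) (by nlinarith)

lemma rate_eq_of_min {φ : ℝ}
    (h : ∀ φ', rateObj a₁ m₁ v₁ a₂ m₂ v₂ φ ≤ rateObj a₁ m₁ v₁ a₂ m₂ v₂ φ') :
    rate a₁ m₁ v₁ a₂ m₂ v₂ = rateObj a₁ m₁ v₁ a₂ m₂ v₂ φ :=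
  le_antisymm (ciInf_le ⟨_, by rintro _ ⟨φ', rfl⟩; exact h φ'⟩ φ) (le_ciInf h)

lemma hasDerivAt_logTerm (m : ℝ) {v : ℝ} (hv : 0 < v) (φ : ℝ) :
    HasDerivAt (logTerm m v) (-(2 * (m - φ) / (v + (m - φ) ^ 2))) φ := by
  unfold logTerm
  have h1 : HasDerivAt (fun φ => 1 + (m - φ) ^ 2 / v) (2 * (m - φ) * (-1) / v) φ := by
    have := (((hasDerivAt_id φ).const_sub m).pow 2).div_const v
    simpa using this.const_add 1
  have hpos : 0 < 1 + (m - φ) ^ 2 / v := by positivity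
  convert h1.log hpos.ne' using 1
  have : 0 < v + (m - φ) ^ 2 := by positivity
  field_simp

lemma stationary_of_min (hv₁ : 0 < v₁) (hv₂ : 0 < v₂) {φ : ℝ}
    (h : ∀ φ', rateObj a₁ m₁ v₁ a₂ m₂ v₂ φ ≤ rateObj a₁ m₁ v₁ a₂ m₂ v₂ φ') :
    a₁ * ((φ - m₁) / (v₁ + (φ - m₁) ^ 2)) = a₂ * ((m₂ - φ) / (v₂ + (m₂ - φ) ^ 2)) := by
  have hd : HasDerivAt (rateObj a₁ m₁ v₁ a₂ m₂ v₂)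
      (a₁ / 2 * (-(2 * (m₁ - φ) / (v₁ + (m₁ - φ) ^ 2))) +
        a₂ / 2 * (-(2 * (m₂ - φ) / (v₂ + (m₂ - φ) ^ 2)))) φ :=
    ((hasDerivAt_logTerm m₁ hv₁ φ).const_mul _).add ((hasDerivAt_logTerm m₂ hv₂ φ).const_mul _)
  have h0 := IsLocalMin.hasDerivAt_eq_zero (Filter.Eventually.of_forall h) hd
  have e : (m₁ - φ) ^ 2 = (φ - m₁) ^ 2 := by ring
  rw [e] at h0
  have e2 : 2 * (m₁ - φ) / (v₁ + (φ - m₁) ^ 2) = -(2 * ((φ - m₁) / (v₁ + (φ - m₁) ^ 2))) := by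
    ring
  have e3 : 2 * (m₂ - φ) / (v₂ + (m₂ - φ) ^ 2) = 2 * ((m₂ - φ) / (v₂ + (m₂ - φ) ^ 2)) := by
    ring
  rw [e2, e3] at h0
  linarith

/-- Outside the open interval the two sides of the stationarity equation have incompatible signs. -/
lemma mem_Ioo_of_min (ha₁ : 0 < a₁) (hv₁ : 0 < v₁) (ha₂ : 0 < a₂) (hv₂ : 0 < v₂) (hm : m₁ < m₂)
    {φ : ℝ} (h : ∀ φ', rateObj a₁ m₁ v₁ a₂ m₂ v₂ φ ≤ rateObj a₁ m₁ v₁ a₂ m₂ v₂ φ') :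
    φ ∈ Ioo m₁ m₂ := by
  have hs := stationary_of_min hv₁ hv₂ h
  have hp₁ : 0 < v₁ + (φ - m₁) ^ 2 := by positivity
  have hp₂ : 0 < v₂ + (m₂ - φ) ^ 2 := by positivity
  constructor
  · by_contra hcon
    rw [not_lt] at hcon
    have h1 : a₁ * ((φ - m₁) / (v₁ + (φ - m₁) ^ 2)) ≤ 0 :=
      mul_nonpos_of_nonneg_of_nonpos ha₁.le (div_nonpos_of_nonpos_of_nonneg (by linarith) hp₁.le)
    have h2 : 0 < a₂ * ((m₂ - φ) / (v₂ + (m₂ - φ) ^ 2)) :=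
      mul_pos ha₂ (div_pos (by linarith) hp₂)
    linarith
  · by_contra hcon
    rw [not_lt] at hcon
    have h1 : a₂ * ((m₂ - φ) / (v₂ + (m₂ - φ) ^ 2)) ≤ 0 :=
      mul_nonpos_of_nonneg_of_nonpos ha₂.le (div_nonpos_of_nonpos_of_nonneg (by linarith) hp₂.le)
    have h2 : 0 < a₁ * ((φ - m₁) / (v₁ + (φ - m₁) ^ 2)) :=
      mul_pos ha₁ (div_pos (by linarith) hp₁)
    linarith

/-- The minimisers form a nonempty closed set that is bounded below, so the infimum defining
`minimizer` belongs to it. -/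
lemma minimizer_spec (ha₁ : 0 < a₁) (hv₁ : 0 < v₁) (ha₂ : 0 < a₂) (hv₂ : 0 < v₂) (hm : m₁ < m₂)
    (φ' : ℝ) :
    rateObj a₁ m₁ v₁ a₂ m₂ v₂ (minimizer a₁ m₁ v₁ a₂ m₂ v₂) ≤ rateObj a₁ m₁ v₁ a₂ m₂ v₂ φ' := by
  let S := {φ : ℝ | ∀ φ' : ℝ, rateObj a₁ m₁ v₁ a₂ m₂ v₂ φ ≤ rateObj a₁ m₁ v₁ a₂ m₂ v₂ φ'}
  have hne : S.Nonempty := by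
    obtain ⟨φ, -, h⟩ := exists_rateObj_min (m₁ := m₁) (m₂ := m₂) ha₁.le hv₁ ha₂.le hv₂ hm.le
    exact ⟨φ, h⟩
  have hbdd : BddBelow S := ⟨m₁, fun φ hφ => (mem_Ioo_of_min ha₁ hv₁ ha₂ hv₂ hm hφ).1.le⟩
  have hcl : IsClosed S := by
    have : S = ⋂ φ' : ℝ, {φ | rateObj a₁ m₁ v₁ a₂ m₂ v₂ φ ≤ rateObj a₁ m₁ v₁ a₂ m₂ v₂ φ'} := by
      ext; simp [S]
    rw [this]
    exact isClosed_iInter fun φ' => isClosed_le (continuous_rateObj hv₁ hv₂) continuous_const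
  exact hcl.csInf_mem hne hbdd φ'

lemma rate_smul {c : ℝ} (hc : 0 ≤ c) :
    rate (c * a₁) m₁ v₁ (c * a₂) m₂ v₂ = c * rate a₁ m₁ v₁ a₂ m₂ v₂ := by
  unfold rate
  rw [Real.mul_iInf_of_nonneg hc]
  congr 1
  ext φ
  unfold rateObj
  ring

/-- The ratio of log-terms at a minimiser is comparable to the squared ratio of the weights. -/
lemma logTerm_ratio_bounds {lo hi D : ℝ} (ha₁ : 0 < a₁) (ha₂ : 0 < a₂) (hm : m₁ < m₂)
    (hlo : 0 < lo) (hv₁ : v₁ ∈ Icc lo hi) (hv₂ : v₂ ∈ Icc lo hi) (hD : m₂ - m₁ ≤ D) {φ : ℝ}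
    (h : ∀ φ', rateObj a₁ m₁ v₁ a₂ m₂ v₂ φ ≤ rateObj a₁ m₁ v₁ a₂ m₂ v₂ φ') :
    (lo / (hi + D ^ 2)) ^ 3 * (a₁ / a₂) ^ 2 ≤ logTerm m₂ v₂ φ / logTerm m₁ v₁ φ ∧
      logTerm m₂ v₂ φ / logTerm m₁ v₁ φ ≤ ((hi + D ^ 2) / lo) ^ 3 * (a₁ / a₂) ^ 2 := by
  have hv₁' : 0 < v₁ := hlo.trans_le hv₁.1
  have hv₂' : 0 < v₂ := hlo.trans_le hv₂.1
  have hs := stationary_of_min hv₁' hv₂' h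
  obtain ⟨hx, hy⟩ := mem_Ioo_of_min ha₁ hv₁' ha₂ hv₂' hm h
  have hu := logTerm_pos hv₁' hx.ne
  have hw := logTerm_pos hv₂' hy.ne'
  have hu1 := logTerm_le hv₁' m₁ φ
  have hw1 := logTerm_le hv₂' m₂ φ
  have hu2 := le_logTerm hv₁' m₁ φ
  have hw2 := le_logTerm hv₂' m₂ φ
  have esq : (m₁ - φ) ^ 2 = (φ - m₁) ^ 2 := by ring
  rw [esq] at hu1 hu2
  set u := logTerm m₁ v₁ φ
  set w := logTerm m₂ v₂ φ
  obtain ⟨x, rfl⟩ : ∃ x, φ = m₁ + x := ⟨φ - m₁, by ring⟩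
  obtain ⟨y, rfl⟩ : ∃ y, m₂ = m₁ + x + y := ⟨m₂ - (m₁ + x), by ring⟩
  simp only [add_sub_cancel_left] at *
  have hx0 : 0 < x := by linarith
  have hy0 : 0 < y := by linarith
  have hxD : x ≤ D := by linarith
  have hyD : y ≤ D := by linarith
  -- All denominators lie between `lo` and `K`. Each log-term is then comparable to the squared
  -- distance, which costs one factor `K / lo` in the quotient. Stationarity pins `y / x` to `a₁ /
  -- a₂` up to `K / lo`, which costs two more after squaring.
  set K := hi + D ^ 2 with hK
  have hhi : 0 < hi := hlo.trans_le (hv₁.1.trans hv₁.2)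
  have hK0 : 0 < K := by positivity
  have k₁ : v₁ + x ^ 2 ≤ K := by have := hv₁.2; rw [hK]; gcongr
  have k₂ : v₂ + y ^ 2 ≤ K := by have := hv₂.2; rw [hK]; gcongr
  have l₁ : lo ≤ v₁ + x ^ 2 := by have := hv₁.1; nlinarith
  have l₂ : lo ≤ v₂ + y ^ 2 := by have := hv₂.1; nlinarith
  have hu1' : u ≤ x ^ 2 / lo := hu1.trans (by gcongr; exact hv₁.1)
  have hw1' : w ≤ y ^ 2 / lo := hw1.trans (by gcongr; exact hv₂.1)
  have hu2' : x ^ 2 / K ≤ u := le_trans (by gcongr) hu2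
  have hw2' : y ^ 2 / K ≤ w := le_trans (by gcongr) hw2
  have b1 : x / K ≤ x / (v₁ + x ^ 2) := by gcongr
  have b2 : x / (v₁ + x ^ 2) ≤ x / lo := by gcongr
  have b3 : y / K ≤ y / (v₂ + y ^ 2) := by gcongr
  have b4 : y / (v₂ + y ^ 2) ≤ y / lo := by gcongr
  have s1 : a₁ * (x / K) ≤ a₂ * (y / lo) :=
    (mul_le_mul_of_nonneg_left b1 ha₁.le).trans (hs.le.trans (mul_le_mul_of_nonneg_left b4 ha₂.le))
  have s2 : a₂ * (y / K) ≤ a₁ * (x / lo) :=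
    (mul_le_mul_of_nonneg_left b3 ha₂.le).trans (hs.ge.trans (mul_le_mul_of_nonneg_left b2 ha₁.le))
  have t1 : (lo / K) * (a₁ / a₂) ≤ y / x := by
    rw [div_mul_div_comm, div_le_div_iff₀ (by positivity) hx0]
    have e1 : a₁ * (x / K) = a₁ * x / K := by ring
    have e2 : a₂ * (y / lo) = a₂ * y / lo := by ring
    rw [e1, e2, div_le_div_iff₀ hK0 hlo] at s1
    linarith
  have t2 : y / x ≤ (K / lo) * (a₁ / a₂) := by
    rw [div_mul_div_comm, div_le_div_iff₀ hx0 (by positivity)]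
    have e1 : a₂ * (y / K) = a₂ * y / K := by ring
    have e2 : a₁ * (x / lo) = a₁ * x / lo := by ring
    rw [e1, e2, div_le_div_iff₀ hK0 hlo] at s2
    linarith
  constructor
  · calc (lo / K) ^ 3 * (a₁ / a₂) ^ 2 = (lo / K) * ((lo / K) * (a₁ / a₂)) ^ 2 := by ring
      _ ≤ (lo / K) * (y / x) ^ 2 := by gcongr
      _ = (y ^ 2 / K) / (x ^ 2 / lo) := by field_simp
      _ ≤ w / u := by gcongr
  · calc w / u ≤ (y ^ 2 / lo) / (x ^ 2 / K) := by gcongr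
      _ = (K / lo) * (y / x) ^ 2 := by field_simp
      _ ≤ (K / lo) * ((K / lo) * (a₁ / a₂)) ^ 2 := by gcongr
      _ = (K / lo) ^ 3 * (a₁ / a₂) ^ 2 := by ring

/-- Every φ is at least half the gap away from one of the two means, and the corresponding log-term
alone gives the bound. -/
lemma le_rate {hi : ℝ} (ha₁ : 0 ≤ a₁) (ha₂ : 0 ≤ a₂) (hv₁ : 0 < v₁) (hv₂ : 0 < v₂)
    (h₁ : v₁ ≤ hi) (h₂ : v₂ ≤ hi) :
    min a₁ a₂ / 2 * Real.log (1 + (m₂ - m₁) ^ 2 / (4 * hi)) ≤ rate a₁ m₁ v₁ a₂ m₂ v₂ := by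
  refine le_ciInf fun φ => ?_
  rw [rateObj_eq]
  have hu := logTerm_nonneg hv₁ m₁ φ
  have hw := logTerm_nonneg hv₂ m₂ φ
  have hhi : 0 < hi := hv₁.trans_le h₁
  have key : ∀ m v : ℝ, 0 < v → v ≤ hi → (m₂ - m₁) ^ 2 / 4 ≤ (m - φ) ^ 2 →
      Real.log (1 + (m₂ - m₁) ^ 2 / (4 * hi)) ≤ logTerm m v φ := by
    intro m v hv hvh h
    unfold logTerm
    apply Real.log_le_log (by positivity)
    have : (m₂ - m₁) ^ 2 / (4 * hi) = ((m₂ - m₁) ^ 2 / 4) / hi := by ring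
    rw [this]
    gcongr
  have hL : 0 ≤ Real.log (1 + (m₂ - m₁) ^ 2 / (4 * hi)) :=
    Real.log_nonneg (by have : 0 ≤ (m₂ - m₁) ^ 2 / (4 * hi) := by positivity
                        linarith)
  rcases le_total ((m₂ - m₁) ^ 2 / 4) ((m₁ - φ) ^ 2) with h | h
  · have := key m₁ v₁ hv₁ h₁ h
    calc _ ≤ a₁ / 2 * logTerm m₁ v₁ φ := by gcongr; exact min_le_left _ _
      _ ≤ _ := by have : 0 ≤ a₂ / 2 * logTerm m₂ v₂ φ := by positivity
                  linarith
  · have := key m₂ v₂ hv₂ h₂ (by nlinarith [sq_nonneg (m₁ + m₂ - 2 * φ)])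
    calc _ ≤ a₂ / 2 * logTerm m₂ v₂ φ := by gcongr; exact min_le_right _ _
      _ ≤ _ := by have : 0 ≤ a₁ / 2 * logTerm m₁ v₁ φ := by positivity
                  linarith

end Min

/-! ### The rate as a concave function of the weight ratio -/

/-- Twice the rate as a function of the ratio `r` of the two weights. -/
noncomputable def profile (m₁ v₁ m₂ v₂ r : ℝ) : ℝ := 2 * rate r m₁ v₁ 1 m₂ v₂

section Profile

variable {m₁ v₁ m₂ v₂ r r' φ : ℝ}

lemma two_mul_rateObj : 2 * rateObj r m₁ v₁ 1 m₂ v₂ φ = r * logTerm m₁ v₁ φ + logTerm m₂ v₂ φ := by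
  rw [rateObj_eq]; ring

lemma two_mul_rate_div {a₁ a₂ : ℝ} (ha₂ : 0 < a₂) :
    2 / a₂ * rate a₁ m₁ v₁ a₂ m₂ v₂ = profile m₁ v₁ m₂ v₂ (a₁ / a₂) := by
  have h := rate_smul (a₁ := a₁ / a₂) (m₁ := m₁) (v₁ := v₁) (a₂ := 1) (m₂ := m₂) (v₂ := v₂) ha₂.le
  rw [mul_one, mul_div_cancel₀ _ ha₂.ne'] at h
  rw [h, profile]
  field_simp

lemma profile_le (hv₁ : 0 < v₁) (hv₂ : 0 < v₂) (hr : 0 ≤ r) (φ : ℝ) :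
    profile m₁ v₁ m₂ v₂ r ≤ r * logTerm m₁ v₁ φ + logTerm m₂ v₂ φ := by
  rw [← two_mul_rateObj, profile]
  have := rate_le_rateObj (m₁ := m₁) (m₂ := m₂) hr hv₁ zero_le_one hv₂ φ
  linarith

lemma profile_eq_of_min
    (h : ∀ φ', rateObj r m₁ v₁ 1 m₂ v₂ φ ≤ rateObj r m₁ v₁ 1 m₂ v₂ φ') :
    profile m₁ v₁ m₂ v₂ r = r * logTerm m₁ v₁ φ + logTerm m₂ v₂ φ := by
  rw [← two_mul_rateObj, profile, rate_eq_of_min h]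

lemma profile_nonneg (hv₁ : 0 < v₁) (hv₂ : 0 < v₂) (hr : 0 ≤ r) :
    0 ≤ profile m₁ v₁ m₂ v₂ r :=
  mul_nonneg zero_le_two (rate_nonneg hr hv₁ zero_le_one hv₂)

lemma profile_zero (hv₁ : 0 < v₁) (hv₂ : 0 < v₂) : profile m₁ v₁ m₂ v₂ 0 = 0 :=
  le_antisymm (by simpa using profile_le (m₁ := m₁) (m₂ := m₂) hv₁ hv₂ le_rfl m₂)
    (profile_nonneg hv₁ hv₂ le_rfl)

lemma exists_profile_eq (hv₁ : 0 < v₁) (hv₂ : 0 < v₂) (hm : m₁ < m₂) (hr : 0 < r) :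
    ∃ φ ∈ Ioo m₁ m₂, (∀ φ', rateObj r m₁ v₁ 1 m₂ v₂ φ ≤ rateObj r m₁ v₁ 1 m₂ v₂ φ') ∧
      profile m₁ v₁ m₂ v₂ r = r * logTerm m₁ v₁ φ + logTerm m₂ v₂ φ := by
  obtain ⟨φ, -, h⟩ := exists_rateObj_min (m₁ := m₁) (m₂ := m₂) hr.le hv₁ zero_le_one hv₂ hm.le
  exact ⟨φ, mem_Ioo_of_min hr hv₁ one_pos hv₂ hm h, h, profile_eq_of_min h⟩

/-- The line belonging to a minimiser φ at `r` lies above the profile. Contact at `r'` as well would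
make φ a minimiser for both weights, whereas the stationarity equation at φ determines the weight.
This is the source of strict concavity. -/
lemma profile_lt_of_min (hv₁ : 0 < v₁) (hv₂ : 0 < v₂) (hm : m₁ < m₂) (hr : 0 < r) (hr' : 0 ≤ r')
    (hne : r' ≠ r) (h : ∀ φ', rateObj r m₁ v₁ 1 m₂ v₂ φ ≤ rateObj r m₁ v₁ 1 m₂ v₂ φ') :
    profile m₁ v₁ m₂ v₂ r' < r' * logTerm m₁ v₁ φ + logTerm m₂ v₂ φ := by
  refine lt_of_le_of_ne (profile_le hv₁ hv₂ hr' φ) fun heq => hne ?_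
  have h' : ∀ φ', rateObj r' m₁ v₁ 1 m₂ v₂ φ ≤ rateObj r' m₁ v₁ 1 m₂ v₂ φ' := by
    intro φ'
    have h1 := profile_le (m₁ := m₁) (m₂ := m₂) hv₁ hv₂ hr' φ'
    rw [heq, ← two_mul_rateObj, ← two_mul_rateObj] at h1
    linarith
  have s := stationary_of_min hv₁ hv₂ h
  have s' := stationary_of_min hv₁ hv₂ h'
  obtain ⟨hx, -⟩ := mem_Ioo_of_min hr hv₁ one_pos hv₂ hm h
  rw [← s'] at s
  have : 0 < (φ - m₁) / (v₁ + (φ - m₁) ^ 2) := by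
    have := sub_pos.2 hx
    positivity
  exact (mul_right_cancel₀ this.ne' s).symm

lemma strictMonoOn_profile (hv₁ : 0 < v₁) (hv₂ : 0 < v₂) (hm : m₁ < m₂) :
    StrictMonoOn (profile m₁ v₁ m₂ v₂) (Ici 0) := by
  intro r hr r' hr' hlt
  obtain ⟨φ, hφ, h, heq⟩ := exists_profile_eq hv₁ hv₂ hm (lt_of_le_of_lt hr hlt)
  have := profile_le (m₁ := m₁) (m₂ := m₂) hv₁ hv₂ hr φ
  have hpos := logTerm_pos hv₁ hφ.1.ne
  rw [heq]
  nlinarith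

lemma profile_pos (hv₁ : 0 < v₁) (hv₂ : 0 < v₂) (hm : m₁ < m₂) (hr : 0 < r) :
    0 < profile m₁ v₁ m₂ v₂ r := by
  have := strictMonoOn_profile hv₁ hv₂ hm (mem_Ici.2 le_rfl) (mem_Ici.2 hr.le) hr
  rwa [profile_zero hv₁ hv₂] at this

/-- The supporting line at `r` has nonnegative intercept, so scaling its argument by `c ≥ 1` scales
its value by at most `c`. -/
lemma profile_mul_le (hv₁ : 0 < v₁) (hv₂ : 0 < v₂) (hm : m₁ ≤ m₂) (hr : 0 ≤ r) {c : ℝ}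
    (hc : 1 ≤ c) : profile m₁ v₁ m₂ v₂ (c * r) ≤ c * profile m₁ v₁ m₂ v₂ r := by
  obtain ⟨φ, -, h⟩ := exists_rateObj_min (m₁ := m₁) (m₂ := m₂) hr hv₁ zero_le_one hv₂ hm
  rw [profile_eq_of_min h]
  have := profile_le (m₁ := m₁) (m₂ := m₂) hv₁ hv₂ (mul_nonneg (zero_le_one.trans hc) hr) φ
  have := logTerm_nonneg hv₂ m₂ φ
  nlinarith

lemma profile_le_top (hv₁ : 0 < v₁) (hv₂ : 0 < v₂) (hr : 0 ≤ r) :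
    profile m₁ v₁ m₂ v₂ r ≤ logTerm m₂ v₂ m₁ := by
  simpa using profile_le (m₁ := m₁) (m₂ := m₂) hv₁ hv₂ hr m₁

lemma profile_sub_le (hv₁ : 0 < v₁) (hv₂ : 0 < v₂) (hm : m₁ ≤ m₂) (hr : 0 ≤ r) (hr' : r ≤ r') :
    profile m₁ v₁ m₂ v₂ r' - profile m₁ v₁ m₂ v₂ r ≤ (r' - r) * logTerm m₁ v₁ m₂ := by
  obtain ⟨φ, hφ, h⟩ := exists_rateObj_min (m₁ := m₁) (m₂ := m₂) hr hv₁ zero_le_one hv₂ hm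
  rw [profile_eq_of_min h]
  have h1 := profile_le (m₁ := m₁) (m₂ := m₂) hv₁ hv₂ (hr.trans hr') φ
  have h2 : logTerm m₁ v₁ φ ≤ logTerm m₁ v₁ m₂ :=
    logTerm_mono hv₁ (by nlinarith [hφ.1, hφ.2])
  nlinarith

lemma continuousOn_profile (hv₁ : 0 < v₁) (hv₂ : 0 < v₂) (hm : m₁ < m₂) :
    ContinuousOn (profile m₁ v₁ m₂ v₂) (Ici 0) := by
  have hL := logTerm_nonneg hv₁ m₁ m₂
  refine (LipschitzOnWith.of_dist_le_mul (K := ⟨logTerm m₁ v₁ m₂, hL⟩) ?_).continuousOn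
  have key : ∀ r ∈ Ici (0 : ℝ), ∀ r' ∈ Ici (0 : ℝ), r ≤ r' →
      dist (profile m₁ v₁ m₂ v₂ r) (profile m₁ v₁ m₂ v₂ r') ≤ logTerm m₁ v₁ m₂ * dist r r' := by
    intro r hr r' hr' hle
    have h1 := profile_sub_le hv₁ hv₂ hm.le hr hle
    have h2 := (strictMonoOn_profile hv₁ hv₂ hm).monotoneOn hr hr' hle
    rw [dist_comm, Real.dist_eq, abs_of_nonneg (by linarith), dist_comm, Real.dist_eq,
      abs_of_nonneg (by linarith)]
    linarith
  intro r hr r' hr'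
  rcases le_total r r' with h | h
  · exact key r hr r' hr' h
  · rw [dist_comm, dist_comm r]; exact key r' hr' r hr h

lemma exists_profile_eq_of_le (hv₁ : 0 < v₁) (hv₂ : 0 < v₂) (hm : m₁ < m₂) (hr : 0 ≤ r) {W : ℝ}
    (hW : 0 ≤ W) (h : W ≤ profile m₁ v₁ m₂ v₂ r) :
    ∃ s ∈ Icc 0 r, profile m₁ v₁ m₂ v₂ s = W := by
  have := intermediate_value_Icc hr
    ((continuousOn_profile hv₁ hv₂ hm).mono (Icc_subset_Ici_self))
  rw [profile_zero hv₁ hv₂] at this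
  exact this ⟨hW, h⟩

/-- Bernoulli's inequality after taking logarithms. -/
lemma log_one_add_mul_le {c x : ℝ} (hc : 1 ≤ c) (hx : 0 ≤ x) :
    Real.log (1 + c * x) ≤ c * Real.log (1 + x) := by
  have h := one_add_mul_self_le_rpow_one_add (s := x) (by linarith) hc
  calc Real.log (1 + c * x) ≤ Real.log ((1 + x) ^ c) :=
        Real.log_le_log (by positivity) h
    _ = c * Real.log (1 + x) := Real.log_rpow (by positivity) c

/-- Changing means and variances changes the profile at most by a constant factor. -/
lemma profile_perturb {n₁ w₁ n₂ w₂ c : ℝ} (hv₁ : 0 < v₁) (hv₂ : 0 < v₂) (hm : m₁ < m₂)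
    (hw₁ : 0 < w₁) (hw₂ : 0 < w₂) (hr : 0 ≤ r) (hc : 1 ≤ c)
    (h₁ : (n₂ - n₁) ^ 2 / w₁ ≤ c * ((m₂ - m₁) ^ 2 / v₁))
    (h₂ : (n₂ - n₁) ^ 2 / w₂ ≤ c * ((m₂ - m₁) ^ 2 / v₂)) :
    profile n₁ w₁ n₂ w₂ r ≤ c * profile m₁ v₁ m₂ v₂ r := by
  obtain ⟨φ, -, h⟩ := exists_rateObj_min (m₁ := m₁) (m₂ := m₂) hr hv₁ zero_le_one hv₂ hm.le
  rw [profile_eq_of_min h]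
  have hd : m₂ - m₁ ≠ 0 := (sub_pos.2 hm).ne'
  -- The relative position `l` of the minimiser is reused for the other pair of means. Each squared
  -- distance is then the squared gap times `l ^ 2` or `(1 - l) ^ 2`, so only the gaps and the
  -- variances have to be compared.
  obtain ⟨l, rfl⟩ : ∃ l, φ = m₁ + l * (m₂ - m₁) := ⟨(φ - m₁) / (m₂ - m₁), by field_simp; ring⟩
  refine (profile_le hw₁ hw₂ hr (n₁ + l * (n₂ - n₁))).trans ?_
  have key : ∀ (p q n w m v : ℝ), 0 < w → 0 < v → (n - q) ^ 2 / w ≤ c * ((m - p) ^ 2 / v) →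
      logTerm n w q ≤ c * logTerm m v p := by
    intro p q n w m v hw hv hle
    refine le_trans ?_ (log_one_add_mul_le hc (by positivity))
    unfold logTerm
    exact Real.log_le_log (by positivity) (by linarith)
  have k₁ : logTerm n₁ w₁ (n₁ + l * (n₂ - n₁)) ≤ c * logTerm m₁ v₁ (m₁ + l * (m₂ - m₁)) := by
    apply key _ _ _ _ _ _ hw₁ hv₁
    calc (n₁ - (n₁ + l * (n₂ - n₁))) ^ 2 / w₁ = l ^ 2 * ((n₂ - n₁) ^ 2 / w₁) := by ring
      _ ≤ l ^ 2 * (c * ((m₂ - m₁) ^ 2 / v₁)) := by gcongr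
      _ = _ := by ring
  have k₂ : logTerm n₂ w₂ (n₁ + l * (n₂ - n₁)) ≤ c * logTerm m₂ v₂ (m₁ + l * (m₂ - m₁)) := by
    apply key _ _ _ _ _ _ hw₂ hv₂
    calc (n₂ - (n₁ + l * (n₂ - n₁))) ^ 2 / w₂ = (1 - l) ^ 2 * ((n₂ - n₁) ^ 2 / w₂) := by ring
      _ ≤ (1 - l) ^ 2 * (c * ((m₂ - m₁) ^ 2 / v₂)) := by gcongr
      _ = _ := by ring
  calc r * logTerm n₁ w₁ (n₁ + l * (n₂ - n₁)) + logTerm n₂ w₂ (n₁ + l * (n₂ - n₁))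
      ≤ r * (c * logTerm m₁ v₁ (m₁ + l * (m₂ - m₁))) +
        c * logTerm m₂ v₂ (m₁ + l * (m₂ - m₁)) := by gcongr
    _ = _ := by ring

end Profile

/-! ### Existence, uniqueness and shape of the optimal allocation -/

/-- The profile of design `i` against the best design `b`. -/
noncomputable def designProfile {k : ℕ} (m v : Fin k → ℝ) (b i : Fin k) (r : ℝ) : ℝ :=
  profile (m i) (v i) (m b) (v b) r

/-- The objective of the allocation problem. -/
noncomputable def allocValue {k : ℕ} (m v : Fin k → ℝ) (b : Fin k) (β : Fin k → ℝ) : ℝ :=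
  ⨅ i : {i : Fin k // i ≠ b}, rate (β i) (m i) (v i) (β b) (m b) (v b)

/-- The sum of the entries other than `b`. -/
def sumOthers {k : ℕ} (b : Fin k) (r : Fin k → ℝ) : ℝ := ∑ i ∈ Finset.univ.erase b, r i

/-- The allocation whose proportions relative to that of `b` are `r`. -/
noncomputable def allocOfRatio {k : ℕ} (b : Fin k) (r : Fin k → ℝ) (i : Fin k) : ℝ :=
  if i = b then 1 / (1 + sumOthers b r) else r i / (1 + sumOthers b r)

section Optimal

variable {k : ℕ} {m v : Fin k → ℝ} {b : Fin k}

lemma nonempty_others (hk : 2 ≤ k) : Nonempty {i : Fin k // i ≠ b} := by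
  have : Nontrivial (Fin k) := Fin.nontrivial_iff_two_le.2 hk
  obtain ⟨i, hi⟩ := exists_ne b
  exact ⟨⟨i, hi⟩⟩

lemma sumOthers_nonneg {r : Fin k → ℝ} (hr : ∀ i, i ≠ b → 0 ≤ r i) : 0 ≤ sumOthers b r :=
  Finset.sum_nonneg fun i hi => hr i (Finset.ne_of_mem_erase hi)

lemma sum_eq_sumOthers (b : Fin k) (r : Fin k → ℝ) : ∑ i, r i = r b + sumOthers b r :=
  (Finset.add_sum_erase _ _ (Finset.mem_univ b)).symm

lemma allocOfRatio_mem {r : Fin k → ℝ} (hr : ∀ i, i ≠ b → 0 ≤ r i) :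
    allocOfRatio b r ∈ stdSimplex ℝ (Fin k) := by
  have h0 := sumOthers_nonneg hr
  refine ⟨fun i => ?_, ?_⟩
  · unfold allocOfRatio
    split_ifs with h
    · positivity
    · exact div_nonneg (hr i h) (by positivity)
  · rw [sum_eq_sumOthers b]
    have : sumOthers b (allocOfRatio b r) = sumOthers b r / (1 + sumOthers b r) := by
      conv_lhs => unfold sumOthers
      conv_rhs => rw [sumOthers, Finset.sum_div, ← sumOthers]
      refine Finset.sum_congr rfl fun i hi => ?_
      rw [allocOfRatio, if_neg (Finset.ne_of_mem_erase hi)]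
      rfl
    rw [this, allocOfRatio, if_pos rfl]
    field_simp

lemma rate_eq_designProfile {β : Fin k → ℝ} (hβ : 0 < β b) (i : Fin k) :
    rate (β i) (m i) (v i) (β b) (m b) (v b) = β b / 2 * designProfile m v b i (β i / β b) := by
  rw [designProfile, ← two_mul_rate_div hβ]
  field_simp

/-- By homogeneity the value is half the proportion of `b`, here 1 / (1 + ∑ r), times the smallest
profile. -/
lemma allocValue_allocOfRatio_ge (hk : 2 ≤ k) {r : Fin k → ℝ} (hr : ∀ i, i ≠ b → 0 ≤ r i) {W : ℝ}
    (hW : ∀ i, i ≠ b → W ≤ designProfile m v b i (r i)) :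
    W / (2 * (1 + sumOthers b r)) ≤ allocValue m v b (allocOfRatio b r) := by
  have := nonempty_others (b := b) hk
  have h0 := sumOthers_nonneg hr
  refine le_ciInf fun i => ?_
  have hb : allocOfRatio b r b = 1 / (1 + sumOthers b r) := if_pos rfl
  have hi : allocOfRatio b r i = r i / (1 + sumOthers b r) := if_neg i.2
  rw [rate_eq_designProfile (by rw [hb]; positivity), hb, hi]
  have : r i / (1 + sumOthers b r) / (1 / (1 + sumOthers b r)) = r i := by field_simp
  rw [this]
  calc W / (2 * (1 + sumOthers b r)) = 1 / (1 + sumOthers b r) / 2 * W := by field_simp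
    _ ≤ _ := by gcongr; exact hW i i.2

variable (hv : ∀ i, 0 < v i)
include hv

/-- For fixed φ the objective is continuous in the allocation, and infima of such functions are
upper semicontinuous. This is enough for a maximum on the compact simplex. -/
lemma exists_isOptimalAllocation :
    ∃ α, IsOptimalAllocation m v b α := by
  have hu : UpperSemicontinuousOn (allocValue m v b) (stdSimplex ℝ (Fin k)) := by
    apply upperSemicontinuousOn_ciInf
    · intro x hx
      exact (Set.finite_range _).bddBelow
    · intro i
      unfold rate
      apply upperSemicontinuousOn_ciInf
      · intro x hx
        refine ⟨0, ?_⟩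
        rintro _ ⟨φ, rfl⟩
        exact rateObj_nonneg (hx.1 i) (hv i) (hx.1 b) (hv b) φ
      · intro φ
        apply ContinuousOn.upperSemicontinuousOn
        apply Continuous.continuousOn
        unfold rateObj
        fun_prop
  obtain ⟨α, hα, hmax⟩ := hu.exists_isMaxOn ⟨Pi.single b 1, single_mem_stdSimplex ℝ b⟩
    (isCompact_stdSimplex ℝ (Fin k))
  exact ⟨α, hα, hmax⟩

variable (hb : ∀ i, i ≠ b → m i < m b)
include hb

/-- If some profile exceeded the common level `W`, its ratio could be lowered until the level is
met. The sum of the ratios would drop and the value W / (2 (1 + ∑ r)) would rise. -/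
lemma IsOptimalAllocation.exists_ratio (hk : 2 ≤ k) {α : Fin k → ℝ}
    (h : IsOptimalAllocation m v b α) :
    ∃ r : Fin k → ℝ, ∃ W : ℝ, 0 < W ∧ (∀ i, i ≠ b → 0 < r i ∧ designProfile m v b i (r i) = W) ∧
      α = allocOfRatio b r ∧ allocValue m v b α = W / (2 * (1 + sumOthers b r)) := by
  have hne := nonempty_others (b := b) hk
  obtain ⟨hα, hmax⟩ := h
  have hmax' : ∀ β ∈ stdSimplex ℝ (Fin k), allocValue m v b β ≤ allocValue m v b α :=
    fun β hβ => hmax hβ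
  have hle : ∀ i, i ≠ b → allocValue m v b α ≤ rate (α i) (m i) (v i) (α b) (m b) (v b) :=
    fun i hi => ciInf_le (f := fun i : {i : Fin k // i ≠ b} =>
      rate (α i) (m i) (v i) (α b) (m b) (v b)) (Set.finite_range _).bddBelow ⟨i, hi⟩
  -- positivity of the optimal value
  have hpos : 0 < allocValue m v b α := by
    obtain ⟨i₀, hi₀⟩ := exists_eq_ciInf_of_finite
      (f := fun i : {i : Fin k // i ≠ b} => designProfile m v b i 1)
    have hp : 0 < designProfile m v b i₀ 1 :=
      profile_pos (hv _) (hv _) (hb _ i₀.2) one_pos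
    have h1 := allocValue_allocOfRatio_ge (m := m) (v := v) (b := b) hk (r := fun _ => 1)
      (fun _ _ => zero_le_one) (W := designProfile m v b i₀ 1) (fun i hi => by
        rw [hi₀]
        exact ciInf_le (f := fun i : {i : Fin k // i ≠ b} => designProfile m v b i 1)
          (Set.finite_range _).bddBelow ⟨i, hi⟩)
    have h0 := sumOthers_nonneg (b := b) (r := fun _ => 1) (fun _ _ => zero_le_one)
    exact lt_of_lt_of_le (by positivity) (h1.trans (hmax' _ (allocOfRatio_mem fun _ _ => zero_le_one)))
  have hαb : 0 < α b := by
    refine lt_of_le_of_ne (hα.1 b) fun h0 => ?_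
    obtain ⟨i, hi⟩ := hne
    have h1 := hle i hi
    have h2 := rate_le_rateObj (m₁ := m i) (m₂ := m b) (hα.1 i) (hv i) (hα.1 b) (hv b) (m i)
    rw [rateObj_eq, logTerm_self, ← h0] at h2
    simp only [mul_zero, zero_div, zero_mul, add_zero, ← h0] at h1 h2
    linarith
  set r : Fin k → ℝ := fun i => α i / α b with hr
  have hr0 : ∀ i, 0 ≤ r i := fun i => div_nonneg (hα.1 i) hαb.le
  have hsum : 1 + sumOthers b r = 1 / α b := by
    have h1 : ∑ i, r i = 1 / α b := by rw [hr, ← Finset.sum_div, hα.2]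
    rw [← h1, sum_eq_sumOthers b r, hr]
    simp only [div_self hαb.ne']
  have hαr : α = allocOfRatio b r := by
    ext i
    unfold allocOfRatio
    rw [hsum]
    split_ifs with h
    · rw [h]; field_simp
    · rw [hr]; field_simp
  set W := 2 / α b * allocValue m v b α with hWdef
  have hW : 0 < W := by positivity
  have hval : allocValue m v b α = W / (2 * (1 + sumOthers b r)) := by
    rw [hsum, hWdef]; field_simp
  have hge : ∀ i, i ≠ b → W ≤ designProfile m v b i (r i) := by
    intro i hi
    have h1 := hle i hi
    rw [rate_eq_designProfile hαb] at h1
    have h2 := mul_le_mul_of_nonneg_left h1 (show 0 ≤ 2 / α b by positivity)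
    rw [← hWdef] at h2
    refine h2.trans (le_of_eq ?_)
    rw [hr]
    field_simp
  -- all rates are equal at the optimum
  have heq : ∀ i, i ≠ b → designProfile m v b i (r i) = W := by
    have hex : ∀ i, ∃ s, i ≠ b → s ∈ Icc 0 (r i) ∧ designProfile m v b i s = W := by
      intro i
      by_cases hi : i = b
      · exact ⟨0, fun h => absurd hi h⟩
      · obtain ⟨s, hs, hsW⟩ := exists_profile_eq_of_le (hv i) (hv b) (hb i hi) (hr0 i) hW.le (hge i hi)
        exact ⟨s, fun _ => ⟨hs, hsW⟩⟩
    choose s hs using hex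
    have hs0 : ∀ i, i ≠ b → 0 ≤ s i := fun i hi => (hs i hi).1.1
    have h1 := allocValue_allocOfRatio_ge (m := m) (v := v) (b := b) hk hs0
      (W := W) fun i hi => (hs i hi).2.ge
    have h2 := h1.trans (hmax' _ (allocOfRatio_mem hs0))
    rw [hval] at h2
    have p1 := sumOthers_nonneg hs0
    have p2 := sumOthers_nonneg (b := b) (r := r) fun i _ => hr0 i
    rw [div_le_div_iff_of_pos_left hW (by positivity) (by positivity)] at h2
    have h3 : sumOthers b r ≤ sumOthers b s := by linarith
    intro i hi
    have h4 : s i = r i := by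
      by_contra hcon
      have hlt : s i < r i := lt_of_le_of_ne (hs i hi).1.2 hcon
      have : sumOthers b s < sumOthers b r :=
        Finset.sum_lt_sum (fun j hj => (hs j (Finset.ne_of_mem_erase hj)).1.2)
          ⟨i, Finset.mem_erase.2 ⟨hi, Finset.mem_univ i⟩, hlt⟩
      linarith
    rw [← h4]; exact (hs i hi).2
  refine ⟨r, W, hW, fun i hi => ⟨lt_of_le_of_ne (hr0 i) fun h0 => ?_, heq i hi⟩, hαr, hval⟩
  have := heq i hi
  rw [← h0, designProfile, profile_zero (hv i) (hv b)] at this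
  exact hW.ne this

lemma designProfile_midpoint {i : Fin k} (hi : i ≠ b) {r s : ℝ} (hr : 0 < r) (hs : 0 < s)
    (hne : r ≠ s) :
    (designProfile m v b i r + designProfile m v b i s) / 2 <
      designProfile m v b i ((r + s) / 2) := by
  obtain ⟨φ, -, h, heq⟩ := exists_profile_eq (r := (r + s) / 2) (hv i) (hv b) (hb i hi) (by linarith)
  have h1 := profile_lt_of_min (r := (r + s) / 2) (hv i) (hv b) (hb i hi) (by linarith) hr.le
    (fun h => hne (by linarith)) h
  have h2 := profile_lt_of_min (r := (r + s) / 2) (hv i) (hv b) (hb i hi) (by linarith) hs.le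
    (fun h => hne (by linarith)) h
  unfold designProfile
  rw [heq]
  linarith

/-- Two optima with the same level have the same ratios because profiles are injective. With
different levels, strict concavity lifts all profiles at the averaged ratios strictly above the
averaged level, so the averaged ratios would give a strictly larger value. -/
lemma IsOptimalAllocation.unique (hk : 2 ≤ k) {α β : Fin k → ℝ}
    (hα : IsOptimalAllocation m v b α) (hβ : IsOptimalAllocation m v b β) : α = β := by
  obtain ⟨r, W, hW, hr, hαr, hαW⟩ := hα.exists_ratio hv hb hk
  obtain ⟨s, V, hV, hs, hβs, hβV⟩ := hβ.exists_ratio hv hb hk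
  have hval : allocValue m v b α = allocValue m v b β := le_antisymm (hβ.2 hα.1) (hα.2 hβ.1)
  have hr0 := sumOthers_nonneg fun i hi => (hr i hi).1.le
  have hs0 := sumOthers_nonneg fun i hi => (hs i hi).1.le
  by_cases hWV : W = V
  · have : ∀ i, i ≠ b → r i = s i := by
      intro i hi
      apply (strictMonoOn_profile (hv i) (hv b) (hb i hi)).injOn (hr i hi).1.le (hs i hi).1.le
      exact (hr i hi).2.trans (hWV.trans (hs i hi).2.symm)
    have hsum : sumOthers b r = sumOthers b s :=
      Finset.sum_congr rfl fun i hi => this i (Finset.ne_of_mem_erase hi)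
    rw [hαr, hβs]
    ext i
    unfold allocOfRatio
    rw [hsum]
    split_ifs with h
    · rfl
    · rw [this i h]
  · exfalso
    set t : Fin k → ℝ := fun i => (r i + s i) / 2 with ht
    have ht0 : ∀ i, i ≠ b → 0 ≤ t i := fun i hi => by
      have := (hr i hi).1; have := (hs i hi).1; simp only [ht]; linarith
    have hlt : ∀ i, i ≠ b → (W + V) / 2 < designProfile m v b i (t i) := by
      intro i hi
      have hne : r i ≠ s i := by
        intro h
        apply hWV
        rw [← (hr i hi).2, ← (hs i hi).2, h]
      have := designProfile_midpoint hv hb hi (hr i hi).1 (hs i hi).1 hne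
      rwa [(hr i hi).2, (hs i hi).2] at this
    have hne := nonempty_others (b := b) hk
    obtain ⟨i₀, hi₀⟩ := exists_eq_ciInf_of_finite
      (f := fun i : {i : Fin k // i ≠ b} => designProfile m v b i (t i))
    have h1 := allocValue_allocOfRatio_ge (m := m) (v := v) (b := b) hk ht0
      (W := designProfile m v b i₀ (t i₀)) (fun i hi => by
        rw [hi₀]
        exact ciInf_le (f := fun i : {i : Fin k // i ≠ b} => designProfile m v b i (t i))
          (Set.finite_range _).bddBelow ⟨i, hi⟩)
    have h2 : allocValue m v b (allocOfRatio b t) ≤ allocValue m v b α :=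
      hα.2 (allocOfRatio_mem ht0)
    have hsum : sumOthers b t = (sumOthers b r + sumOthers b s) / 2 := by
      simp only [sumOthers, ht]
      rw [← Finset.sum_add_distrib, Finset.sum_div]
    have h3 := hlt i₀ i₀.2
    rw [hβV, hαW] at hval
    rw [div_eq_div_iff (by positivity) (by positivity)] at hval
    have h4 := h1.trans h2
    rw [hαW, hsum, div_le_div_iff₀ (by positivity) (by positivity)] at h4
    nlinarith

/-- The optimal allocation in terms of ratios, with a strict optimality inequality among the
allocations that equalise the rates. -/
theorem exists_unique_optimal (hk : 2 ≤ k) :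
    ∃ r : Fin k → ℝ, ∃ W : ℝ, 0 < W ∧
      (∀ i, i ≠ b → 0 < r i ∧ designProfile m v b i (r i) = W) ∧
      IsOptimalAllocation m v b (allocOfRatio b r) ∧
      (∀ β, IsOptimalAllocation m v b β → β = allocOfRatio b r) ∧
      ∀ (s : Fin k → ℝ) (V : ℝ), V ≠ W →
        (∀ i, i ≠ b → 0 ≤ s i ∧ designProfile m v b i (s i) = V) →
        V * (1 + sumOthers b r) < W * (1 + sumOthers b s) := by
  obtain ⟨α, hα⟩ := exists_isOptimalAllocation (m := m) (b := b) hv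
  obtain ⟨r, W, hW, hr, hαr, hαW⟩ := hα.exists_ratio hv hb hk
  subst hαr
  refine ⟨r, W, hW, hr, hα, fun β hβ => hβ.unique hv hb hk hα, fun s V hVW hs => ?_⟩
  have hr0 := sumOthers_nonneg fun i hi => (hr i hi).1.le
  have hs0 := sumOthers_nonneg fun i hi => (hs i hi).1
  have h1 := allocValue_allocOfRatio_ge (m := m) (v := v) (b := b) hk (fun i hi => (hs i hi).1)
    (W := V) fun i hi => (hs i hi).2.ge
  have hmem := allocOfRatio_mem fun i hi => (hs i hi).1
  have h2 : allocValue m v b (allocOfRatio b s) ≤ allocValue m v b (allocOfRatio b r) :=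
    hα.2 hmem
  have h3 : V / (2 * (1 + sumOthers b s)) < W / (2 * (1 + sumOthers b r)) := by
    rw [← hαW]
    -- In case of equality the allocation with ratios `s` is optimal as well. By uniqueness it has
    -- the same ratios as the one with `r`, which forces `V = W`.
    refine lt_of_le_of_ne (h1.trans h2) fun heq => hVW ?_
    have hopt : IsOptimalAllocation m v b (allocOfRatio b s) := by
      refine ⟨hmem, fun β hβ => ?_⟩
      have h5 : allocValue m v b β ≤ allocValue m v b (allocOfRatio b r) := hα.2 hβ
      exact h5.trans (heq.symm.le.trans h1)
    have hE := hopt.unique hv hb hk hα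
    have hbb := congrFun hE b
    simp only [allocOfRatio, if_true] at hbb
    have hsum : 1 + sumOthers b s = 1 + sumOthers b r := by
      rw [div_eq_div_iff (by positivity) (by positivity)] at hbb
      linarith
    obtain ⟨i, hi⟩ := nonempty_others (b := b) hk
    have hii := congrFun hE i
    simp only [allocOfRatio, if_neg hi, hsum] at hii
    rw [div_left_inj' (by positivity)] at hii
    rw [← (hs i hi).2, ← (hr i hi).2, hii]
  rw [div_lt_div_iff₀ (by positivity) (by positivity)] at h3
  linarith

end Optimal

/-! ### Sample counts and the balancing dynamics -/

lemma count_succ {k : ℕ} (n₀ : ℕ) (I : ℕ → Fin k) (t : ℕ) (i : Fin k) :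
    count n₀ I (t + 1) i = count n₀ I t i + if I t = i then 1 else 0 := by
  unfold count
  rw [Finset.range_add_one, Finset.filter_insert]
  split_ifs with h
  · rw [Finset.card_insert_of_notMem (by simp)]; ring
  · ring

lemma count_zero {k : ℕ} (n₀ : ℕ) (I : ℕ → Fin k) (i : Fin k) : count n₀ I 0 i = n₀ := by
  simp [count]

lemma le_count {k : ℕ} (n₀ : ℕ) (I : ℕ → Fin k) (t : ℕ) (i : Fin k) : n₀ ≤ count n₀ I t i :=
  Nat.le_add_right _ _

lemma count_mono {k : ℕ} (n₀ : ℕ) (I : ℕ → Fin k) (i : Fin k) :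
    Monotone fun t => count n₀ I t i :=
  monotone_nat_of_le_succ fun t => by rw [count_succ]; exact Nat.le_add_right _ _

lemma exists_sampled {k : ℕ} {n₀ : ℕ} {I : ℕ → Fin k} {i : Fin k}
    (h : Filter.Tendsto (fun t => count n₀ I t i) Filter.atTop Filter.atTop) (T : ℕ) :
    ∃ t, T ≤ t ∧ I t = i := by
  by_contra! hcon
  have hconst : ∀ t, T ≤ t → count n₀ I t i = count n₀ I T i := by
    intro t ht
    induction t, ht using Nat.le_induction with
    | base => rfl
    | succ t ht ih => rw [count_succ, if_neg (hcon t ht), ih, add_zero]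
  obtain ⟨t, ht, ht'⟩ := ((h.eventually_ge_atTop (count n₀ I T i + 1)).and
    (Filter.eventually_ge_atTop T)).exists
  have := hconst t ht'
  omega

/-- The number of observations of design `i` relative to that of design `b`. -/
noncomputable def countRatio {k : ℕ} (n₀ : ℕ) (I : ℕ → Fin k) (b : Fin k) (t : ℕ) (i : Fin k) : ℝ :=
  (count n₀ I t i : ℝ) / count n₀ I t b

section Dynamics

variable {k : ℕ} {b : Fin k} {G : Fin k → ℝ → ℝ} {n₀ : ℕ} {I : ℕ → Fin k} {W C : ℝ}
  {r : Fin k → ℝ}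

lemma countRatio_pos (hn₀ : 1 ≤ n₀) (t : ℕ) (i : Fin k) : 0 < countRatio n₀ I b t i := by
  have h1 := hn₀.trans (le_count n₀ I t i)
  have h2 := hn₀.trans (le_count n₀ I t b)
  unfold countRatio
  positivity

lemma countRatio_succ_le (hn₀ : 1 ≤ n₀) (t : ℕ) {i : Fin k} (h : I t ≠ i) :
    countRatio n₀ I b (t + 1) i ≤ countRatio n₀ I b t i := by
  unfold countRatio
  rw [count_succ n₀ I t i, if_neg h, add_zero]
  have h1 := hn₀.trans (le_count n₀ I t b)
  have h2 : count n₀ I t b ≤ count n₀ I (t + 1) b := count_mono n₀ I b (Nat.le_succ t)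
  gcongr

/-- If the design sampled among those other than `b` always has nearly the smallest value `G`, and
`b` is sampled when all values exceed `W` and not sampled when all are below `W`, then all values
converge to `W`. -/
theorem tendsto_of_balanced_sampling (hn₀ : 1 ≤ n₀)
    (hmono : ∀ i, i ≠ b → StrictMonoOn (G i) (Ici 0))
    (hscale : ∀ i, i ≠ b → ∀ c s : ℝ, 1 ≤ c → 0 ≤ s → G i (c * s) ≤ c * G i s)
    (hC : ∀ i, i ≠ b → ∀ s : ℝ, 0 ≤ s → G i s ≤ C)
    (hr : ∀ i, i ≠ b → 0 < r i ∧ G i (r i) = W)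
    (hinf : ∀ i, Tendsto (fun t => count n₀ I t i) atTop atTop)
    (hmin : ∀ ε > 0, ∀ᶠ t in atTop, I t ≠ b → ∀ j, j ≠ b →
      G (I t) (countRatio n₀ I b t (I t)) ≤ G j (countRatio n₀ I b t j) + ε)
    (hhigh : ∀ ε > 0, ∀ᶠ t in atTop, (∀ i, i ≠ b → W + ε ≤ G i (countRatio n₀ I b t i)) → I t = b)
    (hlow : ∀ ε > 0, ∀ᶠ t in atTop, (∀ i, i ≠ b → G i (countRatio n₀ I b t i) ≤ W - ε) → I t ≠ b) :
    ∀ ε > 0, ∀ᶠ t in atTop, ∀ i, i ≠ b → |G i (countRatio n₀ I b t i) - W| ≤ ε := by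
  set R := countRatio n₀ I b with hR
  have hRpos : ∀ t i, 0 < R t i := fun t i => countRatio_pos hn₀ t i
  have hRmem : ∀ t i, R t i ∈ Ici (0 : ℝ) := fun t i => (hRpos t i).le
  have hle_of_ne : ∀ t i, i ≠ b → I t ≠ i → G i (R (t + 1) i) ≤ G i (R t i) := by
    intro t i hi h
    exact (hmono i hi).monotoneOn (hRmem _ _) (hRmem _ _) (countRatio_succ_le hn₀ t h)
  -- One observation of `i` multiplies its ratio by 1 + 1 / N_i. By `hscale` and the bound `C` the
  -- value rises by at most C / N_i, which tends to 0.
  have hstep : ∀ ε > 0, ∀ᶠ t in atTop, ∀ i, i ≠ b → I t = i →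
      G i (R (t + 1) i) ≤ G i (R t i) + ε := by
    intro ε hε
    have h1 : ∀ i, ∀ᶠ t in atTop, C / ε ≤ (count n₀ I t i : ℝ) := fun i =>
      (tendsto_natCast_atTop_atTop.comp (hinf i)).eventually_ge_atTop _
    filter_upwards [eventually_all.2 h1] with t ht i hi hIt
    have hpos : (0 : ℝ) < count n₀ I t i := by
      have := hn₀.trans (le_count n₀ I t i)
      positivity
    have e : R (t + 1) i = (1 + 1 / (count n₀ I t i : ℝ)) * R t i := by
      simp only [hR, countRatio]
      rw [count_succ, count_succ, if_pos hIt, if_neg (by rw [hIt]; exact hi)]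
      push_cast
      field_simp
      simp
    have h2 := hscale i hi (1 + 1 / (count n₀ I t i : ℝ)) (R t i)
      (by have : 0 ≤ 1 / (count n₀ I t i : ℝ) := by positivity
          linarith) (hRpos t i).le
    rw [← e] at h2
    have h3 := hC i hi (R t i) (hRpos t i).le
    have h4 : 1 / (count n₀ I t i : ℝ) * G i (R t i) ≤ ε := by
      have h5 := ht i
      rw [div_le_iff₀ hε] at h5
      rw [div_mul_eq_mul_div, one_mul, div_le_iff₀ hpos]
      linarith
    linarith
  -- upper bound
  have hupper : ∀ ε > 0, ∀ᶠ t in atTop, ∀ i, i ≠ b → G i (R t i) ≤ W + ε := by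
    intro ε hε
    have hε3 : 0 < ε / 3 := by positivity
    obtain ⟨T, hT⟩ := eventually_atTop.1
      ((hmin _ hε3).and ((hhigh _ hε3).and (hstep _ hε3)))
    rw [eventually_all]
    intro i
    obtain ⟨w, hw, hIw⟩ := exists_sampled (hinf i) T
    filter_upwards [eventually_ge_atTop (w + 1)] with t ht hi
    -- When `i` is sampled, some value is below `W + ε / 3`, since otherwise `b` would have been
    -- sampled. The value of `i` exceeds that one by at most `ε / 3`, and the observation adds at
    -- most `ε / 3`. Between observations of `i` its value cannot increase.
    have hsamp : ∀ t, T ≤ t → I t = i → G i (R (t + 1) i) ≤ W + ε := by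
      intro t ht hIt
      obtain ⟨h1, h2, h3⟩ := hT t ht
      have hne : I t ≠ b := by rw [hIt]; exact hi
      have h4 : ∃ j, j ≠ b ∧ G j (R t j) < W + ε / 3 := by
        by_contra! hcon
        exact hne (h2 hcon)
      obtain ⟨j, hj, hj'⟩ := h4
      have h5 := h1 hne j hj
      rw [hIt] at h5
      have h6 := h3 i hi hIt
      linarith
    induction t, ht using Nat.le_induction with
    | base => exact hsamp w hw hIw
    | succ t ht ih =>
      by_cases hIt : I t = i
      · exact hsamp t (by omega) hIt
      · exact (hle_of_ne t i hi hIt).trans ih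
  -- lower bound
  have hlower : ∀ η > 0, ∀ᶠ t in atTop, ∀ i, i ≠ b → W - η ≤ G i (R t i) := by
    intro η hη
    -- The factor `q ^ 3` will bound the growth of the count of `b` since the last time at which no
    -- value was small, and hence also the loss in each value since then.
    have hq : ∃ q : ℝ, 1 < q ∧ W - η < W / q ^ 3 := by
      have hc : Tendsto (fun q : ℝ => W / q ^ 3) (𝓝[>] 1) (𝓝 W) := by
        have : ContinuousAt (fun q : ℝ => W / q ^ 3) 1 :=
          continuousAt_const.div (by fun_prop) (by norm_num)
        have h := this.tendsto
        simp only [one_pow, div_one] at h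
        exact h.mono_left nhdsWithin_le_nhds
      obtain ⟨q, h1, h2⟩ := ((hc.eventually (lt_mem_nhds (by linarith : W - η < W))).and
        self_mem_nhdsWithin).exists
      exact ⟨q, h2, h1⟩
    obtain ⟨q, hq1, hqW⟩ := hq
    have hq0 : 0 < q := by linarith
    have hε : ∃ ε : ℝ, 0 < ε ∧ W - η < (W - 2 * ε) / q ^ 3 ∧
        ∀ i, i ≠ b → W + 2 * ε < G i (r i * q) ∧ G i (r i / q) < W - ε := by
      have c1 : Tendsto (fun ε : ℝ => (W - 2 * ε) / q ^ 3) (𝓝[>] 0) (𝓝 (W / q ^ 3)) := by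
        have : ContinuousAt (fun ε : ℝ => (W - 2 * ε) / q ^ 3) 0 := by fun_prop
        have h := this.tendsto
        simp only [mul_zero, sub_zero] at h
        exact h.mono_left nhdsWithin_le_nhds
      have c2 : Tendsto (fun ε : ℝ => W + 2 * ε) (𝓝[>] 0) (𝓝 W) := by
        have : ContinuousAt (fun ε : ℝ => W + 2 * ε) 0 := by fun_prop
        have h := this.tendsto
        simp only [mul_zero, add_zero] at h
        exact h.mono_left nhdsWithin_le_nhds
      have c3 : Tendsto (fun ε : ℝ => W - ε) (𝓝[>] 0) (𝓝 W) := by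
        have : ContinuousAt (fun ε : ℝ => W - ε) 0 := by fun_prop
        have h := this.tendsto
        simp only [sub_zero] at h
        exact h.mono_left nhdsWithin_le_nhds
      have c4 : ∀ i, ∀ᶠ ε in 𝓝[>] (0 : ℝ), i ≠ b →
          W + 2 * ε < G i (r i * q) ∧ G i (r i / q) < W - ε := by
        intro i
        by_cases hi : i = b
        · exact Eventually.of_forall fun _ h => absurd hi h
        obtain ⟨h1, h2⟩ := hr i hi
        have l1 : W < G i (r i * q) := by
          rw [← h2]
          exact hmono i hi h1.le (mem_Ici.2 (by positivity)) (by nlinarith)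
        have l2 : G i (r i / q) < W := by
          conv_rhs => rw [← h2]
          exact hmono i hi (mem_Ici.2 (by positivity)) h1.le (div_lt_self h1 hq1)
        filter_upwards [c2.eventually (gt_mem_nhds l1), c3.eventually (lt_mem_nhds l2)] with ε e1 e2 _
        exact ⟨e1, e2⟩
      obtain ⟨ε, h1, h2, h3⟩ := ((c1.eventually (lt_mem_nhds hqW)).and
        ((eventually_all.2 c4).and self_mem_nhdsWithin)).exists
      exact ⟨ε, h3, h1, h2⟩
    obtain ⟨ε, hε0, hεη, hεr⟩ := hε
    have hε4 : 0 < ε / 4 := by positivity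
    obtain ⟨T, hT⟩ := eventually_atTop.1
      ((hupper (2 * ε) (by positivity)).and ((hmin _ hε4).and ((hstep _ hε4).and (hlow _ hε0))))
    have hbpos : ∀ t, (1 : ℝ) ≤ count n₀ I t b := fun t => by
      exact_mod_cast hn₀.trans (le_count n₀ I t b)
    -- During a phase in which some value is always below `W - 2 * ε`, the count of `b` grows by a
    -- factor `q ^ 2` at most, up to one observation. If `b` is sampled at `t`, then by `hlow` some
    -- `j` has a value above `W - ε`, and `hinv` shows that `j` has not been sampled since `s`. Its
    -- ratio was at most `r j * q` at `s`, by the upper bound, and is above `r j / q` at `t`; as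
    -- only the count of `b` has changed, this limits its growth.
    have hphase : ∀ s t, T ≤ s → s ≤ t →
        (∀ w, s ≤ w → w < t → ∃ i, i ≠ b ∧ G i (R w i) < W - 2 * ε) →
        (count n₀ I t b : ℝ) ≤ q ^ 2 * count n₀ I s b + 1 := by
      intro s t hs hst
      induction t, hst using Nat.le_induction with
      | base =>
        intro _
        have := hbpos s
        have hq2 : 1 ≤ q ^ 2 := one_le_pow₀ hq1.le
        nlinarith
      | succ t hst ih =>
        intro hph
        have ih' := ih fun w h1 h2 => hph w h1 (by omega)
        by_cases hIt : I t = b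
        · rw [count_succ, if_pos hIt]
          push_cast
          by_contra hcon
          have hbig : q ^ 2 * count n₀ I s b < count n₀ I t b := by linarith
          obtain ⟨-, -, -, h5⟩ := hT t (hs.trans hst)
          have hj : ∃ j, j ≠ b ∧ W - ε < G j (R t j) := by
            by_contra! hno
            exact h5 hno hIt
          obtain ⟨j, hjb, hj⟩ := hj
          -- At an observation of `j` within the phase its value is within `ε / 4` of one below `W -
          -- 2 * ε`, and the observation adds at most `ε / 4`. Afterwards it can only rise at
          -- another such observation, so it stays below `W - ε`.
          have hinv : ∀ w, s ≤ w → w ≤ t →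
              G j (R w j) < W - ε ∨ count n₀ I w j = count n₀ I s j := by
            intro w hw
            induction w, hw using Nat.le_induction with
            | base => exact fun _ => Or.inr rfl
            | succ w hw ihw =>
              intro hwt
              by_cases hIw : I w = j
              · left
                obtain ⟨-, h3, h4, -⟩ := hT w (hs.trans hw)
                obtain ⟨i, hi, hi'⟩ := hph w hw (by omega)
                have h6 := h3 (by rw [hIw]; exact hjb) i hi
                rw [hIw] at h6
                have h7 := h4 j hjb hIw
                linarith
              · rcases ihw (by omega) with h | h
                · exact Or.inl ((hle_of_ne w j hjb hIw).trans_lt h)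
                · right; rw [count_succ, if_neg hIw, h, add_zero]
          rcases hinv t hst le_rfl with h | h
          · linarith
          · obtain ⟨h1, -⟩ := hT s hs
            have h2 := h1 j hjb
            obtain ⟨e1, e2⟩ := hεr j hjb
            obtain ⟨hrj, -⟩ := hr j hjb
            have h3 : R s j ≤ r j * q := by
              by_contra hc
              have := hmono j hjb (mem_Ici.2 (by positivity)) (hRmem s j) (not_le.1 hc)
              linarith
            have h4 : R t j ≤ r j / q := by
              have hs1 := hbpos s
              have ht1 := hbpos t
              have hs0 : (0 : ℝ) < count n₀ I s b := by linarith
              have ht0 : (0 : ℝ) < count n₀ I t b := by linarith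
              simp only [hR, countRatio] at h3 ⊢
              rw [h]
              rw [div_le_iff₀ hs0] at h3
              rw [div_le_div_iff₀ ht0 hq0]
              calc (count n₀ I s j : ℝ) * q ≤ r j * q * count n₀ I s b * q := by gcongr
                _ = r j * (q ^ 2 * count n₀ I s b) := by ring
                _ ≤ r j * count n₀ I t b := by gcongr
            have := (hmono j hjb).monotoneOn (hRmem t j) (mem_Ici.2 (by positivity)) h4
            linarith
        · rw [count_succ, if_neg hIt, add_zero]
          exact ih'
    have hqpos : 0 < q ^ 3 - q ^ 2 := by nlinarith [pow_pos hq0 2]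
    -- From `T'` on, with n the count of `b`, q² (n + 1) + 1 ≤ q³ n. This absorbs the additive terms
    -- of `hphase` and the observation with which a phase starts.
    obtain ⟨T', hT'⟩ := eventually_atTop.1
      (((tendsto_natCast_atTop_atTop (R := ℝ)).comp (hinf b)).eventually_ge_atTop
        ((q ^ 2 + 1) / (q ^ 3 - q ^ 2)))
    simp only [Function.comp_apply] at hT'
    -- a time at which no value is small
    have hex : ∃ t₀, max T T' ≤ t₀ ∧ ∀ i, i ≠ b → W - 2 * ε ≤ G i (R t₀ i) := by
      by_contra! hcon
      obtain ⟨t, ht, ht'⟩ := ((((tendsto_natCast_atTop_atTop (R := ℝ)).comp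
        (hinf b)).eventually_gt_atTop (q ^ 2 * count n₀ I (max T T') b + 1)).and
        (eventually_ge_atTop (max T T'))).exists
      have := hphase (max T T') t (le_max_left _ _) ht' fun w hw _ => hcon w hw
      simp only [Function.comp_apply] at ht
      linarith
    obtain ⟨t₀, ht₀, ht₀'⟩ := hex
    have hTt₀ : T ≤ t₀ := (le_max_left _ _).trans ht₀
    have hT't₀ : T' ≤ t₀ := (le_max_right _ _).trans ht₀
    filter_upwards [eventually_ge_atTop t₀] with t ht
    -- Let `s` be the last time up to `t` without a small value, so that the times after `s` form a
    -- single phase. As the count of `i` does not decrease and that of `b` grows by `q ^ 3` at most,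
    -- the ratio of `i` loses no more than this factor between `s` and `t`.
    have hlast : ∃ s, t₀ ≤ s ∧ s ≤ t ∧ (∀ i, i ≠ b → W - 2 * ε ≤ G i (R s i)) ∧
        ∀ w, s < w → w ≤ t → ∃ i, i ≠ b ∧ G i (R w i) < W - 2 * ε := by
      induction t, ht using Nat.le_induction with
      | base => exact ⟨t₀, le_rfl, le_rfl, ht₀', fun w h1 h2 => by omega⟩
      | succ t ht ih =>
        by_cases h : ∀ i, i ≠ b → W - 2 * ε ≤ G i (R (t + 1) i)
        · exact ⟨t + 1, by omega, le_rfl, h, fun w h1 h2 => by omega⟩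
        · push Not at h
          obtain ⟨s, h1, h2, h3, h4⟩ := ih
          refine ⟨s, h1, by omega, h3, fun w h5 h6 => ?_⟩
          rcases Nat.lt_or_ge t w with h7 | h7
          · have : w = t + 1 := by omega
            rw [this]; exact h
          · exact h4 w h5 h7
    obtain ⟨s, hs1, hs2, hs3, hs4⟩ := hlast
    intro i hi
    have hsb := hbpos s
    have htb := hbpos t
    have hN : (count n₀ I t b : ℝ) ≤ q ^ 3 * count n₀ I s b := by
      have h1 := hT' s (by omega)
      rw [div_le_iff₀ hqpos] at h1
      rcases Nat.lt_or_ge s t with h | h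
      · have h2 := hphase (s + 1) t (by omega) h fun w h1 h2 => hs4 w h1 h2.le
        have h3 : (count n₀ I (s + 1) b : ℝ) ≤ count n₀ I s b + 1 := by
          rw [count_succ]; split_ifs <;> simp
        have h4 : q ^ 2 * count n₀ I (s + 1) b ≤ q ^ 2 * (count n₀ I s b + 1) := by gcongr
        nlinarith
      · have : s = t := by omega
        rw [this]
        have : (1 : ℝ) ≤ q ^ 3 := one_le_pow₀ hq1.le
        nlinarith
    have hRs : R s i ≤ q ^ 3 * R t i := by
      have hmonoi : (count n₀ I s i : ℝ) ≤ count n₀ I t i := by exact_mod_cast count_mono n₀ I i hs2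
      simp only [hR, countRatio]
      rw [← mul_div_assoc, div_le_div_iff₀ (by linarith) (by linarith)]
      calc (count n₀ I s i : ℝ) * count n₀ I t b ≤
          count n₀ I t i * (q ^ 3 * count n₀ I s b) := by gcongr
        _ = _ := by ring
    have hq3 : (1 : ℝ) ≤ q ^ 3 := one_le_pow₀ hq1.le
    have h1 := (hmono i hi).monotoneOn (hRmem s i)
      (mem_Ici.2 (mul_nonneg (by positivity) (hRpos t i).le)) hRs
    have h2 := hscale i hi (q ^ 3) (R t i) hq3 (hRpos t i).le
    have h3 := hs3 i hi
    rw [lt_div_iff₀ (by positivity)] at hεη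
    by_contra hcon
    have h4 : q ^ 3 * G i (R t i) < q ^ 3 * (W - η) := by
      apply mul_lt_mul_of_pos_left (not_le.1 hcon) (by positivity)
    linarith
  intro ε hε
  filter_upwards [hupper ε hε, hlower ε hε] with t h1 h2 i hi
  rw [abs_le]
  constructor
  · have := h2 i hi; linarith
  · have := h1 i hi; linarith

end Dynamics

/-! ### Supporting lines and chords of the profile -/

section Chord

variable {m₁ v₁ m₂ v₂ r r' φ φ' : ℝ}

/-- Testing each minimality inequality with the other minimiser shows that a larger weight on the
first design lowers its log-term and raises that of the second. Uniqueness of the minimisers is not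
needed. -/
lemma logTerm_ratio_mono (hv₁ : 0 < v₁) (hv₂ : 0 < v₂) (hm : m₁ < m₂) (hr : 0 < r) (hlt : r < r')
    (h : ∀ ψ, rateObj r m₁ v₁ 1 m₂ v₂ φ ≤ rateObj r m₁ v₁ 1 m₂ v₂ ψ)
    (h' : ∀ ψ, rateObj r' m₁ v₁ 1 m₂ v₂ φ' ≤ rateObj r' m₁ v₁ 1 m₂ v₂ ψ) :
    logTerm m₂ v₂ φ / logTerm m₁ v₁ φ ≤ logTerm m₂ v₂ φ' / logTerm m₁ v₁ φ' := by
  have h1 := h φ'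
  have h2 := h' φ
  have e1 := two_mul_rateObj (m₁ := m₁) (v₁ := v₁) (m₂ := m₂) (v₂ := v₂) (r := r) (φ := φ)
  have e2 := two_mul_rateObj (m₁ := m₁) (v₁ := v₁) (m₂ := m₂) (v₂ := v₂) (r := r) (φ := φ')
  have e3 := two_mul_rateObj (m₁ := m₁) (v₁ := v₁) (m₂ := m₂) (v₂ := v₂) (r := r') (φ := φ)
  have e4 := two_mul_rateObj (m₁ := m₁) (v₁ := v₁) (m₂ := m₂) (v₂ := v₂) (r := r') (φ := φ')
  have p1 := logTerm_pos hv₁ (mem_Ioo_of_min hr hv₁ one_pos hv₂ hm h).1.ne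
  have p2 := logTerm_pos hv₁ (mem_Ioo_of_min (hr.trans hlt) hv₁ one_pos hv₂ hm h').1.ne
  have q1 := logTerm_nonneg hv₂ m₂ φ
  have q2 := logTerm_nonneg hv₂ m₂ φ'
  have hu : logTerm m₁ v₁ φ' ≤ logTerm m₁ v₁ φ := by
    by_contra hcon
    have := mul_pos (sub_pos.2 hlt) (sub_pos.2 (not_le.1 hcon))
    nlinarith
  have hw : logTerm m₂ v₂ φ ≤ logTerm m₂ v₂ φ' := by nlinarith
  gcongr

/-- At the larger of two weights the ratio of log-terms is at least that of the chord. -/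
lemma chord_le_logTerm_ratio (hv₁ : 0 < v₁) (hv₂ : 0 < v₂) (hm : m₁ < m₂) (hr : 0 < r)
    (hlt : r < r') (h' : ∀ ψ, rateObj r' m₁ v₁ 1 m₂ v₂ φ' ≤ rateObj r' m₁ v₁ 1 m₂ v₂ ψ) :
    (profile m₁ v₁ m₂ v₂ r * r' - profile m₁ v₁ m₂ v₂ r' * r) /
      (profile m₁ v₁ m₂ v₂ r' - profile m₁ v₁ m₂ v₂ r) ≤
      logTerm m₂ v₂ φ' / logTerm m₁ v₁ φ' := by
  have p := logTerm_pos hv₁ (mem_Ioo_of_min (hr.trans hlt) hv₁ one_pos hv₂ hm h').1.ne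
  have q := logTerm_nonneg hv₂ m₂ φ'
  have h1 := profile_eq_of_min h'
  have h2 := profile_le (m₁ := m₁) (m₂ := m₂) hv₁ hv₂ hr.le φ'
  have h3 := strictMonoOn_profile hv₁ hv₂ hm hr.le (hr.trans hlt).le hlt
  rw [div_le_div_iff₀ (by linarith) p]
  set P := profile m₁ v₁ m₂ v₂ r
  rw [h1]
  set u := logTerm m₁ v₁ φ'
  set w := logTerm m₂ v₂ φ'
  -- By concavity the chord has an intercept at most that of the supporting line at its right end
  -- (`hA`) and a slope at least as large (`hB`). At the left end both comparisons are reversed.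
  have hA : P * r' - (r' * u + w) * r ≤ w * (r' - r) := by nlinarith [hr.trans hlt]
  have hB : (r' - r) * u ≤ r' * u + w - P := by linarith
  calc (P * r' - (r' * u + w) * r) * u ≤ w * (r' - r) * u := by gcongr
    _ = w * ((r' - r) * u) := by ring
    _ ≤ w * (r' * u + w - P) := by gcongr

/-- At the smaller of two weights the ratio of log-terms is at most that of the chord. -/
lemma logTerm_ratio_le_chord (hv₁ : 0 < v₁) (hv₂ : 0 < v₂) (hm : m₁ < m₂) (hr : 0 < r)
    (hlt : r < r') (h : ∀ ψ, rateObj r m₁ v₁ 1 m₂ v₂ φ ≤ rateObj r m₁ v₁ 1 m₂ v₂ ψ) :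
    logTerm m₂ v₂ φ / logTerm m₁ v₁ φ ≤
      (profile m₁ v₁ m₂ v₂ r * r' - profile m₁ v₁ m₂ v₂ r' * r) /
      (profile m₁ v₁ m₂ v₂ r' - profile m₁ v₁ m₂ v₂ r) := by
  have p := logTerm_pos hv₁ (mem_Ioo_of_min hr hv₁ one_pos hv₂ hm h).1.ne
  have q := logTerm_nonneg hv₂ m₂ φ
  have h1 := profile_eq_of_min h
  have h2 := profile_le (m₁ := m₁) (m₂ := m₂) hv₁ hv₂ (hr.trans hlt).le φ
  have h3 := strictMonoOn_profile hv₁ hv₂ hm hr.le (hr.trans hlt).le hlt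
  rw [div_le_div_iff₀ p (by linarith)]
  set P := profile m₁ v₁ m₂ v₂ r'
  rw [h1]
  set u := logTerm m₁ v₁ φ
  set w := logTerm m₂ v₂ φ
  have hA : w * (r' - r) ≤ (r * u + w) * r' - P * r := by nlinarith
  have hB : P - (r * u + w) ≤ (r' - r) * u := by linarith
  calc w * (P - (r * u + w)) ≤ w * ((r' - r) * u) := by gcongr
    _ = w * (r' - r) * u := by ring
    _ ≤ ((r * u + w) * r' - P * r) * u := by gcongr

end Chord

/-! ### Plug-in quantities in terms of ratios of counts -/

section Estimates

variable {k : ℕ} {prior : (Fin k → ℝ) × (Fin k → ℝ) → ℝ} {x : Fin k → ℕ → ℝ} {N : Fin k → ℕ}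
  {b i : Fin k}

lemma proportion_pos (hN : ∀ i, 1 ≤ N i) (i : Fin k) : 0 < proportion N i := by
  unfold proportion
  have h : ∀ j, (0 : ℝ) < N j := fun j => by exact_mod_cast hN j
  exact div_pos (h i) (Finset.sum_pos (fun j _ => h j) ⟨i, Finset.mem_univ i⟩)

lemma proportion_div (hN : ∀ i, 1 ≤ N i) (i b : Fin k) :
    proportion N i / proportion N b = (N i : ℝ) / N b := by
  unfold proportion
  have h : ∀ j, (0 : ℝ) < N j := fun j => by exact_mod_cast hN j
  have hs : (0 : ℝ) < ∑ j, (N j : ℝ) := Finset.sum_pos (fun j _ => h j) ⟨i, Finset.mem_univ i⟩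
  field_simp

lemma estScaledRate_eq (hN : ∀ i, 1 ≤ N i) (b i : Fin k) :
    estScaledRate prior x N b i = profile (postMean prior x N i) (postVar prior x N i)
      (postMean prior x N b) (postVar prior x N b) ((N i : ℝ) / N b) := by
  rw [estScaledRate, estRate, two_mul_rate_div (proportion_pos hN b), proportion_div hN]

lemma estRate_le_iff (hN : ∀ i, 1 ≤ N i) (b i j : Fin k) :
    estRate prior x N b i ≤ estRate prior x N b j ↔
      estScaledRate prior x N b i ≤ estScaledRate prior x N b j := by
  unfold estScaledRate
  have := proportion_pos hN b
  exact (mul_le_mul_iff_of_pos_left (by positivity)).symm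

lemma estMinimizer_spec (hN : ∀ i, 1 ≤ N i) (hi : 0 < postVar prior x N i)
    (hb : 0 < postVar prior x N b) (hm : postMean prior x N i < postMean prior x N b) (φ : ℝ) :
    rateObj ((N i : ℝ) / N b) (postMean prior x N i) (postVar prior x N i) 1
        (postMean prior x N b) (postVar prior x N b) (estMinimizer prior x N b i) ≤
      rateObj ((N i : ℝ) / N b) (postMean prior x N i) (postVar prior x N i) 1
        (postMean prior x N b) (postVar prior x N b) φ := by
  have hpb := proportion_pos hN b
  have h := minimizer_spec (proportion_pos hN i) hi hpb hb hm φ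
  rw [← estMinimizer] at h
  have e : ∀ ψ, rateObj (proportion N i) (postMean prior x N i) (postVar prior x N i)
      (proportion N b) (postMean prior x N b) (postVar prior x N b) ψ = proportion N b *
      rateObj ((N i : ℝ) / N b) (postMean prior x N i) (postVar prior x N i) 1
        (postMean prior x N b) (postVar prior x N b) ψ := by
    intro ψ
    rw [← proportion_div hN]
    unfold rateObj
    field_simp
  rw [e, e] at h
  exact le_of_mul_le_mul_left h hpb

lemma estRatioSum_eq : estRatioSum prior x N b = ∑ i ∈ Finset.univ.erase b,
    logTerm (postMean prior x N b) (postVar prior x N b) (estMinimizer prior x N b i) /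
      logTerm (postMean prior x N i) (postVar prior x N i) (estMinimizer prior x N b i) := rfl

lemma existsUnique_of_lt (h : ∀ j, j ≠ b → postMean prior x N j < postMean prior x N b) :
    ∃! j, IsPostArgmax prior x N j := by
  refine ⟨b, fun j => ?_, fun j hj => ?_⟩
  · by_cases hjb : j = b
    · rw [hjb]
    · exact (h j hjb).le
  · by_contra hjb
    exact absurd (hj b) (not_le.2 (h j hjb))

lemma lt_of_existsUnique (h : ∃! j, IsPostArgmax prior x N j) (hb : IsPostArgmax prior x N b)
    {j : Fin k} (hj : j ≠ b) : postMean prior x N j < postMean prior x N b := by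
  refine lt_of_le_of_ne (hb j) fun heq => hj (h.unique ?_ hb)
  intro l
  rw [heq]
  exact hb l

end Estimates

lemma tendsto_of_ratio_close {ι : Type*} {l : Filter ι} {f : ι → ℝ} {a : ℝ}
    (h : ∀ c > 1, ∀ᶠ t in l, f t ≤ c * a ∧ a ≤ c * f t) : Tendsto f l (𝓝 a) := by
  rw [tendsto_order]
  constructor
  · intro y hy
    have h1 : Tendsto (fun c : ℝ => a / c) (𝓝[>] 1) (𝓝 a) := by
      have : ContinuousAt (fun c : ℝ => a / c) 1 := continuousAt_const.div (by fun_prop) one_ne_zero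
      have h := this.tendsto
      rw [div_one] at h
      exact h.mono_left nhdsWithin_le_nhds
    obtain ⟨c, h2, h3⟩ := ((h1.eventually (lt_mem_nhds hy)).and self_mem_nhdsWithin).exists
    filter_upwards [h c h3] with t ht
    have hc : 0 < c := zero_lt_one.trans h3
    rw [lt_div_iff₀ hc] at h2
    nlinarith [ht.2]
  · intro y hy
    have h1 : Tendsto (fun c : ℝ => c * a) (𝓝[>] 1) (𝓝 a) := by
      have : ContinuousAt (fun c : ℝ => c * a) 1 := by fun_prop
      have h := this.tendsto
      rw [one_mul] at h
      exact h.mono_left nhdsWithin_le_nhds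
    obtain ⟨c, h2, h3⟩ := ((h1.eventually (gt_mem_nhds hy)).and self_mem_nhdsWithin).exists
    filter_upwards [h c h3] with t ht
    linarith [ht.1]

/-! ### Convergence once every design is sampled infinitely often -/

section Convergence

variable {k : ℕ} {m v : Fin k → ℝ} {best : Fin k} {prior : (Fin k → ℝ) × (Fin k → ℝ) → ℝ}
  {x : Fin k → ℕ → ℝ} {n₀ : ℕ} {B I : ℕ → Fin k}

/-- If every design is sampled infinitely often and the posterior estimates are consistent, then
the ratios of the sample sizes converge to the optimal ones, and the scaled rates equalise. -/
theorem balanced_of_consistent (hv : ∀ i, 0 < v i)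
    (hbest : ∀ i, i ≠ best → m i < m best) (hn₀ : 1 ≤ n₀) {r : Fin k → ℝ} {W : ℝ} (hW : 0 < W)
    (hr : ∀ i, i ≠ best → 0 < r i ∧ designProfile m v best i (r i) = W)
    (hopt : ∀ (s : Fin k → ℝ) (V : ℝ), V ≠ W →
        (∀ i, i ≠ best → 0 ≤ s i ∧ designProfile m v best i (s i) = V) →
        V * (1 + sumOthers best r) < W * (1 + sumOthers best s))
    (hrun : IsRun prior n₀ x B I)
    (hinf : ∀ i, Tendsto (fun t => count n₀ I t i) atTop atTop)
    (hmean : ∀ i, Tendsto (fun t => postMean prior x (count n₀ I t) i) atTop (𝓝 (m i)))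
    (hvar : ∀ i, Tendsto (fun t => postVar prior x (count n₀ I t) i) atTop (𝓝 (v i))) :
    (∀ᶠ t in atTop, B t = best) ∧
    (∀ i, i ≠ best → Tendsto (fun t => designProfile m v best i (countRatio n₀ I best t i)) atTop
      (𝓝 W)) ∧
    (∀ i, i ≠ best → Tendsto (fun t => estScaledRate prior x (count n₀ I t) best i) atTop
      (𝓝 W)) := by
  have hN : ∀ t i, 1 ≤ count n₀ I t i := fun t i => hn₀.trans (le_count n₀ I t i)
  have hvpos : ∀ᶠ t in atTop, ∀ i, 0 < postVar prior x (count n₀ I t) i :=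
    eventually_all.2 fun i => (hvar i).eventually (lt_mem_nhds (hv i))
  have hmlt : ∀ᶠ t in atTop, ∀ i, i ≠ best →
      postMean prior x (count n₀ I t) i < postMean prior x (count n₀ I t) best := by
    refine eventually_all.2 fun i => ?_
    by_cases hi : i = best
    · exact Eventually.of_forall fun _ h => absurd hi h
    · filter_upwards [(hmean i).eventually_lt (hmean best) (hbest i hi)] with t ht _
      exact ht
  have hB : ∀ᶠ t in atTop, B t = best := by
    filter_upwards [hmlt] with t ht
    by_contra hne
    have := (hrun t).1.1 best
    exact absurd (ht _ hne) (not_lt.2 this)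
  -- the estimated profiles are close to the true ones, uniformly in the ratio
  have hclose : ∀ c > 1, ∀ᶠ t in atTop, ∀ i, i ≠ best → ∀ s : ℝ, 0 ≤ s →
      profile (postMean prior x (count n₀ I t) i) (postVar prior x (count n₀ I t) i)
        (postMean prior x (count n₀ I t) best) (postVar prior x (count n₀ I t) best) s ≤
        c * designProfile m v best i s ∧
      designProfile m v best i s ≤ c * profile (postMean prior x (count n₀ I t) i)
        (postVar prior x (count n₀ I t) i)
        (postMean prior x (count n₀ I t) best) (postVar prior x (count n₀ I t) best) s := by
    intro c hc
    have hlim : ∀ i j, Tendsto (fun t => (postMean prior x (count n₀ I t) best -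
        postMean prior x (count n₀ I t) i) ^ 2 / postVar prior x (count n₀ I t) j) atTop
        (𝓝 ((m best - m i) ^ 2 / v j)) := fun i j =>
      (((hmean best).sub (hmean i)).pow 2).div (hvar j) (hv j).ne'
    have key : ∀ i j, i ≠ best → ∀ᶠ t in atTop, (postMean prior x (count n₀ I t) best -
        postMean prior x (count n₀ I t) i) ^ 2 / postVar prior x (count n₀ I t) j ≤
        c * ((m best - m i) ^ 2 / v j) ∧ (m best - m i) ^ 2 / v j ≤
        c * ((postMean prior x (count n₀ I t) best -
        postMean prior x (count n₀ I t) i) ^ 2 / postVar prior x (count n₀ I t) j) := by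
      intro i j hi
      have hpos : 0 < (m best - m i) ^ 2 / v j := by
        have := sub_pos.2 (hbest i hi)
        have := hv j
        positivity
      have h1 : (m best - m i) ^ 2 / v j < c * ((m best - m i) ^ 2 / v j) := by nlinarith
      filter_upwards [(hlim i j).eventually (gt_mem_nhds h1),
        ((hlim i j).const_mul c).eventually (lt_mem_nhds h1)] with t h2 h3
      exact ⟨h2.le, h3.le⟩
    have key' : ∀ i, ∀ᶠ t in atTop, i ≠ best → ∀ s : ℝ, 0 ≤ s →
      profile (postMean prior x (count n₀ I t) i) (postVar prior x (count n₀ I t) i)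
        (postMean prior x (count n₀ I t) best) (postVar prior x (count n₀ I t) best) s ≤
        c * designProfile m v best i s ∧
      designProfile m v best i s ≤ c * profile (postMean prior x (count n₀ I t) i)
        (postVar prior x (count n₀ I t) i)
        (postMean prior x (count n₀ I t) best) (postVar prior x (count n₀ I t) best) s := by
      intro i
      by_cases hi : i = best
      · exact Eventually.of_forall fun _ h => absurd hi h
      filter_upwards [key i i hi, key i best hi, hvpos, hmlt] with t h1 h2 h3 h4 _ s hs
      exact ⟨profile_perturb (hv i) (hv best) (hbest i hi) (h3 i) (h3 best) hs hc.le h1.1 h2.1,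
        profile_perturb (h3 i) (h3 best) (h4 i hi) (hv i) (hv best) hs hc.le h1.2 h2.2⟩
    exact eventually_all.2 key'
  have hlimP : ∀ i, i ≠ best → ∀ s : ℝ, 0 ≤ s → Tendsto (fun t =>
      profile (postMean prior x (count n₀ I t) i) (postVar prior x (count n₀ I t) i)
        (postMean prior x (count n₀ I t) best) (postVar prior x (count n₀ I t) best) s) atTop
        (𝓝 (designProfile m v best i s)) := by
    intro i hi s hs
    refine tendsto_of_ratio_close fun c hc => ?_
    filter_upwards [hclose c hc] with t ht
    exact ht i hi s hs
  set C := ∑ i, logTerm (m best) (v best) (m i) with hCdef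
  have hC : ∀ i, i ≠ best → ∀ s : ℝ, 0 ≤ s → designProfile m v best i s ≤ C := by
    intro i hi s hs
    exact (profile_le_top (hv i) (hv best) hs).trans
      (Finset.single_le_sum (f := fun i => logTerm (m best) (v best) (m i))
        (fun j _ => logTerm_nonneg (hv best) _ _) (Finset.mem_univ i))
  have hC0 : 0 ≤ C := Finset.sum_nonneg fun j _ => logTerm_nonneg (hv best) _ _
  have hRpos : ∀ t i, 0 < countRatio n₀ I best t i := fun t i => countRatio_pos hn₀ t i
  have hscaled : ∀ t i, estScaledRate prior x (count n₀ I t) best i =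
      profile (postMean prior x (count n₀ I t) i) (postVar prior x (count n₀ I t) i)
        (postMean prior x (count n₀ I t) best) (postVar prior x (count n₀ I t) best)
        (countRatio n₀ I best t i) := fun t i => estScaledRate_eq (hN t) best i
  have hmono : ∀ i, i ≠ best → StrictMonoOn (designProfile m v best i) (Ici 0) := fun i hi =>
    strictMonoOn_profile (hv i) (hv best) (hbest i hi)
  have hmin : ∀ ε > 0, ∀ᶠ t in atTop, I t ≠ best → ∀ j, j ≠ best →
      designProfile m v best (I t) (countRatio n₀ I best t (I t)) ≤
        designProfile m v best j (countRatio n₀ I best t j) + ε := by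
    intro ε hε
    -- One factor `c` is lost in passing from the true profiles to the estimated ones, where
    -- minimality is exact, and one in passing back.
    obtain ⟨c, hc, hcε⟩ : ∃ c : ℝ, 1 < c ∧ (c ^ 2 - 1) * C < ε := by
      have : ContinuousAt (fun c : ℝ => (c ^ 2 - 1) * C) 1 := by fun_prop
      have h := this.tendsto
      simp only [one_pow, sub_self, zero_mul] at h
      obtain ⟨c, h1, h2⟩ := (((h.mono_left (nhdsWithin_le_nhds (s := Ioi 1))).eventually
        (gt_mem_nhds hε)).and self_mem_nhdsWithin).exists
      exact ⟨c, h2, h1⟩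
    filter_upwards [hclose c hc, hB, hmlt] with t h1 h2 h3 hI j hj
    have hn := (hrun t).2
    rw [h2] at hn
    have huniq := existsUnique_of_lt h3
    have hrs : estRatioSum prior x (count n₀ I t) best ≤ 1 := by
      by_contra hcon
      exact hI (hn.1 (Or.inr (not_le.1 hcon)))
    have h4 := (hn.2 huniq hrs).2 j hj
    rw [estRate_le_iff (hN t), hscaled, hscaled] at h4
    have h5 := (h1 (I t) hI _ (hRpos t (I t)).le).2
    have h6 := (h1 j hj _ (hRpos t j).le).1
    have h7 := hC j hj _ (hRpos t j).le
    have hc0 : 0 < c := by linarith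
    have h8 : designProfile m v best (I t) (countRatio n₀ I best t (I t)) ≤
        c * (c * designProfile m v best j (countRatio n₀ I best t j)) :=
      h5.trans (mul_le_mul_of_nonneg_left (h4.trans h6) hc0.le)
    have h9 : (c ^ 2 - 1) * designProfile m v best j (countRatio n₀ I best t j) ≤
        (c ^ 2 - 1) * C := by
      apply mul_le_mul_of_nonneg_left h7
      nlinarith
    linarith
  -- Each summand is the quotient of intercept and slope of a chord of the estimated profile,
  -- between `r i` and `s i`. In the limit the levels are `W` and `V` for every design, and `hopt`
  -- places the limiting sum above 1 for `V > W` and below 1 for `V < W`.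
  have hchord : ∀ s : Fin k → ℝ, ∀ V, V ≠ W →
      (∀ i, i ≠ best → 0 ≤ s i ∧ designProfile m v best i (s i) = V) →
      Tendsto (fun t => ∑ i ∈ Finset.univ.erase best,
        ((profile (postMean prior x (count n₀ I t) i) (postVar prior x (count n₀ I t) i)
        (postMean prior x (count n₀ I t) best) (postVar prior x (count n₀ I t) best) (r i)) * s i -
        (profile (postMean prior x (count n₀ I t) i) (postVar prior x (count n₀ I t) i)
        (postMean prior x (count n₀ I t) best) (postVar prior x (count n₀ I t) best) (s i)) * r i) /
        ((profile (postMean prior x (count n₀ I t) i) (postVar prior x (count n₀ I t) i)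
        (postMean prior x (count n₀ I t) best) (postVar prior x (count n₀ I t) best) (s i)) -
        (profile (postMean prior x (count n₀ I t) i) (postVar prior x (count n₀ I t) i)
        (postMean prior x (count n₀ I t) best) (postVar prior x (count n₀ I t) best) (r i))))
      atTop (𝓝 ((W * sumOthers best s - V * sumOthers best r) / (V - W))) := by
    intro s V hVW hs
    have e : (W * sumOthers best s - V * sumOthers best r) / (V - W) =
        ∑ i ∈ Finset.univ.erase best, (W * s i - V * r i) / (V - W) := by
      rw [← Finset.sum_div, Finset.sum_sub_distrib, ← Finset.mul_sum, ← Finset.mul_sum]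
      rfl
    rw [e]
    refine tendsto_finsetSum _ fun i hi => ?_
    have hi' := Finset.ne_of_mem_erase hi
    have l1 := hlimP i hi' (r i) (hr i hi').1.le
    have l2 := hlimP i hi' (s i) (hs i hi').1
    rw [(hr i hi').2] at l1
    rw [(hs i hi').2] at l2
    exact ((l1.mul_const _).sub (l2.mul_const _)).div (l2.sub l1) (sub_ne_zero.2 hVW)
  have hhigh : ∀ ε > 0, ∀ᶠ t in atTop, (∀ i, i ≠ best →
      W + ε ≤ designProfile m v best i (countRatio n₀ I best t i)) → I t = best := by
    intro ε hε
    -- The profiles are bounded, so the level `W + δ` must be low enough to be attained by all of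
    -- them. Any `δ` below the increments from `r i` to `2 * r i` will do.
    obtain ⟨δ, hδ0, hδε, hδ⟩ : ∃ δ, 0 < δ ∧ δ ≤ ε ∧
        ∀ i, i ≠ best → W + δ ≤ designProfile m v best i (2 * r i) := by
      have h1 : ∀ i, ∀ᶠ δ in 𝓝[>] (0 : ℝ), i ≠ best →
          W + δ ≤ designProfile m v best i (2 * r i) := by
        intro i
        by_cases hi : i = best
        · exact Eventually.of_forall fun _ h => absurd hi h
        have hlt : W < designProfile m v best i (2 * r i) := by
          obtain ⟨h1, h2⟩ := hr i hi
          conv_lhs => rw [← h2]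
          exact hmono i hi h1.le (mem_Ici.2 (by positivity)) (by linarith)
        filter_upwards [Ioo_mem_nhdsGT (sub_pos.2 hlt)] with δ hδ _
        linarith [hδ.2]
      obtain ⟨δ, h2, h3⟩ := ((eventually_all.2 h1).and (Ioo_mem_nhdsGT hε)).exists
      exact ⟨δ, h3.1, h3.2.le, h2⟩
    have hex : ∀ i, ∃ s, i ≠ best → 0 ≤ s ∧ designProfile m v best i s = W + δ := by
      intro i
      by_cases hi : i = best
      · exact ⟨0, fun h => absurd hi h⟩
      · obtain ⟨s, h1, h2⟩ := exists_profile_eq_of_le (hv i) (hv best) (hbest i hi)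
          (r := 2 * r i) (by linarith [(hr i hi).1]) (by linarith) (hδ i hi)
        exact ⟨s, fun _ => ⟨h1.1, h2⟩⟩
    choose s hs using hex
    have hVW : W + δ ≠ W := by linarith
    have hgt : 1 < (W * sumOthers best s - (W + δ) * sumOthers best r) / (W + δ - W) := by
      have := hopt s (W + δ) hVW hs
      rw [lt_div_iff₀ (by linarith)]
      linarith
    have hrs : ∀ i, i ≠ best → r i < s i := by
      intro i hi
      by_contra hcon
      have := (hmono i hi).monotoneOn (hs i hi).1 (hr i hi).1.le (not_lt.1 hcon)
      rw [(hr i hi).2, (hs i hi).2] at this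
      linarith
    filter_upwards [(hchord s _ hVW hs).eventually (lt_mem_nhds hgt), hB, hmlt, hvpos]
      with t h1 h2 h3 h4 h5
    have hn := (hrun t).2
    rw [h2] at hn
    refine hn.1 (Or.inr (h1.trans_le ?_))
    rw [estRatioSum_eq]
    refine Finset.sum_le_sum fun i hi => ?_
    have hi' := Finset.ne_of_mem_erase hi
    have hspec := estMinimizer_spec (hN t) (h4 i) (h4 best) (h3 i hi')
    have hle : s i ≤ countRatio n₀ I best t i := by
      by_contra hcon
      have := hmono i hi' (hRpos t i).le (hs i hi').1 (not_le.1 hcon)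
      rw [(hs i hi').2] at this
      have := h5 i hi'
      linarith
    have hspos : 0 < s i := (hr i hi').1.trans (hrs i hi')
    -- The quotient of log-terms at the current ratio is at least that at `s i`, which is the right
    -- end of the chord and hence has a quotient at least that of the chord.
    rcases hle.lt_or_eq with hlt | heq
    · obtain ⟨φ, -, hφ, -⟩ := exists_profile_eq (h4 i) (h4 best) (h3 i hi') hspos
      exact (chord_le_logTerm_ratio (h4 i) (h4 best) (h3 i hi') (hr i hi').1 (hrs i hi') hφ).trans
        (logTerm_ratio_mono (h4 i) (h4 best) (h3 i hi') hspos hlt hφ hspec)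
    · refine chord_le_logTerm_ratio (h4 i) (h4 best) (h3 i hi') (hr i hi').1 (hrs i hi') ?_
      rw [heq]
      exact hspec
  have hlow : ∀ ε > 0, ∀ᶠ t in atTop, (∀ i, i ≠ best →
      designProfile m v best i (countRatio n₀ I best t i) ≤ W - ε) → I t ≠ best := by
    intro ε hε
    obtain ⟨δ, hδ0, hδε, hδ⟩ : ∃ δ, 0 < δ ∧ δ ≤ ε ∧ δ < W :=
      ⟨min ε (W / 2), by positivity, min_le_left _ _, (min_le_right _ _).trans_lt (by linarith)⟩
    have hex : ∀ i, ∃ s, i ≠ best → 0 ≤ s ∧ designProfile m v best i s = W - δ := by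
      intro i
      by_cases hi : i = best
      · exact ⟨0, fun h => absurd hi h⟩
      · obtain ⟨s, h1, h2⟩ := exists_profile_eq_of_le (hv i) (hv best) (hbest i hi)
          (r := r i) (hr i hi).1.le (W := W - δ) (by linarith) (by
            have := (hr i hi).2
            rw [designProfile] at this
            linarith)
        exact ⟨s, fun _ => ⟨h1.1, h2⟩⟩
    choose s hs using hex
    have hVW : W - δ ≠ W := by linarith
    have hlt1 : (W * sumOthers best s - (W - δ) * sumOthers best r) / (W - δ - W) < 1 := by
      have := hopt s (W - δ) hVW hs
      rw [div_lt_iff_of_neg (by linarith)]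
      linarith
    have hrs : ∀ i, i ≠ best → s i < r i := by
      intro i hi
      by_contra hcon
      have := (hmono i hi).monotoneOn (hr i hi).1.le (hs i hi).1 (not_lt.1 hcon)
      rw [(hr i hi).2, (hs i hi).2] at this
      linarith
    have hspos : ∀ i, i ≠ best → 0 < s i := by
      intro i hi
      refine lt_of_le_of_ne (hs i hi).1 fun h0 => ?_
      have := (hs i hi).2
      rw [← h0, designProfile, profile_zero (hv i) (hv best)] at this
      linarith
    filter_upwards [(hchord s _ hVW hs).eventually (gt_mem_nhds hlt1), hB, hmlt, hvpos]
      with t h1 h2 h3 h4 h5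
    have hn := (hrun t).2
    rw [h2] at hn
    refine (hn.2 (existsUnique_of_lt h3) (le_trans ?_ h1.le)).1
    rw [estRatioSum_eq]
    refine Finset.sum_le_sum fun i hi => ?_
    have hi' := Finset.ne_of_mem_erase hi
    have hspec := estMinimizer_spec (hN t) (h4 i) (h4 best) (h3 i hi')
    have hle : countRatio n₀ I best t i ≤ s i := by
      by_contra hcon
      have := hmono i hi' (hs i hi').1 (hRpos t i).le (not_le.1 hcon)
      rw [(hs i hi').2] at this
      have := h5 i hi'
      linarith
    have hchordle : ∀ φ, (∀ ψ, rateObj (s i) (postMean prior x (count n₀ I t) i)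
        (postVar prior x (count n₀ I t) i) 1 (postMean prior x (count n₀ I t) best)
        (postVar prior x (count n₀ I t) best) φ ≤ rateObj (s i) (postMean prior x (count n₀ I t) i)
        (postVar prior x (count n₀ I t) i) 1 (postMean prior x (count n₀ I t) best)
        (postVar prior x (count n₀ I t) best) ψ) → _ := fun φ hφ =>
      logTerm_ratio_le_chord (φ := φ) (h4 i) (h4 best) (h3 i hi') (hspos i hi') (hrs i hi') hφ
    -- Here `s i < r i`, so the chord runs in the opposite direction and numerator and denominator
    -- both change sign.
    rw [show ∀ a c : ℝ, (a * s i - c * r i) / (c - a) = (c * r i - a * s i) / (a - c) from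
      fun a c => by rw [← neg_sub (c * r i), ← neg_sub a c, neg_div_neg_eq]]
    rcases hle.lt_or_eq with hlt | heq
    · obtain ⟨φ, -, hφ, -⟩ := exists_profile_eq (h4 i) (h4 best) (h3 i hi') (hspos i hi')
      exact (logTerm_ratio_mono (h4 i) (h4 best) (h3 i hi') (hRpos t i) hlt hspec hφ).trans
        (hchordle φ hφ)
    · apply hchordle
      rw [← heq]
      exact hspec
  have hmain := tendsto_of_balanced_sampling (G := designProfile m v best) hn₀ hmono
    (fun i hi c s hc hs => profile_mul_le (hv i) (hv best) (hbest i hi).le hs hc) hC hr hinf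
    hmin hhigh hlow
  have hlimG : ∀ i, i ≠ best → Tendsto (fun t => designProfile m v best i
      (countRatio n₀ I best t i)) atTop (𝓝 W) := by
    intro i hi
    rw [Metric.tendsto_nhds]
    intro ε hε
    filter_upwards [hmain (ε / 2) (by positivity)] with t ht
    rw [Real.dist_eq]
    linarith [ht i hi]
  refine ⟨hB, hlimG, fun i hi => ?_⟩
  have hdiff : Tendsto (fun t => estScaledRate prior x (count n₀ I t) best i -
      designProfile m v best i (countRatio n₀ I best t i)) atTop (𝓝 0) := by
    rw [Metric.tendsto_nhds]
    intro ε hε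
    obtain ⟨c, hc, hcε⟩ : ∃ c : ℝ, 1 < c ∧ (c - 1) * (c * C) < ε := by
      have : ContinuousAt (fun c : ℝ => (c - 1) * (c * C)) 1 := by fun_prop
      have h := this.tendsto
      simp only [sub_self, zero_mul] at h
      obtain ⟨c, h1, h2⟩ := (((h.mono_left (nhdsWithin_le_nhds (s := Ioi 1))).eventually
        (gt_mem_nhds hε)).and self_mem_nhdsWithin).exists
      exact ⟨c, h2, h1⟩
    filter_upwards [hclose c hc] with t ht
    obtain ⟨h1, h2⟩ := ht i hi _ (hRpos t i).le
    rw [← hscaled] at h1 h2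
    have h3 := hC i hi _ (hRpos t i).le
    have h4 := profile_nonneg (m₁ := m i) (m₂ := m best) (hv i) (hv best) (hRpos t i).le
    rw [← designProfile] at h4
    rw [Real.dist_eq, sub_zero, abs_lt]
    have h5 : estScaledRate prior x (count n₀ I t) best i ≤ c * C :=
      h1.trans (by gcongr)
    have h6 : (c - 1) * estScaledRate prior x (count n₀ I t) best i ≤ (c - 1) * (c * C) :=
      mul_le_mul_of_nonneg_left h5 (by linarith)
    have h7 : (c - 1) * designProfile m v best i (countRatio n₀ I best t i) ≤
        (c - 1) * (c * C) := by
      apply mul_le_mul_of_nonneg_left _ (by linarith)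
      nlinarith
    constructor <;> linarith
  simpa using hdiff.add (hlimG i hi)

end Convergence

/-! ### Good paths, and why every design is sampled infinitely often -/

/-- The mean of the first `n` terms of a sequence. -/
noncomputable def sampleMean (y : ℕ → ℝ) (n : ℕ) : ℝ := (∑ l ∈ Finset.range n, y l) / n

/-- The posterior estimates are close to the sample estimates, uniformly in all sample sizes that
are at least `n₀`. -/
structure ConsistentEstimates {k : ℕ} (v : Fin k → ℝ)
    (prior : (Fin k → ℝ) × (Fin k → ℝ) → ℝ) (n₀ : ℕ) (x : Fin k → ℕ → ℝ) : Prop where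
  mean : ∃ C : ℝ, ∀ N : Fin k → ℕ, (∀ i, n₀ ≤ N i) → ∀ i,
    |postMean prior x N i - sampleMean (x i) (N i)| ≤ C / √(N i)
  var_lower : ∃ lo > 0, ∀ N : Fin k → ℕ, (∀ i, n₀ ≤ N i) → ∀ i, lo ≤ postVar prior x N i
  var : ∃ e : Fin k → ℕ → ℝ, (∀ i, Filter.Tendsto (e i) Filter.atTop (nhds 0)) ∧
    ∀ N : Fin k → ℕ, (∀ i, n₀ ≤ N i) → ∀ i, |postVar prior x N i - v i| ≤ e i (N i)

/-- At infinitely many times, the sample mean of any given design is far below the true mean on the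
scale of the standard error, while those of the other designs are not. -/
def OscillatingMeans {k : ℕ} (m : Fin k → ℝ) (x : Fin k → ℕ → ℝ) : Prop :=
  ∀ q : ℕ, 0 < q → ∃ M : ℝ, ∀ (L : ℕ) (i : Fin k), ∃ᶠ s : ℕ in Filter.atTop,
    sampleMean (x i) s ≤ m i - L / √s ∧
      ∀ j, j ≠ i → ∀ n : ℕ, s ≤ q * n → m j - M / √s ≤ sampleMean (x j) n

/-- The count of `i` moves in unit steps, so it takes the value `s`, and at the last time it does so
`i` is sampled. The bound `s ≤ n₀ + t` makes that time late when `s` is large. -/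
lemma exists_sampled_at {k : ℕ} {n₀ : ℕ} {I : ℕ → Fin k} {i : Fin k}
    (h : Tendsto (fun t => count n₀ I t i) atTop atTop) {s : ℕ} (hs : n₀ ≤ s) :
    ∃ t, count n₀ I t i = s ∧ I t = i ∧ s ≤ n₀ + t := by
  have hex : ∃ t, s < count n₀ I t i := (h.eventually_gt_atTop s).exists
  classical
  have hspec := Nat.find_spec hex
  have hmin := fun {t} => Nat.find_min hex (m := t)
  obtain ⟨t, ht⟩ : ∃ t, Nat.find hex = t + 1 := by
    refine Nat.exists_eq_succ_of_ne_zero fun h0 => ?_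
    rw [h0, count_zero] at hspec
    omega
  rw [ht, count_succ] at hspec
  have h1 := hmin (t := t) (by omega)
  by_cases hI : I t = i
  · rw [if_pos hI] at hspec
    have h2 : count n₀ I t i = s := by omega
    refine ⟨t, h2, hI, ?_⟩
    rw [← h2, count]
    have := Finset.card_filter_le (Finset.range t) fun s => I s = i
    rw [Finset.card_range] at this
    omega
  · rw [if_neg hI] at hspec
    omega

section Consistency

variable {k : ℕ} {m v : Fin k → ℝ} {prior : (Fin k → ℝ) × (Fin k → ℝ) → ℝ}
  {x : Fin k → ℕ → ℝ} {n₀ : ℕ} {B I : ℕ → Fin k}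

lemma ConsistentEstimates.tendsto_mean (h : ConsistentEstimates v prior n₀ x) {i : Fin k} {mi : ℝ}
    (hx : Tendsto (sampleMean (x i)) atTop (𝓝 mi))
    (hi : Tendsto (fun t => count n₀ I t i) atTop atTop) :
    Tendsto (fun t => postMean prior x (count n₀ I t) i) atTop (𝓝 mi) := by
  obtain ⟨C, hC⟩ := h.mean
  have h1 : Tendsto (fun n : ℕ => C / √(n : ℝ)) atTop (𝓝 0) :=
    (Real.tendsto_sqrt_atTop.comp tendsto_natCast_atTop_atTop).const_div_atTop C
  have h2 : Tendsto (fun t => postMean prior x (count n₀ I t) i -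
      sampleMean (x i) (count n₀ I t i)) atTop (𝓝 0) :=
    squeeze_zero_norm (fun t => hC _ (le_count n₀ I t) i) (h1.comp hi)
  simpa using h2.add (hx.comp hi)

lemma ConsistentEstimates.tendsto_var (h : ConsistentEstimates v prior n₀ x) {i : Fin k}
    (hi : Tendsto (fun t => count n₀ I t i) atTop atTop) :
    Tendsto (fun t => postVar prior x (count n₀ I t) i) atTop (𝓝 (v i)) := by
  obtain ⟨e, he, hv⟩ := h.var
  have h2 : Tendsto (fun t => postVar prior x (count n₀ I t) i - v i) atTop (𝓝 0) :=
    squeeze_zero_norm (fun t => hv _ (le_count n₀ I t) i) ((he i).comp hi)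
  simpa using h2.add_const (v i)

/-- Constants valid for all sample sizes are needed as long as some counts may stay bounded. They
exist because the convergent sequences that control the estimates are bounded. -/
lemma ConsistentEstimates.exists_bounds (h : ConsistentEstimates v prior n₀ x) (hn₀ : 1 ≤ n₀)
    (hx : ∀ i, Tendsto (sampleMean (x i)) atTop (𝓝 (m i))) :
    ∃ lo hi D : ℝ, 0 < lo ∧ 0 ≤ D ∧ ∀ N : Fin k → ℕ, (∀ i, n₀ ≤ N i) → ∀ i j,
      postVar prior x N i ∈ Icc lo hi ∧ postMean prior x N i - postMean prior x N j ≤ D := by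
  obtain ⟨C, hC⟩ := h.mean
  obtain ⟨lo, hlo, hlo'⟩ := h.var_lower
  obtain ⟨e, he, hv⟩ := h.var
  have h1 : ∀ i, ∃ c, ∀ n, |sampleMean (x i) n| ≤ c := by
    intro i
    obtain ⟨c, hc⟩ := (Metric.isBounded_range_of_tendsto _ (hx i)).exists_norm_le
    exact ⟨c, fun n => hc _ ⟨n, rfl⟩⟩
  have h2 : ∀ i, ∃ c, ∀ n, |e i n| ≤ c := by
    intro i
    obtain ⟨c, hc⟩ := (Metric.isBounded_range_of_tendsto _ (he i)).exists_norm_le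
    exact ⟨c, fun n => hc _ ⟨n, rfl⟩⟩
  choose c hc using h1
  choose d hd using h2
  have hc0 : ∀ i, 0 ≤ c i := fun i => (abs_nonneg _).trans (hc i 0)
  have hd0 : ∀ i, 0 ≤ d i := fun i => (abs_nonneg _).trans (hd i 0)
  refine ⟨lo, ∑ i, (|v i| + d i), 2 * (∑ i, c i + |C|), hlo, ?_, fun N hN i j => ⟨⟨hlo' N hN i, ?_⟩, ?_⟩⟩
  · have := Finset.sum_nonneg fun i (_ : i ∈ Finset.univ) => hc0 i
    positivity
  · have h1 := hv N hN i
    have h2 := hd i (N i)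
    have h3 : |v i| + d i ≤ ∑ i, (|v i| + d i) := Finset.single_le_sum
      (f := fun i => |v i| + d i) (fun j _ => add_nonneg (abs_nonneg _) (hd0 j)) (Finset.mem_univ i)
    have h4 := le_abs_self (v i)
    have h5 := (abs_le.1 h1).2
    have h6 := le_abs_self (e i (N i))
    linarith
  · have key : ∀ i, |postMean prior x N i| ≤ ∑ i, c i + |C| := by
      intro i
      have h1 := hC N hN i
      have h2 := hc i (N i)
      have h3 : c i ≤ ∑ i, c i := Finset.single_le_sum
        (f := c) (fun j _ => hc0 j) (Finset.mem_univ i)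
      have h4 : C / √(N i) ≤ |C| := by
        have h5 : (1 : ℝ) ≤ √(N i) := by
          rw [Real.one_le_sqrt]
          exact_mod_cast hn₀.trans (hN i)
        calc C / √(N i) ≤ |C| / √(N i) := by gcongr; exact le_abs_self C
          _ ≤ |C| := div_le_self (abs_nonneg _) h5
      have h6 := abs_sub_abs_le_abs_sub (postMean prior x N i) (sampleMean (x i) (N i))
      linarith
    have h1 := (abs_le.1 (key i)).2
    have h2 := (abs_le.1 (key j)).1
    linarith

lemma two_mul_rate_natCast {N : Fin k → ℕ} (hN : ∀ i, 1 ≤ N i) (b i : Fin k) :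
    estScaledRate prior x N b i = 2 / (N b : ℝ) * rate (N i) (postMean prior x N i)
      (postVar prior x N i) (N b) (postMean prior x N b) (postVar prior x N b) := by
  rw [estScaledRate_eq hN, two_mul_rate_div]
  exact_mod_cast hN b

/-- Bounds on the terms of the ratio sum. -/
lemma estRatio_bounds {N : Fin k → ℕ} {b i : Fin k} {lo hi D : ℝ} (hN : ∀ i, 1 ≤ N i)
    (hlo : 0 < lo) (hi' : postVar prior x N i ∈ Icc lo hi) (hb : postVar prior x N b ∈ Icc lo hi)
    (hD : postMean prior x N b - postMean prior x N i ≤ D)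
    (hlt : postMean prior x N i < postMean prior x N b) :
    (lo / (hi + D ^ 2)) ^ 3 * ((N i : ℝ) / N b) ^ 2 ≤
      logTerm (postMean prior x N b) (postVar prior x N b) (estMinimizer prior x N b i) /
        logTerm (postMean prior x N i) (postVar prior x N i) (estMinimizer prior x N b i) ∧
    logTerm (postMean prior x N b) (postVar prior x N b) (estMinimizer prior x N b i) /
        logTerm (postMean prior x N i) (postVar prior x N i) (estMinimizer prior x N b i) ≤
      ((hi + D ^ 2) / lo) ^ 3 * ((N i : ℝ) / N b) ^ 2 := by
  have h1 : (0 : ℝ) < N i := by exact_mod_cast hN i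
  have h2 : (0 : ℝ) < N b := by exact_mod_cast hN b
  have := logTerm_ratio_bounds (a₁ := (N i : ℝ) / N b) (a₂ := 1) (by positivity) one_pos hlt hlo hi'
    hb hD (estMinimizer_spec hN (hlo.trans_le hi'.1) (hlo.trans_le hb.1) hlt)
  simpa using this

/-- Under consistent estimates and oscillating sample means, every design is sampled infinitely
often. -/
theorem tendsto_count_atTop (hn₀ : 1 ≤ n₀) (hest : ConsistentEstimates v prior n₀ x)
    (hx : ∀ i, Tendsto (sampleMean (x i)) atTop (𝓝 (m i))) (hosc : OscillatingMeans m x)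
    (hrun : IsRun prior n₀ x B I) (i : Fin k) :
    Tendsto (fun t => count n₀ I t i) atTop atTop := by
  obtain ⟨lo, hi, D, hlo, hD0, hbd⟩ := hest.exists_bounds hn₀ hx
  have hN : ∀ t i, 1 ≤ count n₀ I t i := fun t i => hn₀.trans (le_count n₀ I t i)
  have hN' : ∀ t i, (0 : ℝ) < count n₀ I t i := fun t i => by exact_mod_cast hN t i
  have hvar := fun t i => (hbd (count n₀ I t) (le_count n₀ I t) i i).1
  have hgap := fun t i j => (hbd (count n₀ I t) (le_count n₀ I t) i j).2
  have hvar0 : ∀ t i, 0 < postVar prior x (count n₀ I t) i := fun t i => hlo.trans_le (hvar t i).1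
  have hhi : 0 < hi := hlo.trans_le ((hvar 0 i).1.trans (hvar 0 i).2)
  set c₀ := (lo / (hi + D ^ 2)) ^ 3 with hc₀
  set C₀ := ((hi + D ^ 2) / lo) ^ 3 with hC₀
  have hc₀pos : 0 < c₀ := by positivity
  have hC₀pos : 0 < C₀ := by positivity
  have hterm_nonneg : ∀ t b j, 0 ≤ logTerm (postMean prior x (count n₀ I t) b)
      (postVar prior x (count n₀ I t) b) (estMinimizer prior x (count n₀ I t) b j) /
      logTerm (postMean prior x (count n₀ I t) j)
      (postVar prior x (count n₀ I t) j) (estMinimizer prior x (count n₀ I t) b j) := fun t b j =>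
    div_nonneg (logTerm_nonneg (hvar0 t b) _ _) (logTerm_nonneg (hvar0 t j) _ _)
  have hratio_ge : ∀ t b j, (∃! l, IsPostArgmax prior x (count n₀ I t) l) →
      IsPostArgmax prior x (count n₀ I t) b → j ≠ b →
      c₀ * ((count n₀ I t j : ℝ) / count n₀ I t b) ^ 2 ≤
        estRatioSum prior x (count n₀ I t) b := by
    intro t b j hu hb hj
    have h1 := (estRatio_bounds (hN t) hlo (hvar t j) (hvar t b) (hgap t b j)
      (lt_of_existsUnique hu hb hj)).1
    refine h1.trans ?_
    rw [estRatioSum_eq]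
    exact Finset.single_le_sum (f := fun j => logTerm (postMean prior x (count n₀ I t) b)
      (postVar prior x (count n₀ I t) b) (estMinimizer prior x (count n₀ I t) b j) /
      logTerm (postMean prior x (count n₀ I t) j)
      (postVar prior x (count n₀ I t) j) (estMinimizer prior x (count n₀ I t) b j))
      (fun l _ => hterm_nonneg t b l) (Finset.mem_erase.2 ⟨hj, Finset.mem_univ j⟩)
  -- consequences of sampling a design other than the estimated best
  have hnonbest : ∀ t, I t ≠ B t → (∃! l, IsPostArgmax prior x (count n₀ I t) l) ∧
      estRatioSum prior x (count n₀ I t) (B t) ≤ 1 ∧ ∀ j, j ≠ B t →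
      estRate prior x (count n₀ I t) (B t) (I t) ≤ estRate prior x (count n₀ I t) (B t) j := by
    intro t ht
    have hn := (hrun t).2
    have h1 : ∃! l, IsPostArgmax prior x (count n₀ I t) l := by
      by_contra hcon
      exact ht (hn.1 (Or.inl hcon))
    have h2 : estRatioSum prior x (count n₀ I t) (B t) ≤ 1 := by
      by_contra hcon
      exact ht (hn.1 (Or.inr (not_le.1 hcon)))
    exact ⟨h1, h2, (hn.2 h1 h2).2⟩
  by_contra hnot
  -- `A` consists of the designs sampled infinitely often. The design `i` is outside it, and all
  -- counts outside `A` are bounded by a common `K`.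
  let A : Set (Fin k) := {i | Tendsto (fun t => count n₀ I t i) atTop atTop}
  have hbounded : ∃ K : ℕ, ∀ j ∉ A, ∀ t, count n₀ I t j ≤ K := by
    have h1 : ∀ j, ∃ K : ℕ, j ∉ A → ∀ t, count n₀ I t j ≤ K := by
      intro j
      by_cases hj : j ∈ A
      · exact ⟨0, fun h => absurd hj h⟩
      · have : ¬ ∀ K, ∃ t, K ≤ count n₀ I t j := fun h =>
          hj (tendsto_atTop_atTop_of_monotone (count_mono n₀ I j) h)
        push Not at this
        obtain ⟨K, hK⟩ := this
        exact ⟨K, fun _ t => (hK t).le⟩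
    choose K hK using h1
    exact ⟨∑ j, K j, fun j hj t => (hK j hj t).trans
      (Finset.single_le_sum (f := K) (fun _ _ => Nat.zero_le _) (Finset.mem_univ j))⟩
  obtain ⟨K, hK⟩ := hbounded
  have hIA : ∀ᶠ t in atTop, I t ∈ A := by
    have h1 : ∀ j, ∀ᶠ t in atTop, j ∉ A → I t ≠ j := by
      intro j
      by_cases hj : j ∈ A
      · exact Eventually.of_forall fun _ h => absurd hj h
      · by_contra hcon
        rw [not_eventually] at hcon
        apply hj
        refine tendsto_atTop_atTop_of_monotone (count_mono n₀ I j) fun c => ?_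
        induction c with
        | zero => exact ⟨0, Nat.zero_le _⟩
        | succ c ih =>
          obtain ⟨t, ht⟩ := ih
          obtain ⟨w, hw, hw'⟩ := (frequently_atTop.1 hcon) t
          push Not at hw'
          refine ⟨w + 1, ?_⟩
          rw [count_succ, if_pos hw'.2]
          have := count_mono n₀ I j hw
          simp only at this
          omega
    filter_upwards [eventually_all.2 h1] with t ht
    by_contra hcon
    exact ht (I t) hcon rfl
  obtain ⟨a, ha⟩ : ∃ a, a ∈ A := by
    obtain ⟨t, ht⟩ := hIA.exists
    exact ⟨I t, ht⟩
  have hlarge : ∀ (c : ℝ), ∀ᶠ t in atTop, ∀ j ∈ A, c < (count n₀ I t j : ℝ) := by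
    intro c
    refine eventually_all.2 fun j => ?_
    by_cases hj : j ∈ A
    · have h1 : Tendsto (fun t => (count n₀ I t j : ℝ)) atTop atTop :=
        tendsto_natCast_atTop_atTop.comp hj
      filter_upwards [h1.eventually_gt_atTop c] with t ht _ using ht
    · exact Eventually.of_forall fun _ h => absurd h hj
  -- An estimated best design outside `A` has a bounded count, so its ratio sum is eventually above
  -- 1 because of the growing count of `a`. It would then be sampled, although eventually only
  -- designs in `A` are.
  have hBA : ∀ᶠ t in atTop, B t ∈ A := by
    filter_upwards [hIA, hlarge (K / √c₀)] with t h1 h2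
    by_contra hcon
    have hne : I t ≠ B t := fun h => hcon (h ▸ h1)
    obtain ⟨h3, h4, -⟩ := hnonbest t hne
    have hab : a ≠ B t := fun h => hcon (h ▸ ha)
    have h5 := (hratio_ge t (B t) a h3 (hrun t).1.1 hab).trans h4
    have h6 := h2 a ha
    have h7 : (count n₀ I t (B t) : ℝ) ≤ K := by exact_mod_cast hK _ hcon t
    have hpos := hN' t (B t)
    rw [div_lt_iff₀ (by positivity)] at h6
    rw [div_pow, ← mul_div_assoc, div_le_one (by positivity)] at h5
    have h8 : (K : ℝ) ^ 2 < (count n₀ I t a * √c₀) ^ 2 := by gcongr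
    rw [mul_pow, Real.sq_sqrt hc₀pos.le] at h8
    have h9 : (count n₀ I t (B t) : ℝ) ^ 2 ≤ K ^ 2 := by gcongr
    linarith
  -- a design sampled while not the estimated best is hardly distinguishable from the latter
  obtain ⟨K₂, hK₂0, hK₂⟩ : ∃ K₂ : ℝ, 0 ≤ K₂ ∧ ∀ᶠ t in atTop, I t ≠ B t →
      min (count n₀ I t (I t) : ℝ) (count n₀ I t (B t)) *
        (postMean prior x (count n₀ I t) (B t) - postMean prior x (count n₀ I t) (I t)) ^ 2 ≤ K₂ := by
    refine ⟨K * (D ^ 2 / lo) * (4 * hi + D ^ 2), by positivity, ?_⟩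
    filter_upwards [hBA] with t hB hne
    obtain ⟨h3, h4, h5⟩ := hnonbest t hne
    -- The sampled design has at most the estimated rate of `i`. The latter, with counts as weights,
    -- is bounded because the count of `i` is: evaluate its objective at the posterior mean of `B
    -- t`. The lower bound `le_rate` for the sampled design then gives the claim.
    have hib : i ≠ B t := fun h => hnot (h ▸ hB)
    have h6 := h5 i hib
    rw [estRate_le_iff (hN t), two_mul_rate_natCast (hN t), two_mul_rate_natCast (hN t)] at h6
    have hb0 := hN' t (B t)
    replace h6 := le_of_mul_le_mul_left h6 (by positivity)
    have h7 := rate_le_rateObj (m₁ := postMean prior x (count n₀ I t) i)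
      (m₂ := postMean prior x (count n₀ I t) (B t)) (hN' t i).le (hvar0 t i) hb0.le (hvar0 t (B t))
      (postMean prior x (count n₀ I t) (B t))
    rw [rateObj_eq, logTerm_self, mul_zero, add_zero] at h7
    have h8 := logTerm_le (hvar0 t i) (postMean prior x (count n₀ I t) i)
      (postMean prior x (count n₀ I t) (B t))
    have hsq : ∀ j, (postMean prior x (count n₀ I t) j -
        postMean prior x (count n₀ I t) (B t)) ^ 2 ≤ D ^ 2 := fun j =>
      sq_le_sq' (by linarith [hgap t (B t) j]) (hgap t j (B t))
    have h9 : (postMean prior x (count n₀ I t) i - postMean prior x (count n₀ I t) (B t)) ^ 2 /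
        postVar prior x (count n₀ I t) i ≤ D ^ 2 / lo :=
      div_le_div₀ (by positivity) (hsq i) hlo (hvar t i).1
    have h10 : (count n₀ I t i : ℝ) ≤ K := by exact_mod_cast hK i hnot t
    have h11 : rate (count n₀ I t i) (postMean prior x (count n₀ I t) i)
        (postVar prior x (count n₀ I t) i) (count n₀ I t (B t))
        (postMean prior x (count n₀ I t) (B t)) (postVar prior x (count n₀ I t) (B t)) ≤
        K / 2 * (D ^ 2 / lo) := by
      refine h7.trans ?_
      have := h8.trans h9
      have := logTerm_nonneg (hvar0 t i) (postMean prior x (count n₀ I t) i)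
        (postMean prior x (count n₀ I t) (B t))
      gcongr
    have h12 := le_rate (m₁ := postMean prior x (count n₀ I t) (I t))
      (m₂ := postMean prior x (count n₀ I t) (B t)) (hN' t (I t)).le hb0.le (hvar0 t (I t))
      (hvar0 t (B t)) (hvar t (I t)).2 (hvar t (B t)).2
    set d := postMean prior x (count n₀ I t) (B t) - postMean prior x (count n₀ I t) (I t) with hd
    have hdD : d ^ 2 ≤ D ^ 2 := by
      have := hsq (I t)
      calc d ^ 2 = _ := by rw [hd]; ring
        _ ≤ D ^ 2 := this
    have h13 : d ^ 2 / (4 * hi + D ^ 2) ≤ Real.log (1 + d ^ 2 / (4 * hi)) := by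
      have := le_logTerm (v := 4 * hi) (by positivity) d 0
      rw [logTerm, sub_zero] at this
      refine le_trans ?_ this
      gcongr
    set mn := min (count n₀ I t (I t) : ℝ) (count n₀ I t (B t))
    have hmn : 0 ≤ mn := le_min (hN' t _).le (hN' t _).le
    have h14 : mn / 2 * (d ^ 2 / (4 * hi + D ^ 2)) ≤ K / 2 * (D ^ 2 / lo) :=
      (mul_le_mul_of_nonneg_left h13 (by positivity)).trans (h12.trans (h6.trans h11))
    have hp : 0 < 4 * hi + D ^ 2 := by positivity
    rw [← mul_div_assoc, div_le_iff₀ hp] at h14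
    linarith
  have hmeanA : ∀ j ∈ A, Tendsto (fun t => postMean prior x (count n₀ I t) j) atTop (𝓝 (m j)) :=
    fun j hj => hest.tendsto_mean (hx j) hj
  -- If `m i < m j`, then at a late observation of `i` its posterior mean is at least `δ` below that
  -- of the estimated best. As both counts are large, this contradicts the bound `K₂`.
  have hle : ∀ i ∈ A, ∀ j ∈ A, m j ≤ m i := by
    intro i hi j hj
    by_contra hcon
    rw [not_le] at hcon
    set δ := (m j - m i) / 2 with hδ
    have hδ0 : 0 < δ := by rw [hδ]; linarith
    have h1 : ∀ᶠ t in atTop, δ < postMean prior x (count n₀ I t) j -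
        postMean prior x (count n₀ I t) i :=
      ((hmeanA j hj).sub (hmeanA i hi)).eventually (lt_mem_nhds (by rw [hδ]; linarith))
    obtain ⟨T, hT⟩ := eventually_atTop.1 (h1.and (hK₂.and (hBA.and (hlarge (K₂ / δ ^ 2)))))
    obtain ⟨t, ht, hIt⟩ := exists_sampled hi T
    obtain ⟨h2, h3, h4, h5⟩ := hT t ht
    have h6 := (hrun t).1.1 j
    by_cases hib : I t = B t
    · rw [← hib, hIt] at h6
      linarith
    · have h7 := h3 hib
      rw [hIt] at h7
      have h8 : δ ^ 2 ≤ (postMean prior x (count n₀ I t) (B t) -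
          postMean prior x (count n₀ I t) i) ^ 2 := by gcongr; linarith
      have h9 : K₂ / δ ^ 2 < min (count n₀ I t i : ℝ) (count n₀ I t (B t)) :=
        lt_min (h5 i hi) (h5 _ h4)
      rw [div_lt_iff₀ (by positivity)] at h9
      have h10 : min (count n₀ I t i : ℝ) (count n₀ I t (B t)) * δ ^ 2 ≤ K₂ := by
        refine le_trans ?_ h7
        have := le_min (hN' t i).le (hN' t (B t)).le
        gcongr
      linarith
  have heqA : ∀ j ∈ A, m j = m a := fun j hj => le_antisymm (hle a ha j hj) (hle j hj a ha)
  obtain ⟨C₁, hC₁⟩ := hest.mean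
  have hC₁0 : 0 ≤ C₁ := by
    have h1 := (abs_nonneg _).trans (hC₁ (count n₀ I 0) (le_count n₀ I 0) a)
    have h2 : 0 < √(count n₀ I 0 a : ℝ) := Real.sqrt_pos.2 (hN' 0 a)
    by_contra hcon
    have := div_neg_of_neg_of_pos (not_le.1 hcon) h2
    linarith
  -- The first condition turns a ratio sum at most 1 into a count of the estimated best of at least
  -- `s / q`. The second makes the ratio sum at most 1 when all other counts are below `s / q`.
  obtain ⟨q, hq1, hqc, hqC⟩ : ∃ q : ℕ, 0 < q ∧ 1 ≤ c₀ * (q : ℝ) ^ 2 ∧ k * C₀ ≤ (q : ℝ) ^ 2 := by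
    have h1 : Tendsto (fun q : ℕ => (q : ℝ) ^ 2) atTop atTop :=
      (tendsto_pow_atTop two_ne_zero).comp tendsto_natCast_atTop_atTop
    obtain ⟨q, ⟨h2, h3⟩, h4⟩ := (((eventually_gt_atTop 0).and
      (h1.eventually_ge_atTop (k * C₀))).and (h1.eventually_ge_atTop (1 / c₀))).exists
    refine ⟨q, h2, ?_, h3⟩
    rw [div_le_iff₀ hc₀pos] at h4
    linarith
  have hq0 : (0 : ℝ) < q := by exact_mod_cast hq1
  obtain ⟨M, hM⟩ := hosc q hq1
  -- `L` may be chosen after `M`. It covers the posterior errors of both designs, the fluctuation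
  -- `M` of the other design, and a remaining gap of `√(K₂ * q) / √s`.
  obtain ⟨L, hL⟩ := exists_nat_gt (C₁ + M + C₁ * √q + √(K₂ * q))
  obtain ⟨T, hT⟩ := eventually_atTop.1 (hBA.and hK₂)
  -- The lower bound on `s` ensures that the observation of `a` taken at count `s` comes after `T`,
  -- and that counts outside `A`, being at most `K`, are below `s / q`.
  obtain ⟨s, ⟨hs1, hs2⟩, hsT⟩ := ((hM L a).and_eventually
    (eventually_ge_atTop (T + n₀ + q * K + 1))).exists
  have hsn₀ : n₀ ≤ s := by
    have := Nat.zero_le (q * K)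
    omega
  obtain ⟨t, hts, hIt, hst⟩ := exists_sampled_at ha hsn₀
  have htT : T ≤ t := by
    have := Nat.zero_le (q * K)
    omega
  obtain ⟨hBt, hK₂t⟩ := hT t htT
  have hs0 : (0 : ℝ) < s := by rw [← hts]; exact hN' t a
  have hsq0 : 0 < √(s : ℝ) := Real.sqrt_pos.2 hs0
  have hμa : postMean prior x (count n₀ I t) a ≤ m a - (L - C₁) / √s := by
    have h1 := (abs_le.1 (hC₁ (count n₀ I t) (le_count n₀ I t) a)).2
    rw [hts] at h1
    have : (L - C₁) / √(s : ℝ) = L / √s - C₁ / √s := by ring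
    linarith
  have hμj : ∀ j ∈ A, j ≠ a → s ≤ q * count n₀ I t j →
      m a - (M + C₁ * √q) / √s ≤ postMean prior x (count n₀ I t) j := by
    intro j hj hja hsj
    have h1 := hs2 j hja _ hsj
    rw [heqA j hj] at h1
    have h2 := (abs_le.1 (hC₁ (count n₀ I t) (le_count n₀ I t) j)).1
    have h3 : C₁ / √(count n₀ I t j : ℝ) ≤ C₁ * √q / √s := by
      rw [div_le_div_iff₀ (Real.sqrt_pos.2 (hN' t j)) hsq0, mul_assoc, ← Real.sqrt_mul hq0.le]
      gcongr
      exact_mod_cast hsj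
    have : (M + C₁ * √q) / √(s : ℝ) = M / √s + C₁ * √q / √s := by ring
    linarith
  have hfar : ∀ j ∈ A, j ≠ a → s ≤ q * count n₀ I t j →
      √(K₂ * q) / √s < postMean prior x (count n₀ I t) j - postMean prior x (count n₀ I t) a := by
    intro j hj hja hsj
    have h1 := hμj j hj hja hsj
    have h2 : √(K₂ * q) / √(s : ℝ) < (L - C₁ - M - C₁ * √q) / √s :=
      div_lt_div_of_pos_right (by linarith) hsq0
    have h3 : (L - C₁ - M - C₁ * √q) / √(s : ℝ) = (L - C₁) / √s - (M + C₁ * √q) / √s := by ring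
    linarith
  by_cases hab : I t = B t
  · -- `a` is the estimated best design
    rw [hIt] at hab
    have hsmall : ∀ j, j ≠ a → q * count n₀ I t j < s := by
      intro j hja
      by_cases hj : j ∈ A
      · by_contra hcon
        have h1 := hfar j hj hja (not_lt.1 hcon)
        have h2 := (hrun t).1.1 j
        rw [← hab] at h2
        have h3 : 0 ≤ √(K₂ * q) / √(s : ℝ) := by positivity
        linarith
      · have := Nat.mul_le_mul_left q (hK j hj t)
        have := Nat.zero_le (T + n₀)
        omega
    -- Among tied maximisers the estimated best has the fewest observations. Since `a` has more than
    -- any other design, there is no tie.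
    have hu : ∃! l, IsPostArgmax prior x (count n₀ I t) l := by
      refine ⟨a, by rw [hab]; exact (hrun t).1.1, fun j hj => ?_⟩
      by_contra hja
      have h1 := (hrun t).1.2 j hj
      rw [← hab, hts] at h1
      have h2 := hsmall j hja
      have h3 : 1 * count n₀ I t j ≤ q * count n₀ I t j := Nat.mul_le_mul_right _ hq1
      omega
    have hr : estRatioSum prior x (count n₀ I t) (B t) ≤ 1 := by
      rw [estRatioSum_eq]
      calc _ ≤ ∑ j ∈ Finset.univ.erase (B t), C₀ / (q : ℝ) ^ 2 := by
            refine Finset.sum_le_sum fun j hj => ?_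
            have hjb := Finset.ne_of_mem_erase hj
            refine (estRatio_bounds (hN t) hlo (hvar t j) (hvar t (B t)) (hgap t (B t) j)
              (lt_of_existsUnique hu (hrun t).1.1 hjb)).2.trans ?_
            rw [← hC₀, ← hab, hts, div_eq_mul_inv C₀, ← inv_pow]
            gcongr
            rw [div_le_iff₀ hs0, inv_mul_eq_div, le_div_iff₀ hq0, mul_comm]
            exact_mod_cast (hsmall j (by rw [hab]; exact hjb)).le
        _ ≤ ∑ j : Fin k, C₀ / (q : ℝ) ^ 2 :=
            Finset.sum_le_sum_of_subset_of_nonneg (Finset.subset_univ _)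
              fun _ _ _ => by positivity
        _ = k * C₀ / (q : ℝ) ^ 2 := by simp [mul_div_assoc]
        _ ≤ 1 := by rw [div_le_one (by positivity)]; exact hqC
    exact ((hrun t).2.2 hu hr).1 (hIt.trans hab)
  · -- `a` is not the estimated best design
    obtain ⟨h3, h4, -⟩ := hnonbest t hab
    rw [hIt] at hab
    have h5 := (hratio_ge t (B t) a h3 (hrun t).1.1 hab).trans h4
    have hb0 := hN' t (B t)
    rw [hts, div_pow, ← mul_div_assoc, div_le_one (by positivity)] at h5
    have h6 : (s : ℝ) ≤ q * count n₀ I t (B t) := by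
      apply le_of_sq_le_sq _ (by positivity)
      calc (s : ℝ) ^ 2 ≤ c₀ * (q : ℝ) ^ 2 * s ^ 2 := by nlinarith [sq_nonneg (s : ℝ)]
        _ = q ^ 2 * (c₀ * s ^ 2) := by ring
        _ ≤ q ^ 2 * (count n₀ I t (B t) : ℝ) ^ 2 := by gcongr
        _ = _ := by ring
    have h7 := hfar (B t) hBt (Ne.symm hab) (by exact_mod_cast h6)
    have h8 := hK₂t (by rw [hIt]; exact hab)
    rw [hIt, hts] at h8
    have h9 : (s : ℝ) / q ≤ min (s : ℝ) (count n₀ I t (B t)) := by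
      refine le_min (div_le_self hs0.le (by exact_mod_cast hq1)) ?_
      rw [div_le_iff₀ hq0]; linarith
    have h10 : (√(K₂ * q) / √(s : ℝ)) ^ 2 < (postMean prior x (count n₀ I t) (B t) -
        postMean prior x (count n₀ I t) a) ^ 2 := by gcongr
    rw [div_pow, Real.sq_sqrt (by positivity), Real.sq_sqrt hs0.le] at h10
    have h11 : K₂ < (s : ℝ) / q * (postMean prior x (count n₀ I t) (B t) -
        postMean prior x (count n₀ I t) a) ^ 2 := by
      calc K₂ = (s : ℝ) / q * (K₂ * q / s) := by field_simp
        _ < _ := by gcongr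
    have h12 := mul_le_mul_of_nonneg_right h9 (sq_nonneg (postMean prior x (count n₀ I t) (B t) -
        postMean prior x (count n₀ I t) a))
    linarith

end Consistency

/-! ### Convergence of the proportions on a good path -/

section Limit

variable {k : ℕ} {m v : Fin k → ℝ} {best : Fin k} {prior : (Fin k → ℝ) × (Fin k → ℝ) → ℝ}
  {x : Fin k → ℕ → ℝ} {n₀ : ℕ} {B I : ℕ → Fin k}

lemma proportion_eq_allocOfRatio (hn₀ : 1 ≤ n₀) (t : ℕ) (b i : Fin k) :
    proportion (count n₀ I t) i = allocOfRatio b (countRatio n₀ I b t) i := by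
  have hN : ∀ i, (0 : ℝ) < count n₀ I t i := fun i => by
    exact_mod_cast hn₀.trans (le_count n₀ I t i)
  have hb := hN b
  have hsum : 1 + sumOthers b (countRatio n₀ I b t) =
      (∑ j, (count n₀ I t j : ℝ)) / count n₀ I t b := by
    rw [Finset.sum_div, sum_eq_sumOthers b, div_self hb.ne']
    rfl
  have hpos : (0 : ℝ) < ∑ j, (count n₀ I t j : ℝ) :=
    Finset.sum_pos (fun j _ => hN j) ⟨i, Finset.mem_univ i⟩
  unfold proportion allocOfRatio
  rw [hsum]
  split_ifs with h
  · rw [h]; field_simp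
  · unfold countRatio; field_simp

lemma tendsto_of_tendsto_strictMonoOn {ι : Type*} {l : Filter ι} {f : ℝ → ℝ} {u : ι → ℝ} {a : ℝ}
    (hf : StrictMonoOn f (Ici 0)) (ha : 0 < a) (hu : ∀ t, 0 ≤ u t)
    (h : Tendsto (fun t => f (u t)) l (𝓝 (f a))) : Tendsto u l (𝓝 a) := by
  rw [tendsto_order]
  constructor
  · intro y hy
    have h1 : f (max y 0) < f a := hf (mem_Ici.2 (le_max_right _ _)) ha.le (max_lt hy ha)
    filter_upwards [h.eventually (lt_mem_nhds h1)] with t ht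
    by_contra hcon
    have := hf.monotoneOn (hu t) (mem_Ici.2 (le_max_right y 0))
      ((not_lt.1 hcon).trans (le_max_left _ _))
    linarith
  · intro y hy
    have h1 : f a < f y := hf ha.le (ha.trans hy).le hy
    filter_upwards [h.eventually (gt_mem_nhds h1)] with t ht
    by_contra hcon
    have := hf.monotoneOn (ha.trans hy).le (hu t) (not_lt.1 hcon)
    linarith

/-- On every path with consistent estimates and oscillating sample means, every run converges to
the optimal allocation. -/
theorem run_converges (hk : 2 ≤ k) (hv : ∀ i, 0 < v i) (hbest : ∀ i, i ≠ best → m i < m best)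
    (hn₀ : 1 ≤ n₀) {α : Fin k → ℝ} (hα : IsOptimalAllocation m v best α)
    (hest : ConsistentEstimates v prior n₀ x)
    (hx : ∀ i, Tendsto (sampleMean (x i)) atTop (𝓝 (m i))) (hosc : OscillatingMeans m x)
    (hrun : IsRun prior n₀ x B I) {ε : ℝ} (hε : 0 < ε) :
    ∃ M M' : ℕ, M ≤ M' ∧
      (∀ t, M ≤ t → ∀ i j, i ≠ best → j ≠ best →
        |estScaledRate prior x (count n₀ I t) (B t) i -
          estScaledRate prior x (count n₀ I t) (B t) j| ≤ ε) ∧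
      (∀ t, M' ≤ t → ∀ i, |proportion (count n₀ I t) i - α i| ≤ ε) := by
  obtain ⟨r, W, hW, hr, -, huniq, hopt⟩ := exists_unique_optimal hv hbest hk
  rw [huniq α hα]
  have hinf := tendsto_count_atTop hn₀ hest hx hosc hrun
  obtain ⟨hB, hG, hS⟩ := balanced_of_consistent hv hbest hn₀ hW hr hopt hrun hinf
    (fun i => hest.tendsto_mean (hx i) (hinf i)) (fun i => hest.tendsto_var (hinf i))
  have hR : ∀ i, i ≠ best → Tendsto (fun t => countRatio n₀ I best t i) atTop (𝓝 (r i)) := by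
    intro i hi
    refine tendsto_of_tendsto_strictMonoOn (strictMonoOn_profile (hv i) (hv best) (hbest i hi))
      (hr i hi).1 (fun t => (countRatio_pos hn₀ t i).le) ?_
    have := hG i hi
    rw [← (hr i hi).2] at this
    exact this
  have hsum : Tendsto (fun t => 1 + sumOthers best (countRatio n₀ I best t)) atTop
      (𝓝 (1 + sumOthers best r)) :=
    (tendsto_finsetSum _ fun i hi => hR i (Finset.ne_of_mem_erase hi)).const_add 1
  have hne : 1 + sumOthers best r ≠ 0 := by
    have := sumOthers_nonneg fun i hi => (hr i hi).1.le
    positivity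
  have hP : ∀ i, Tendsto (fun t => proportion (count n₀ I t) i) atTop
      (𝓝 (allocOfRatio best r i)) := by
    intro i
    simp_rw [fun t => proportion_eq_allocOfRatio (I := I) hn₀ t best i]
    unfold allocOfRatio
    split_ifs with h
    · exact tendsto_const_nhds.div hsum hne
    · exact (hR i h).div hsum hne
  have e1 : ∀ᶠ t in atTop, ∀ i, i ≠ best →
      |estScaledRate prior x (count n₀ I t) best i - W| ≤ ε / 2 := by
    refine eventually_all.2 fun i => ?_
    by_cases hi : i = best
    · exact Eventually.of_forall fun _ h => absurd hi h
    · filter_upwards [(Metric.tendsto_nhds.1 (hS i hi)) (ε / 2) (by positivity)] with t ht _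
      exact ht.le
  have e2 : ∀ᶠ t in atTop, ∀ i, |proportion (count n₀ I t) i - allocOfRatio best r i| ≤ ε := by
    refine eventually_all.2 fun i => ?_
    filter_upwards [(Metric.tendsto_nhds.1 (hP i)) ε hε] with t ht
    exact ht.le
  obtain ⟨M, hM⟩ := eventually_atTop.1 (hB.and e1)
  obtain ⟨M', hM'⟩ := eventually_atTop.1 e2
  refine ⟨M, max M M', le_max_left _ _, fun t ht i j hi hj => ?_,
    fun t ht => hM' t ((le_max_right _ _).trans ht)⟩
  obtain ⟨h1, h2⟩ := hM t ht
  rw [h1]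
  have h3 := abs_le.1 (h2 i hi)
  have h4 := abs_le.1 (h2 j hj)
  rw [abs_le]
  constructor <;> linarith [h3.1, h3.2, h4.1, h4.2]

end Limit

/-! ### Inverse-gamma and normal-inverse-gamma integrals -/

section InverseGamma

variable {α β : ℝ}

/-- The substitution of 1 / ψ for ψ, with its Jacobian, turns the gamma integrand into the
inverse-gamma one. -/
lemma invGamma_eq {x : ℝ} (hx : x ∈ Ioi (0 : ℝ)) :
    (|(-1 : ℝ)| * x ^ ((-1 : ℝ) - 1)) • ((x ^ (-1 : ℝ)) ^ (α - 1) * Real.exp (-(β * x ^ (-1 : ℝ)))) =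
      x ^ (-(α + 1)) * Real.exp (-β / x) := by
  have hx' : 0 < x := hx
  rw [← Real.rpow_mul hx'.le, smul_eq_mul, abs_neg, abs_one, one_mul, ← mul_assoc,
    ← Real.rpow_add hx', Real.rpow_neg_one]
  congr 2
  · ring
  · rw [neg_div, div_eq_mul_inv]

lemma integrableOn_invGamma (hα : 0 < α) (hβ : 0 < β) :
    IntegrableOn (fun ψ : ℝ => ψ ^ (-(α + 1)) * Real.exp (-β / ψ)) (Ioi 0) := by
  have h := (integrableOn_Ioi_comp_rpow_iff (fun y : ℝ => y ^ (α - 1) * Real.exp (-(β * y)))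
    (p := -1) (by norm_num)).2 ?_
  · exact h.congr_fun (fun x hx => invGamma_eq hx) measurableSet_Ioi
  · have := integrableOn_rpow_mul_exp_neg_mul_rpow (p := 1) (s := α - 1) (b := β) (by linarith)
      one_pos hβ
    simpa using this

lemma integral_invGamma (hα : 0 < α) (hβ : 0 < β) :
    ∫ ψ in Ioi (0 : ℝ), ψ ^ (-(α + 1)) * Real.exp (-β / ψ) = (1 / β) ^ α * Real.Gamma α := by
  rw [← Real.integral_rpow_mul_exp_neg_mul_Ioi hα hβ, ← integral_comp_rpow_Ioi
    (fun y : ℝ => y ^ (α - 1) * Real.exp (-(β * y))) (p := -1) (by norm_num)]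
  exact setIntegral_congr_fun measurableSet_Ioi fun x hx => (invGamma_eq hx).symm

end InverseGamma

/-- Lebesgue measure on pairs of a mean and a positive variance. -/
noncomputable def pairMeasure : Measure (ℝ × ℝ) :=
  (volume : Measure ℝ).prod (volume.restrict (Ioi 0))

instance : SigmaFinite pairMeasure := by unfold pairMeasure; infer_instance

lemma pairMeasure_eq : pairMeasure = volume.restrict {p : ℝ × ℝ | 0 < p.2} := by
  have : {p : ℝ × ℝ | 0 < p.2} = univ ×ˢ Ioi 0 := by ext; simp
  rw [this, Measure.volume_eq_prod, ← Measure.prod_restrict, Measure.restrict_univ, pairMeasure]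

lemma measurableSet_snd_pos : MeasurableSet {p : ℝ × ℝ | 0 < p.2} :=
  measurableSet_lt measurable_const measurable_snd

lemma ae_pairMeasure : ∀ᵐ p ∂pairMeasure, 0 < p.2 := by
  rw [pairMeasure_eq]
  exact ae_restrict_mem measurableSet_snd_pos

section Nig

variable {loc lam a b : ℝ}

lemma nigKernel_nonneg {φ ψ : ℝ} (hψ : 0 < ψ) : 0 ≤ nigKernel loc lam a b φ ψ := by
  unfold nigKernel; positivity

lemma nigKernel_pos {φ ψ : ℝ} (hψ : 0 < ψ) : 0 < nigKernel loc lam a b φ ψ := by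
  unfold nigKernel; positivity

lemma measurable_nigKernel :
    Measurable fun p : ℝ × ℝ => nigKernel loc lam a b p.1 p.2 := by
  unfold nigKernel; fun_prop

/-- This shift of the shape reduces moments of the variance to normalising constants. -/
lemma mul_nigKernel {φ ψ : ℝ} (hψ : 0 < ψ) :
    ψ * nigKernel loc lam a b φ ψ = nigKernel loc lam (a - 1) b φ ψ := by
  unfold nigKernel
  have : ψ ^ (-(a - 1 + 1)) = ψ * ψ ^ (-(a + 1)) := by
    rw [mul_comm, ← Real.rpow_add_one hψ.ne']
    congr 1; ring
  rw [this]
  ring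

/-- Given ψ, the mean is normal with variance ψ / lam, and ψ itself follows an inverse-gamma law.
The normal density has integral 1, so only an integral over ψ remains. -/
lemma nigKernel_eq_gaussian (hlam : 0 < lam) {φ ψ : ℝ} (hψ : 0 < ψ) :
    nigKernel loc lam a b φ ψ = gaussianPDFReal loc (ψ / lam).toNNReal φ *
      (√(2 * Real.pi / lam) * (ψ ^ (-(a + 1)) * Real.exp (-b / ψ))) := by
  unfold nigKernel gaussianPDFReal
  rw [Real.coe_toNNReal _ (by positivity)]
  have h1 : √(2 * Real.pi * (ψ / lam)) = √(2 * Real.pi / lam) * √ψ := by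
    rw [← Real.sqrt_mul (by positivity)]; congr 1; ring
  have h2 : ψ ^ (-(1 / 2 : ℝ)) = (√ψ)⁻¹ := by
    rw [Real.rpow_neg hψ.le, Real.sqrt_eq_rpow]
  have h3 : -(φ - loc) ^ 2 / (2 * (ψ / lam)) = -(lam * (φ - loc) ^ 2) / (2 * ψ) := by
    field_simp
  rw [h1, h2, h3]
  have : 0 < √(2 * Real.pi / lam) := Real.sqrt_pos.2 (by positivity)
  have : 0 < √ψ := Real.sqrt_pos.2 hψ
  field_simp

lemma integrable_sq_mul_gaussianPDFReal (μ : ℝ) {v : NNReal} (hv : v ≠ 0) :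
    Integrable fun φ => (φ - μ) ^ 2 * gaussianPDFReal μ v φ := by
  have h : Integrable (fun φ : ℝ => (φ - μ) ^ 2) (gaussianReal μ v) := by
    have := ((memLp_id_gaussianReal (μ := μ) (v := v) 2).sub (memLp_const μ)).integrable_sq
    exact this
  rw [gaussianReal_of_var_ne_zero _ hv, integrable_withDensity_iff (measurable_gaussianPDF _ _)
    (ae_of_all _ fun _ => gaussianPDF_lt_top)] at h
  simpa [toReal_gaussianPDF] using h

lemma integral_sq_mul_gaussianPDFReal (μ : ℝ) {v : NNReal} (hv : v ≠ 0) :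
    ∫ φ, (φ - μ) ^ 2 * gaussianPDFReal μ v φ = v := by
  have h := variance_fun_id_gaussianReal (μ := μ) (v := v)
  rw [variance_eq_integral (by fun_prop), integral_id_gaussianReal,
    integral_gaussianReal_eq_integral_smul hv] at h
  rw [← h]
  congr 1
  ext φ
  rw [smul_eq_mul, mul_comm]

lemma integral_sub_mul_gaussianPDFReal (μ : ℝ) {v : NNReal} (hv : v ≠ 0) :
    ∫ φ, (φ - μ) * gaussianPDFReal μ v φ = 0 := by
  have h : ∫ φ, (φ - μ) ∂gaussianReal μ v = 0 := by
    rw [integral_sub _ (integrable_const _), integral_id_gaussianReal]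
    · simp
    · exact (memLp_id_gaussianReal (μ := μ) (v := v) 1).integrable le_rfl
  rw [integral_gaussianReal_eq_integral_smul hv] at h
  rw [← h]
  congr 1
  ext φ
  rw [smul_eq_mul, mul_comm]

/-- Integrals against the normal-inverse-gamma kernel are iterated integrals. -/
lemma integrable_mul_nigKernel_of (hlam : 0 < lam) {g : ℝ → ℝ} (hg : Measurable g)
    (hg0 : ∀ φ, 0 ≤ g φ) {G : ℝ → ℝ}
    (hint : ∀ ψ, 0 < ψ → Integrable fun φ => g φ * gaussianPDFReal loc (ψ / lam).toNNReal φ)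
    (hG : ∀ ψ, 0 < ψ → ∫ φ, g φ * gaussianPDFReal loc (ψ / lam).toNNReal φ = G ψ)
    (hGi : IntegrableOn (fun ψ => G ψ * (ψ ^ (-(a + 1)) * Real.exp (-b / ψ))) (Ioi 0)) :
    Integrable (fun p : ℝ × ℝ => g p.1 * nigKernel loc lam a b p.1 p.2) pairMeasure := by
  have hmeas : Measurable fun p : ℝ × ℝ => g p.1 * nigKernel loc lam a b p.1 p.2 :=
    (hg.comp measurable_fst).mul measurable_nigKernel
  rw [pairMeasure, integrable_prod_iff' hmeas.aestronglyMeasurable]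
  constructor
  · filter_upwards [ae_restrict_mem measurableSet_Ioi] with ψ hψ
    have : (fun φ => g φ * nigKernel loc lam a b φ ψ) = fun φ =>
        (g φ * gaussianPDFReal loc (ψ / lam).toNNReal φ) *
        (√(2 * Real.pi / lam) * (ψ ^ (-(a + 1)) * Real.exp (-b / ψ))) := by
      ext φ
      rw [nigKernel_eq_gaussian hlam hψ]; ring
    rw [this]
    exact (hint ψ hψ).mul_const _
  · refine (hGi.const_mul √(2 * Real.pi / lam)).congr ?_
    filter_upwards [ae_restrict_mem measurableSet_Ioi] with ψ hψ
    have : ∀ φ, ‖g φ * nigKernel loc lam a b φ ψ‖ =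
        (g φ * gaussianPDFReal loc (ψ / lam).toNNReal φ) *
        (√(2 * Real.pi / lam) * (ψ ^ (-(a + 1)) * Real.exp (-b / ψ))) := by
      intro φ
      rw [Real.norm_of_nonneg (mul_nonneg (hg0 φ) (nigKernel_nonneg hψ)),
        nigKernel_eq_gaussian hlam hψ]
      ring
    simp_rw [this]
    rw [integral_mul_const, hG ψ hψ]
    ring

lemma integral_mul_nigKernel_of (hlam : 0 < lam) {g : ℝ → ℝ} {G : ℝ → ℝ}
    (hG : ∀ ψ, 0 < ψ → ∫ φ, g φ * gaussianPDFReal loc (ψ / lam).toNNReal φ = G ψ)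
    (hi : Integrable (fun p : ℝ × ℝ => g p.1 * nigKernel loc lam a b p.1 p.2) pairMeasure) :
    ∫ p, g p.1 * nigKernel loc lam a b p.1 p.2 ∂pairMeasure = √(2 * Real.pi / lam) *
      ∫ ψ in Ioi 0, G ψ * (ψ ^ (-(a + 1)) * Real.exp (-b / ψ)) := by
  rw [pairMeasure] at hi ⊢
  rw [integral_prod_symm _ hi, ← integral_const_mul]
  refine setIntegral_congr_fun measurableSet_Ioi fun ψ hψ => ?_
  have : (fun φ => g φ * nigKernel loc lam a b φ ψ) = fun φ =>
      (g φ * gaussianPDFReal loc (ψ / lam).toNNReal φ) *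
      (√(2 * Real.pi / lam) * (ψ ^ (-(a + 1)) * Real.exp (-b / ψ))) := by
    ext φ
    rw [nigKernel_eq_gaussian hlam hψ]; ring
  simp only [this]
  rw [integral_mul_const, hG ψ hψ]
  ring

lemma toNNReal_div_ne_zero {ψ : ℝ} (hlam : 0 < lam) (hψ : 0 < ψ) : (ψ / lam).toNNReal ≠ 0 := by
  have : 0 < ψ / lam := by positivity
  simpa using this

lemma integrable_nigKernel (hlam : 0 < lam) (ha : 0 < a) (hb : 0 < b) :
    Integrable (fun p : ℝ × ℝ => nigKernel loc lam a b p.1 p.2) pairMeasure := by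
  have := integrable_mul_nigKernel_of (loc := loc) (a := a) (b := b) hlam (g := fun _ => 1)
    measurable_const (fun _ => zero_le_one) (G := fun _ => 1)
    (fun ψ hψ => by simpa using integrable_gaussianPDFReal _ _)
    (fun ψ hψ => by
      simpa using integral_gaussianPDFReal_eq_one loc (toNNReal_div_ne_zero hlam hψ))
    (by simpa using integrableOn_invGamma ha hb)
  simpa using this

lemma integral_nigKernel (hlam : 0 < lam) (ha : 0 < a) (hb : 0 < b) :
    ∫ p, nigKernel loc lam a b p.1 p.2 ∂pairMeasure =
      √(2 * Real.pi / lam) * ((1 / b) ^ a * Real.Gamma a) := by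
  have h := integral_mul_nigKernel_of (loc := loc) (a := a) (b := b) hlam (g := fun _ => 1)
    (G := fun _ => 1)
    (fun ψ hψ => by
      simpa using integral_gaussianPDFReal_eq_one loc (toNNReal_div_ne_zero hlam hψ))
    (by simpa using integrable_nigKernel hlam ha hb)
  simp only [one_mul] at h
  rw [h, integral_invGamma ha hb]

lemma integral_nigKernel_pos (hlam : 0 < lam) (ha : 0 < a) (hb : 0 < b) :
    0 < ∫ p, nigKernel loc lam a b p.1 p.2 ∂pairMeasure := by
  rw [integral_nigKernel hlam ha hb]
  have := Real.Gamma_pos_of_pos ha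
  have : 0 < √(2 * Real.pi / lam) := Real.sqrt_pos.2 (by positivity)
  positivity

lemma snd_mul_nigKernel_ae (c : ℝ) :
    (fun p : ℝ × ℝ => p.2 * nigKernel loc lam c b p.1 p.2) =ᵐ[pairMeasure]
      fun p => nigKernel loc lam (c - 1) b p.1 p.2 := by
  filter_upwards [ae_pairMeasure] with p hp
  exact mul_nigKernel hp

lemma integrable_snd_mul_nigKernel (hlam : 0 < lam) (ha : 1 < a) (hb : 0 < b) :
    Integrable (fun p : ℝ × ℝ => p.2 * nigKernel loc lam a b p.1 p.2) pairMeasure :=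
  (integrable_nigKernel hlam (by linarith) hb).congr (snd_mul_nigKernel_ae a).symm

lemma integral_snd_mul_nigKernel (hlam : 0 < lam) (ha : 1 < a) (hb : 0 < b) :
    ∫ p, p.2 * nigKernel loc lam a b p.1 p.2 ∂pairMeasure =
      b / (a - 1) * ∫ p, nigKernel loc lam a b p.1 p.2 ∂pairMeasure := by
  rw [integral_congr_ae (snd_mul_nigKernel_ae a), integral_nigKernel hlam (by linarith) hb,
    integral_nigKernel hlam (by linarith) hb]
  have h1 : Real.Gamma a = (a - 1) * Real.Gamma (a - 1) := by
    have := Real.Gamma_add_one (s := a - 1) (by linarith)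
    rwa [sub_add_cancel] at this
  have h2 : (1 / b) ^ a = (1 / b) ^ (a - 1) * (1 / b) := by
    rw [← Real.rpow_add_one (by positivity), sub_add_cancel]
  rw [h1, h2]
  have : a - 1 ≠ 0 := by linarith
  field_simp

lemma snd_sq_mul_nigKernel_ae :
    (fun p : ℝ × ℝ => p.2 ^ 2 * nigKernel loc lam a b p.1 p.2) =ᵐ[pairMeasure]
      fun p => p.2 * nigKernel loc lam (a - 1) b p.1 p.2 := by
  filter_upwards [ae_pairMeasure] with p hp
  rw [← mul_nigKernel hp]; ring

lemma integrable_snd_sq_mul_nigKernel (hlam : 0 < lam) (ha : 2 < a) (hb : 0 < b) :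
    Integrable (fun p : ℝ × ℝ => p.2 ^ 2 * nigKernel loc lam a b p.1 p.2) pairMeasure :=
  (integrable_snd_mul_nigKernel hlam (by linarith) hb).congr snd_sq_mul_nigKernel_ae.symm

lemma integral_snd_sq_mul_nigKernel (hlam : 0 < lam) (ha : 2 < a) (hb : 0 < b) :
    ∫ p, p.2 ^ 2 * nigKernel loc lam a b p.1 p.2 ∂pairMeasure =
      b ^ 2 / ((a - 1) * (a - 2)) * ∫ p, nigKernel loc lam a b p.1 p.2 ∂pairMeasure := by
  rw [integral_congr_ae snd_sq_mul_nigKernel_ae, integral_snd_mul_nigKernel hlam (by linarith) hb,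
    ← integral_congr_ae (snd_mul_nigKernel_ae a), integral_snd_mul_nigKernel hlam (by linarith) hb]
  have : a - 1 ≠ 0 := by linarith
  have : a - 2 ≠ 0 := by linarith
  have : a - 1 - 1 = a - 2 := by ring
  rw [this]
  field_simp

lemma integrable_fst_sub_sq_mul_nigKernel (hlam : 0 < lam) (ha : 1 < a) (hb : 0 < b) :
    Integrable (fun p : ℝ × ℝ => (p.1 - loc) ^ 2 * nigKernel loc lam a b p.1 p.2) pairMeasure := by
  refine integrable_mul_nigKernel_of hlam (g := fun φ => (φ - loc) ^ 2) (G := fun ψ => ψ / lam)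
    (by fun_prop) (fun φ => sq_nonneg _)
    (fun ψ hψ => integrable_sq_mul_gaussianPDFReal _ (toNNReal_div_ne_zero hlam hψ))
    (fun ψ hψ => ?_) ?_
  · rw [integral_sq_mul_gaussianPDFReal _ (toNNReal_div_ne_zero hlam hψ),
      Real.coe_toNNReal _ (by positivity)]
  · refine IntegrableOn.congr_fun ((integrableOn_invGamma (α := a - 1) (by linarith) hb).const_mul
      (1 / lam)) (fun ψ hψ => ?_) measurableSet_Ioi
    have hψ' : 0 < ψ := hψ
    have : ψ ^ (-(a - 1 + 1)) = ψ ^ (-(a + 1)) * ψ := by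
      rw [← Real.rpow_add_one hψ'.ne']; congr 1; ring
    simp only [this]
    ring

lemma integral_fst_sub_sq_mul_nigKernel (hlam : 0 < lam) (ha : 1 < a) (hb : 0 < b) :
    ∫ p, (p.1 - loc) ^ 2 * nigKernel loc lam a b p.1 p.2 ∂pairMeasure =
      b / ((a - 1) * lam) * ∫ p, nigKernel loc lam a b p.1 p.2 ∂pairMeasure := by
  have e : b / ((a - 1) * lam) * ∫ p, nigKernel loc lam a b p.1 p.2 ∂pairMeasure =
      (1 / lam) * ∫ p, p.2 * nigKernel loc lam a b p.1 p.2 ∂pairMeasure := by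
    rw [integral_snd_mul_nigKernel hlam ha hb]
    field_simp
  rw [e, integral_congr_ae (snd_mul_nigKernel_ae a), integral_nigKernel hlam (by linarith) hb,
    integral_mul_nigKernel_of hlam (g := fun φ => (φ - loc) ^ 2) (G := fun ψ => ψ / lam)
      (fun ψ hψ => by
        rw [integral_sq_mul_gaussianPDFReal _ (toNNReal_div_ne_zero hlam hψ),
          Real.coe_toNNReal _ (by positivity)])
      (integrable_fst_sub_sq_mul_nigKernel hlam ha hb),
    ← integral_invGamma (α := a - 1) (β := b) (by linarith) hb]
  rw [mul_left_comm, ← integral_const_mul (1 / lam)]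
  congr 1
  refine setIntegral_congr_fun measurableSet_Ioi fun ψ hψ => ?_
  have hψ' : 0 < ψ := hψ
  have : ψ ^ (-(a - 1 + 1)) = ψ ^ (-(a + 1)) * ψ := by
    rw [← Real.rpow_add_one hψ'.ne']; congr 1; ring
  simp only [this]
  ring

lemma integrable_fst_sub_mul_nigKernel (hlam : 0 < lam) (ha : 1 < a) (hb : 0 < b) :
    Integrable (fun p : ℝ × ℝ => (p.1 - loc) * nigKernel loc lam a b p.1 p.2) pairMeasure := by
  refine ((integrable_nigKernel (loc := loc) (a := a) hlam (by linarith) hb).add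
    (integrable_fst_sub_sq_mul_nigKernel (loc := loc) hlam ha hb)).mono'
    ((measurable_fst.sub_const loc).mul measurable_nigKernel).aestronglyMeasurable ?_
  filter_upwards [ae_pairMeasure] with p hp
  have h := nigKernel_nonneg (loc := loc) (lam := lam) (a := a) (b := b) (φ := p.1) hp
  rw [norm_mul, Real.norm_eq_abs, Real.norm_of_nonneg h, Pi.add_apply]
  have : |p.1 - loc| ≤ 1 + (p.1 - loc) ^ 2 := by
    rw [← sq_abs]; nlinarith [sq_nonneg (|p.1 - loc| - 1), abs_nonneg (p.1 - loc)]
  nlinarith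

lemma integral_fst_sub_mul_nigKernel (hlam : 0 < lam) (ha : 1 < a) (hb : 0 < b) :
    ∫ p, (p.1 - loc) * nigKernel loc lam a b p.1 p.2 ∂pairMeasure = 0 := by
  rw [integral_mul_nigKernel_of hlam (g := fun φ => φ - loc) (G := fun _ => 0)
    (fun ψ hψ => integral_sub_mul_gaussianPDFReal _ (toNNReal_div_ne_zero hlam hψ))
    (integrable_fst_sub_mul_nigKernel hlam ha hb)]
  simp

end Nig

/-! ### Product integrals over the parameter domain -/

section ParamSpace

variable {k : ℕ}

/-- Regrouping the two vectors into `k` pairs makes integrals of products over designs factorise. -/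
lemma measurePreserving_paramSpace (k : ℕ) :
    MeasurePreserving (MeasurableEquiv.arrowProdEquivProdArrow ℝ ℝ (Fin k))
      (Measure.pi fun _ => pairMeasure) (volume.restrict (paramSpace k)) := by
  have h := measurePreserving_arrowProdEquivProdArrow ℝ ℝ (Fin k) (fun _ => volume)
    (fun _ => volume.restrict (Ioi 0))
  have e : paramSpace k = univ ×ˢ (univ.pi fun _ => Ioi 0) := by
    ext θ; simp [paramSpace]
  have e2 : (volume.restrict (paramSpace k)) =
      ((Measure.pi fun _ : Fin k => (volume : Measure ℝ)).prod
        (Measure.pi fun _ : Fin k => volume.restrict (Ioi (0 : ℝ)))) := by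
    rw [e, Measure.volume_eq_prod, ← Measure.prod_restrict, Measure.restrict_univ, volume_pi,
      Measure.restrict_pi_pi]
  rw [e2]
  exact h

lemma measurableSet_paramSpace (k : ℕ) : MeasurableSet (paramSpace k) := by
  have e : paramSpace k = ⋂ i, {θ | 0 < θ.2 i} := by ext; simp [paramSpace]
  rw [e]
  exact MeasurableSet.iInter fun i => measurableSet_lt measurable_const (by fun_prop)

lemma integrableOn_paramSpace_prod {g : Fin k → ℝ × ℝ → ℝ}
    (hg : ∀ i, Integrable (g i) pairMeasure) :
    IntegrableOn (fun θ : (Fin k → ℝ) × (Fin k → ℝ) => ∏ i, g i (θ.1 i, θ.2 i))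
      (paramSpace k) := by
  rw [IntegrableOn, ← (measurePreserving_paramSpace k).integrable_comp_emb
    (MeasurableEquiv.measurableEmbedding _)]
  exact Integrable.fintype_prod hg

lemma integral_paramSpace_prod (g : Fin k → ℝ × ℝ → ℝ) :
    ∫ θ in paramSpace k, ∏ i, g i (θ.1 i, θ.2 i) = ∏ i, ∫ p, g i p ∂pairMeasure := by
  rw [← (measurePreserving_paramSpace k).integral_comp'
    (g := fun θ : (Fin k → ℝ) × (Fin k → ℝ) => ∏ i, g i (θ.1 i, θ.2 i))]
  exact integral_fintype_prod_eq_prod (f := g)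

/-- A factor that depends on design `i` alone is absorbed into the `i`-th factor, so the product
formulas still apply. -/
lemma mul_prod_eq_prod_update (g : Fin k → ℝ × ℝ → ℝ) (i : Fin k) (f : ℝ × ℝ → ℝ)
    (p : Fin k → ℝ × ℝ) :
    f (p i) * ∏ j, g j (p j) =
      ∏ j, Function.update g i (fun q => f q * g i q) j (p j) := by
  rw [← Finset.mul_prod_erase _ _ (Finset.mem_univ i),
    ← Finset.mul_prod_erase _ (fun j => Function.update g i (fun q => f q * g i q) j (p j))
      (Finset.mem_univ i), Function.update_self, ← mul_assoc]
  congr 1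
  refine Finset.prod_congr rfl fun j hj => ?_
  rw [Function.update_of_ne (Finset.ne_of_mem_erase hj)]

lemma integrableOn_paramSpace_mul_prod {g : Fin k → ℝ × ℝ → ℝ}
    (hg : ∀ i, Integrable (g i) pairMeasure) {i : Fin k} {f : ℝ × ℝ → ℝ}
    (hf : Integrable (fun p => f p * g i p) pairMeasure) :
    IntegrableOn (fun θ : (Fin k → ℝ) × (Fin k → ℝ) =>
      f (θ.1 i, θ.2 i) * ∏ j, g j (θ.1 j, θ.2 j)) (paramSpace k) := by
  have h := integrableOn_paramSpace_prod (g := Function.update g i (fun q => f q * g i q))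
    fun j => by
      by_cases hj : j = i
      · subst hj; rwa [Function.update_self]
      · rw [Function.update_of_ne hj]; exact hg j
  refine h.congr_fun (fun θ _ => ?_) (measurableSet_paramSpace k)
  exact (mul_prod_eq_prod_update g i f fun j => (θ.1 j, θ.2 j)).symm

lemma integral_paramSpace_mul_prod (g : Fin k → ℝ × ℝ → ℝ) (i : Fin k) (f : ℝ × ℝ → ℝ) :
    ∫ θ in paramSpace k, f (θ.1 i, θ.2 i) * ∏ j, g j (θ.1 j, θ.2 j) =
      (∫ p, f p * g i p ∂pairMeasure) * ∏ j ∈ Finset.univ.erase i, ∫ p, g j p ∂pairMeasure := by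
  have h := integral_paramSpace_prod (Function.update g i (fun q => f q * g i q))
  rw [← Finset.mul_prod_erase _ _ (Finset.mem_univ i), Function.update_self] at h
  rw [setIntegral_congr_fun (measurableSet_paramSpace k)
    (fun θ _ => mul_prod_eq_prod_update g i f fun j => (θ.1 j, θ.2 j)), h]
  congr 1
  refine Finset.prod_congr rfl fun j hj => ?_
  rw [Function.update_of_ne (Finset.ne_of_mem_erase hj)]

end ParamSpace

/-! ### Conjugate updating and its limits -/

section Conjugacy

/-- The posterior location after `n` observations `y`. -/
noncomputable def postLoc (loc lam : ℝ) (y : ℕ → ℝ) (n : ℕ) : ℝ :=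
  (lam * loc + ∑ l ∈ Finset.range n, y l) / (lam + n)

/-- The posterior scale after `n` observations `y`. -/
noncomputable def postScale (loc lam b : ℝ) (y : ℕ → ℝ) (n : ℕ) : ℝ :=
  b + (∑ l ∈ Finset.range n, (y l - postLoc loc lam y n) ^ 2 +
    lam * (loc - postLoc loc lam y n) ^ 2) / 2

/-- The normal-inverse-gamma kernel after `n` observations `y`. -/
noncomputable def postKernel (loc lam a b : ℝ) (y : ℕ → ℝ) (n : ℕ) (p : ℝ × ℝ) : ℝ :=
  nigKernel (postLoc loc lam y n) (lam + n) (a + n / 2) (postScale loc lam b y n) p.1 p.2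

variable {loc lam a b : ℝ} {y : ℕ → ℝ} {n : ℕ}

lemma prod_gaussianPDFReal (φ : ℝ) {ψ : ℝ} (hψ : 0 < ψ) (y : ℕ → ℝ) (n : ℕ) :
    ∏ l ∈ Finset.range n, gaussianPDFReal φ ψ.toNNReal (y l) =
      (√(2 * Real.pi))⁻¹ ^ n * ψ ^ (-(n / 2 : ℝ)) *
        Real.exp (-(∑ l ∈ Finset.range n, (y l - φ) ^ 2) / (2 * ψ)) := by
  unfold gaussianPDFReal
  rw [Real.coe_toNNReal _ hψ.le, Finset.prod_mul_distrib, Finset.prod_const, Finset.card_range,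
    ← Real.exp_sum, ← Finset.sum_div, Finset.sum_neg_distrib, Real.sqrt_mul (by positivity),
    mul_inv, mul_pow]
  congr 2
  rw [inv_pow, Real.rpow_neg hψ.le, Real.sqrt_eq_rpow, ← Real.rpow_natCast, ← Real.rpow_mul hψ.le]
  congr 2
  ring

/-- Completing the square in φ. -/
lemma sum_sq_sub (hn : lam + n ≠ 0) (φ : ℝ) :
    ∑ l ∈ Finset.range n, (y l - φ) ^ 2 + lam * (φ - loc) ^ 2 =
      (lam + n) * (φ - postLoc loc lam y n) ^ 2 +
        (∑ l ∈ Finset.range n, (y l - postLoc loc lam y n) ^ 2 +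
          lam * (loc - postLoc loc lam y n) ^ 2) := by
  have h : ∀ c : ℝ, ∑ l ∈ Finset.range n, (y l - c) ^ 2 = ∑ l ∈ Finset.range n, y l ^ 2 -
      2 * c * ∑ l ∈ Finset.range n, y l + n * c ^ 2 := by
    intro c
    rw [Finset.mul_sum, ← Finset.sum_sub_distrib]
    have : (n : ℝ) * c ^ 2 = ∑ l ∈ Finset.range n, c ^ 2 := by simp
    rw [this, ← Finset.sum_add_distrib]
    exact Finset.sum_congr rfl fun l _ => by ring
  rw [h, h]
  have h2 : (lam + n) * postLoc loc lam y n = lam * loc + ∑ l ∈ Finset.range n, y l := by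
    rw [postLoc]; field_simp
  set c := postLoc loc lam y n
  have h3 : ∑ l ∈ Finset.range n, y l = (lam + n) * c - lam * loc := by linarith
  rw [h3]
  ring

/-- Conjugacy of the normal-inverse-gamma family for the normal likelihood. -/
lemma prod_gaussianPDFReal_mul_nigKernel (hn : lam + n ≠ 0) (φ : ℝ) {ψ : ℝ} (hψ : 0 < ψ) :
    (∏ l ∈ Finset.range n, gaussianPDFReal φ ψ.toNNReal (y l)) * nigKernel loc lam a b φ ψ =
      (√(2 * Real.pi))⁻¹ ^ n * postKernel loc lam a b y n (φ, ψ) := by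
  rw [prod_gaussianPDFReal φ hψ, postKernel, nigKernel, nigKernel]
  have h1 : ψ ^ (-(a + n / 2 + 1)) = ψ ^ (-(n / 2 : ℝ)) * ψ ^ (-(a + 1)) := by
    rw [← Real.rpow_add hψ]; congr 1; ring
  have h2 : Real.exp (-(∑ l ∈ Finset.range n, (y l - φ) ^ 2) / (2 * ψ)) *
      Real.exp (-(lam * (φ - loc) ^ 2) / (2 * ψ)) * Real.exp (-b / ψ) =
      Real.exp (-((lam + n) * (φ - postLoc loc lam y n) ^ 2) / (2 * ψ)) *
        Real.exp (-postScale loc lam b y n / ψ) := by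
    rw [← Real.exp_add, ← Real.exp_add, ← Real.exp_add, postScale]
    congr 1
    have := sum_sq_sub (loc := loc) (y := y) hn φ
    field_simp
    linarith
  rw [h1]
  simp only
  calc _ = (√(2 * Real.pi))⁻¹ ^ n * ψ ^ (-(n / 2 : ℝ)) * ψ ^ (-(1 / 2 : ℝ)) * ψ ^ (-(a + 1)) *
      (Real.exp (-(∑ l ∈ Finset.range n, (y l - φ) ^ 2) / (2 * ψ)) *
      Real.exp (-(lam * (φ - loc) ^ 2) / (2 * ψ)) * Real.exp (-b / ψ)) := by ring
    _ = _ := by rw [h2]; ring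

/-- Without a positive prior scale, two different observations cannot both coincide with the
posterior location, so the sum of squares is positive. -/
lemma postScale_pos (hlam : 0 ≤ lam) (hb : 0 ≤ b) (h : 0 < b ∨ 2 ≤ n) (hy : y 0 ≠ y 1) :
    0 < postScale loc lam b y n := by
  unfold postScale
  have h1 : ∀ c, 0 ≤ ∑ l ∈ Finset.range n, (y l - c) ^ 2 := fun c =>
    Finset.sum_nonneg fun l _ => sq_nonneg _
  set c := postLoc loc lam y n
  have h2 := h1 c
  rcases h with h | h
  · positivity
  · have h3 : 0 < ∑ l ∈ Finset.range n, (y l - c) ^ 2 := by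
      by_cases hc : y 0 = c
      · refine Finset.sum_pos' (fun l _ => sq_nonneg _) ⟨1, Finset.mem_range.2 (by omega), ?_⟩
        have : y 1 - c ≠ 0 := fun h => hy (by linarith)
        positivity
      · refine Finset.sum_pos' (fun l _ => sq_nonneg _) ⟨0, Finset.mem_range.2 (by omega), ?_⟩
        have : y 0 - c ≠ 0 := sub_ne_zero.2 hc
        positivity
    positivity

/-- The sample moments converge to those of a distribution with mean `m` and variance `v`, and the
first two observations differ. -/
structure RegularSample (m v : ℝ) (y : ℕ → ℝ) : Prop where
  mean : Tendsto (sampleMean y) atTop (𝓝 m)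
  sq : Tendsto (sampleMean fun l => y l ^ 2) atTop (𝓝 (v + m ^ 2))
  ne : y 0 ≠ y 1

lemma tendsto_lam_add_div (lam : ℝ) : Tendsto (fun n : ℕ => (lam + n) / n) atTop (𝓝 1) := by
  have h : Tendsto (fun n : ℕ => lam / n + 1) atTop (𝓝 (0 + 1)) :=
    (tendsto_const_div_atTop_nhds_zero_nat lam).add_const 1
  rw [zero_add] at h
  refine h.congr' ?_
  filter_upwards [eventually_gt_atTop 0] with n hn
  have : (0 : ℝ) < n := by exact_mod_cast hn
  field_simp

lemma RegularSample.tendsto_postLoc {m v : ℝ} (h : RegularSample m v y) (loc lam : ℝ) :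
    Tendsto (postLoc loc lam y) atTop (𝓝 m) := by
  have h1 : Tendsto (fun n : ℕ => (lam * loc / n + sampleMean y n) / ((lam + n) / n)) atTop
      (𝓝 ((0 + m) / 1)) :=
    ((tendsto_const_div_atTop_nhds_zero_nat _).add h.mean).div (tendsto_lam_add_div lam) one_ne_zero
  rw [zero_add, div_one] at h1
  refine h1.congr' ?_
  filter_upwards [eventually_gt_atTop 0] with n hn
  have hn : (0 : ℝ) < n := by exact_mod_cast hn
  rw [postLoc, sampleMean, ← add_div, div_div_div_cancel_right₀ hn.ne']

lemma RegularSample.tendsto_postScale {m v : ℝ} (h : RegularSample m v y) (loc lam b : ℝ) :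
    Tendsto (fun n : ℕ => postScale loc lam b y n / n) atTop (𝓝 (v / 2)) := by
  have hL := h.tendsto_postLoc loc lam
  have h1 : Tendsto (fun n : ℕ => b / n + ((sampleMean (fun l => y l ^ 2) n -
      2 * postLoc loc lam y n * sampleMean y n + postLoc loc lam y n ^ 2) +
      lam * (loc - postLoc loc lam y n) ^ 2 * (1 / n)) / 2) atTop
      (𝓝 (0 + ((v + m ^ 2 - 2 * m * m + m ^ 2) + lam * (loc - m) ^ 2 * 0) / 2)) := by
    refine (tendsto_const_div_atTop_nhds_zero_nat _).add (Tendsto.div_const ?_ _)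
    refine Tendsto.add ((h.sq.sub ((hL.const_mul 2).mul h.mean)).add (hL.pow 2)) ?_
    exact (((hL.const_sub loc).pow 2).const_mul lam).mul tendsto_one_div_atTop_nhds_zero_nat
  have e : (0 + ((v + m ^ 2 - 2 * m * m + m ^ 2) + lam * (loc - m) ^ 2 * 0) / 2) = v / 2 := by ring
  rw [e] at h1
  refine h1.congr' ?_
  filter_upwards [eventually_gt_atTop 0] with n hn
  have hn : (0 : ℝ) < n := by exact_mod_cast hn
  have h3 : ∑ l ∈ Finset.range n, (y l - postLoc loc lam y n) ^ 2 = ∑ l ∈ Finset.range n, y l ^ 2 -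
      2 * postLoc loc lam y n * ∑ l ∈ Finset.range n, y l + n * postLoc loc lam y n ^ 2 := by
    rw [Finset.mul_sum, ← Finset.sum_sub_distrib]
    have : (n : ℝ) * postLoc loc lam y n ^ 2 = ∑ l ∈ Finset.range n, postLoc loc lam y n ^ 2 := by
      simp
    rw [this, ← Finset.sum_add_distrib]
    exact Finset.sum_congr rfl fun l _ => by ring
  rw [postScale, h3, sampleMean, sampleMean]
  field_simp

lemma RegularSample.tendsto_postVar {m v : ℝ} (h : RegularSample m v y) (loc lam a b : ℝ) :
    Tendsto (fun n : ℕ => postScale loc lam b y n / (a + n / 2 - 1)) atTop (𝓝 v) := by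
  have h1 : Tendsto (fun n : ℕ => (a - 1) / n + 1 / 2) atTop (𝓝 (0 + 1 / 2)) :=
    (tendsto_const_div_atTop_nhds_zero_nat _).add_const _
  have h2 := (h.tendsto_postScale loc lam b).div h1 (by norm_num)
  have e : v / 2 / (0 + 1 / 2) = v := by ring
  rw [e] at h2
  refine h2.congr' ?_
  filter_upwards [eventually_gt_atTop 0] with n hn
  have hn : (0 : ℝ) < n := by exact_mod_cast hn
  simp only [Pi.div_apply]
  have : a + n / 2 - 1 = ((a - 1) / n + 1 / 2) * n := by field_simp; ring
  rw [this, div_div, mul_comm (n : ℝ)]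

end Conjugacy

section Posterior

variable {k : ℕ} {prior : (Fin k → ℝ) × (Fin k → ℝ) → ℝ} {x : Fin k → ℕ → ℝ} {N : Fin k → ℕ}

lemma postMean_eq (i : Fin k) : postMean prior x N i =
    (∫ θ in paramSpace k, θ.1 i * (prior θ * likelihood x N θ)) /
      ∫ θ in paramSpace k, prior θ * likelihood x N θ := by
  rw [postMean, ← integral_div]
  congr 1
  ext θ
  rw [posterior, ← mul_div_assoc]

lemma postVar_eq (i : Fin k) : postVar prior x N i =
    (∫ θ in paramSpace k, θ.2 i * (prior θ * likelihood x N θ)) /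
      ∫ θ in paramSpace k, prior θ * likelihood x N θ := by
  rw [postVar, ← integral_div]
  congr 1
  ext θ
  rw [posterior, ← mul_div_assoc]

/-- The product of the normalising constants of the likelihoods. -/
noncomputable def likConst (N : Fin k → ℕ) : ℝ := ∏ i, (√(2 * Real.pi))⁻¹ ^ N i

lemma likConst_pos (N : Fin k → ℕ) : 0 < likConst N :=
  Finset.prod_pos fun i _ => by positivity

lemma likelihood_mul_prod_nigKernel {loc lam a b : Fin k → ℝ} (h : ∀ i, lam i + N i ≠ 0)
    {θ : (Fin k → ℝ) × (Fin k → ℝ)} (hθ : θ ∈ paramSpace k) :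
    likelihood x N θ * ∏ i, nigKernel (loc i) (lam i) (a i) (b i) (θ.1 i) (θ.2 i) =
      likConst N * ∏ i, postKernel (loc i) (lam i) (a i) (b i) (x i) (N i) (θ.1 i, θ.2 i) := by
  rw [likelihood, likConst, ← Finset.prod_mul_distrib, ← Finset.prod_mul_distrib]
  exact Finset.prod_congr rfl fun i _ => prod_gaussianPDFReal_mul_nigKernel (h i) _ (hθ i)

end Posterior

lemma exists_pos_lower_bound {f : ℕ → ℝ} {c : ℝ} {n₀ : ℕ} (hc : 0 < c)
    (hf : Tendsto f atTop (𝓝 c)) (hpos : ∀ n, n₀ ≤ n → 0 < f n) :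
    ∃ lo > 0, ∀ n, n₀ ≤ n → lo ≤ f n := by
  obtain ⟨T, hT⟩ := eventually_atTop.1 (hf.eventually (lt_mem_nhds (half_lt_self hc)))
  have hfin : ∀ T' : ℕ, ∃ lo > 0, ∀ n, n₀ ≤ n → n < T' → lo ≤ f n := by
    intro T'
    induction T' with
    | zero => exact ⟨1, one_pos, fun n _ h => by omega⟩
    | succ T' ih =>
      obtain ⟨lo, h1, h2⟩ := ih
      by_cases h : n₀ ≤ T'
      · refine ⟨min lo (f T'), lt_min h1 (hpos T' h), fun n hn hn' => ?_⟩
        rcases Nat.lt_succ_iff_lt_or_eq.1 hn' with h3 | h3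
        · exact (min_le_left _ _).trans (h2 n hn h3)
        · rw [h3]; exact min_le_right _ _
      · exact ⟨lo, h1, fun n hn hn' => h2 n hn (by omega)⟩
  obtain ⟨lo, h1, h2⟩ := hfin T
  refine ⟨min lo (c / 2), lt_min h1 (by positivity), fun n hn => ?_⟩
  rcases Nat.lt_or_ge n T with h | h
  · exact (min_le_left _ _).trans (h2 n hn h)
  · exact (min_le_right _ _).trans (hT n h).le

lemma exists_bound_of_tendsto {f : ℕ → ℝ} {c : ℝ} (hf : Tendsto f atTop (𝓝 c)) :
    ∃ K, 0 ≤ K ∧ ∀ n, |f n| ≤ K := by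
  obtain ⟨K, hK⟩ := (Metric.isBounded_range_of_tendsto _ hf).exists_norm_le
  exact ⟨K, (norm_nonneg _).trans (hK _ ⟨0, rfl⟩), fun n => hK _ ⟨n, rfl⟩⟩

/-! ### Consistency under a conjugate prior -/

section Conjugate

variable {k : ℕ} {m v : Fin k → ℝ} {prior : (Fin k → ℝ) × (Fin k → ℝ) → ℝ} {x : Fin k → ℕ → ℝ}
  {n₀ : ℕ}

/-- Under a conjugate prior the posterior estimates are explicit. -/
lemma conjugate_estimates {C : ℝ} {loc lam a b : Fin k → ℝ} {N : Fin k → ℕ} (hC : 0 < C)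
    (hprior : ∀ θ ∈ paramSpace k,
      prior θ = C * ∏ i, nigKernel (loc i) (lam i) (a i) (b i) (θ.1 i) (θ.2 i))
    (hlam : ∀ i, 0 < lam i + N i) (ha : ∀ i, 1 < a i + N i / 2)
    (hb : ∀ i, 0 < postScale (loc i) (lam i) (b i) (x i) (N i)) (i : Fin k) :
    postMean prior x N i = postLoc (loc i) (lam i) (x i) (N i) ∧
      postVar prior x N i =
        postScale (loc i) (lam i) (b i) (x i) (N i) / (a i + N i / 2 - 1) := by
  set g : Fin k → ℝ × ℝ → ℝ := fun j => postKernel (loc j) (lam j) (a j) (b j) (x j) (N j) with hg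
  have hT : ∀ θ ∈ paramSpace k, prior θ * likelihood x N θ =
      (C * likConst N) * ∏ j, g j (θ.1 j, θ.2 j) := by
    intro θ hθ
    rw [hprior θ hθ, mul_assoc, mul_comm (∏ i, _), likelihood_mul_prod_nigKernel
      (fun i => (hlam i).ne') hθ, mul_assoc]
  have hK : 0 < C * likConst N := mul_pos hC (likConst_pos N)
  have hZ : ∀ j, 0 < ∫ p, g j p ∂pairMeasure := fun j =>
    integral_nigKernel_pos (hlam j) (zero_lt_one.trans (ha j)) (hb j)
  have hden : ∫ θ in paramSpace k, prior θ * likelihood x N θ =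
      (C * likConst N) * ((∫ p, g i p ∂pairMeasure) *
        ∏ j ∈ Finset.univ.erase i, ∫ p, g j p ∂pairMeasure) := by
    rw [setIntegral_congr_fun (measurableSet_paramSpace k) hT, integral_const_mul,
      integral_paramSpace_prod, Finset.mul_prod_erase Finset.univ (fun j => ∫ p, g j p ∂pairMeasure) (Finset.mem_univ i)]
  have hnum : ∀ f : ℝ × ℝ → ℝ, ∫ θ in paramSpace k, f (θ.1 i, θ.2 i) *
      (prior θ * likelihood x N θ) = (C * likConst N) * ((∫ p, f p * g i p ∂pairMeasure) *
        ∏ j ∈ Finset.univ.erase i, ∫ p, g j p ∂pairMeasure) := by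
    intro f
    rw [← integral_paramSpace_mul_prod, ← integral_const_mul]
    refine setIntegral_congr_fun (measurableSet_paramSpace k) fun θ hθ => ?_
    simp only [hT θ hθ]
    ring
  have hP : 0 < ∏ j ∈ Finset.univ.erase i, ∫ p, g j p ∂pairMeasure :=
    Finset.prod_pos fun j _ => hZ j
  have hZi := hZ i
  have hL := (likConst_pos N).ne'
  constructor
  · have h1 := integral_fst_sub_mul_nigKernel (loc := postLoc (loc i) (lam i) (x i) (N i))
      (hlam i) (ha i) (hb i)
    have h2 : ∫ p, p.1 * g i p ∂pairMeasure =
        postLoc (loc i) (lam i) (x i) (N i) * ∫ p, g i p ∂pairMeasure := by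
      have e : (fun p : ℝ × ℝ => p.1 * g i p) = fun p =>
          (p.1 - postLoc (loc i) (lam i) (x i) (N i)) * nigKernel (postLoc (loc i) (lam i) (x i) (N i))
            (lam i + N i) (a i + N i / 2) (postScale (loc i) (lam i) (b i) (x i) (N i)) p.1 p.2 +
          postLoc (loc i) (lam i) (x i) (N i) * nigKernel (postLoc (loc i) (lam i) (x i) (N i))
            (lam i + N i) (a i + N i / 2) (postScale (loc i) (lam i) (b i) (x i) (N i)) p.1 p.2 := by
        ext p; simp only [hg, postKernel]; ring
      rw [e, integral_add (integrable_fst_sub_mul_nigKernel (hlam i) (ha i) (hb i))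
        ((integrable_nigKernel (hlam i) (zero_lt_one.trans (ha i)) (hb i)).const_mul _), h1, zero_add,
        integral_const_mul]
      rfl
    rw [postMean_eq, hnum fun p => p.1, hden, h2]
    field_simp
  · have h2 : ∫ p, p.2 * g i p ∂pairMeasure = postScale (loc i) (lam i) (b i) (x i) (N i) /
        (a i + N i / 2 - 1) * ∫ p, g i p ∂pairMeasure :=
      integral_snd_mul_nigKernel (hlam i) (ha i) (hb i)
    rw [postVar_eq, hnum fun p => p.2, hden, h2, mul_div_mul_left _ _ hK.ne', mul_assoc,
      mul_div_assoc, div_self (mul_pos hZi hP).ne', mul_one]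

/-- The posterior location differs from the sample mean by lam (loc - mean) / (lam + n), which is of
order 1 / n. The variance estimate of a design depends on its own sample only and converges; being
positive from `n₀` on, it is bounded away from zero. -/
theorem IsConjugatePrior.consistentEstimates (h : IsConjugatePrior n₀ prior) (hn₀ : 1 ≤ n₀)
    (hv : ∀ i, 0 < v i) (hx : ∀ i, RegularSample (m i) (v i) (x i)) :
    ConsistentEstimates v prior n₀ x := by
  obtain ⟨C, loc, lam, a, b, hC, hpar, hprior⟩ := h
  have hlam : ∀ i, ∀ n : ℕ, n₀ ≤ n → 0 < lam i + n := fun i n hn => by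
    have h1 : (1 : ℝ) ≤ n := by exact_mod_cast hn₀.trans hn
    linarith [(hpar i).1]
  have ha : ∀ i, ∀ n : ℕ, n₀ ≤ n → 1 < a i + n / 2 := fun i n hn => by
    have h1 : (n₀ : ℝ) ≤ n := by exact_mod_cast hn
    linarith [(hpar i).2.2.1]
  have hb : ∀ i, ∀ n : ℕ, n₀ ≤ n → 0 < postScale (loc i) (lam i) (b i) (x i) n := fun i n hn =>
    postScale_pos (hpar i).1 (hpar i).2.1 ((hpar i).2.2.2.imp id fun h => h.trans hn) (hx i).ne
  have hform : ∀ N : Fin k → ℕ, (∀ i, n₀ ≤ N i) → ∀ i,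
      postMean prior x N i = postLoc (loc i) (lam i) (x i) (N i) ∧
      postVar prior x N i =
        postScale (loc i) (lam i) (b i) (x i) (N i) / (a i + N i / 2 - 1) := fun N hN i =>
    conjugate_estimates hC hprior (fun i => hlam i _ (hN i)) (fun i => ha i _ (hN i))
      (fun i => hb i _ (hN i)) i
  refine ⟨?_, ?_, ?_⟩
  · have h1 : ∀ i, ∃ c, 0 ≤ c ∧ ∀ n, |sampleMean (x i) n| ≤ c := fun i =>
      exists_bound_of_tendsto (hx i).mean
    choose c hc0 hc using h1
    refine ⟨∑ i, lam i * (|loc i| + c i), fun N hN i => ?_⟩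
    rw [(hform N hN i).1]
    have hn1 : (1 : ℝ) ≤ N i := by exact_mod_cast hn₀.trans (hN i)
    have hl := (hpar i).1
    have e : postLoc (loc i) (lam i) (x i) (N i) - sampleMean (x i) (N i) =
        lam i * (loc i - sampleMean (x i) (N i)) / (lam i + N i) := by
      rw [postLoc, sampleMean]
      have := hlam i _ (hN i)
      field_simp
      ring
    have h2 : |loc i - sampleMean (x i) (N i)| ≤ |loc i| + c i :=
      (abs_sub _ _).trans (by gcongr; exact hc i _)
    have h3 : lam i * (|loc i| + c i) ≤ ∑ i, lam i * (|loc i| + c i) :=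
      Finset.single_le_sum (f := fun i => lam i * (|loc i| + c i))
        (fun j _ => mul_nonneg (hpar j).1 (add_nonneg (abs_nonneg _) (hc0 j))) (Finset.mem_univ i)
    have h4 : √(N i : ℝ) ≤ lam i + N i := by
      have : √(N i : ℝ) ≤ N i := by
        rw [Real.sqrt_le_left (by linarith)]
        nlinarith
      linarith
    have h5 : 0 < √(N i : ℝ) := Real.sqrt_pos.2 (by linarith)
    rw [e, abs_div, abs_mul, abs_of_nonneg hl, abs_of_pos (hlam i _ (hN i))]
    have h6 : lam i * |loc i - sampleMean (x i) (N i)| ≤ ∑ i, lam i * (|loc i| + c i) :=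
      (mul_le_mul_of_nonneg_left h2 hl).trans h3
    exact div_le_div₀ ((mul_nonneg hl (abs_nonneg _)).trans h6) h6 h5 h4
  · have h1 : ∀ i, ∃ lo > 0, ∀ n, n₀ ≤ n →
        lo ≤ postScale (loc i) (lam i) (b i) (x i) n / (a i + n / 2 - 1) := fun i =>
      exists_pos_lower_bound (hv i) ((hx i).tendsto_postVar _ _ _ _) fun n hn =>
        div_pos (hb i n hn) (by linarith [ha i n hn])
    choose lo hlo hlo' using h1
    rcases isEmpty_or_nonempty (Fin k) with hE | hE
    · exact ⟨1, one_pos, fun N hN i => (hE.false i).elim⟩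
    · obtain ⟨i₀, hi₀⟩ := exists_eq_ciInf_of_finite (f := lo)
      refine ⟨⨅ i, lo i, by rw [← hi₀]; exact hlo i₀, fun N hN i => ?_⟩
      rw [(hform N hN i).2]
      exact (ciInf_le (Set.finite_range lo).bddBelow i).trans (hlo' i _ (hN i))
  · refine ⟨fun i n => |postScale (loc i) (lam i) (b i) (x i) n / (a i + n / 2 - 1) - v i|,
      fun i => ?_, fun N hN i => by rw [(hform N hN i).2]⟩
    have := (((hx i).tendsto_postVar (loc i) (lam i) (a i) (b i)).sub_const (v i)).abs
    simpa using this

end Conjugate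

/-! ### The posterior under a flat prior -/

section FlatPrior

variable {m v : ℝ} {y : ℕ → ℝ} {n : ℕ}

/-- The likelihood of a single sample, that is, the posterior kernel under a flat prior. -/
noncomputable def flatKernel (y : ℕ → ℝ) (n : ℕ) : ℝ × ℝ → ℝ := postKernel 0 0 (-3 / 2) 0 y n

lemma likelihood_eq_prod_flatKernel {k : ℕ} {x : Fin k → ℕ → ℝ} {N : Fin k → ℕ}
    (hN : ∀ i, N i ≠ 0) {θ : (Fin k → ℝ) × (Fin k → ℝ)} (hθ : θ ∈ paramSpace k) :
    likelihood x N θ = likConst N * ∏ i, flatKernel (x i) (N i) (θ.1 i, θ.2 i) := by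
  have h := likelihood_mul_prod_nigKernel (x := x) (N := N) (loc := fun _ => 0) (lam := fun _ => 0)
    (a := fun _ => -3 / 2) (b := fun _ => 0) (fun i => by simpa using hN i) hθ
  -- The exponents are -1/2 and 1/2, so shape -3/2 with zero precision and scale is the constant
  -- density.
  have h1 : ∀ i, nigKernel 0 0 (-3 / 2) 0 (θ.1 i) (θ.2 i) = 1 := fun i => by
    rw [nigKernel]
    simp only [zero_mul, neg_zero, zero_div, Real.exp_zero, mul_one]
    rw [← Real.rpow_add (hθ i)]
    norm_num
  simpa [h1, flatKernel] using h

lemma flatKernel_pos (p : ℝ × ℝ) (hp : 0 < p.2) : 0 < flatKernel y n p := nigKernel_pos hp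

lemma flatKernel_nonneg_ae : ∀ᵐ p ∂pairMeasure, 0 ≤ flatKernel y n p := by
  filter_upwards [ae_pairMeasure] with p hp using (flatKernel_pos p hp).le

/-- Six is the least sample size for which the shape n / 2 - 3 / 2 exceeds 1, so that the posterior
mean of the variance is finite. -/
lemma flat_params (hn : 6 ≤ n) : (0 : ℝ) < 0 + n ∧ (1 : ℝ) < -3 / 2 + n / 2 := by
  have : (6 : ℝ) ≤ n := by exact_mod_cast hn
  constructor <;> linarith

lemma flat_postScale_pos (hy : y 0 ≠ y 1) (hn : 6 ≤ n) : 0 < postScale 0 0 0 y n :=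
  postScale_pos le_rfl le_rfl (Or.inr (by omega)) hy

lemma postLoc_flat : postLoc 0 0 y n = sampleMean y n := by simp [postLoc, sampleMean]

lemma integrable_flatKernel (hy : y 0 ≠ y 1) (hn : 6 ≤ n) :
    Integrable (flatKernel y n) pairMeasure :=
  integrable_nigKernel (flat_params hn).1 (zero_lt_one.trans (flat_params hn).2)
    (flat_postScale_pos hy hn)

lemma integral_flatKernel_pos (hy : y 0 ≠ y 1) (hn : 6 ≤ n) :
    0 < ∫ p, flatKernel y n p ∂pairMeasure :=
  integral_nigKernel_pos (flat_params hn).1 (zero_lt_one.trans (flat_params hn).2)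
    (flat_postScale_pos hy hn)

lemma integrable_fst_sub_mul_flatKernel (hy : y 0 ≠ y 1) (hn : 6 ≤ n) (c : ℝ) :
    Integrable (fun p => (p.1 - c) * flatKernel y n p) pairMeasure := by
  have h := integrable_fst_sub_mul_nigKernel (loc := postLoc 0 0 y n) (flat_params hn).1
    (flat_params hn).2 (flat_postScale_pos hy hn)
  refine (h.add ((integrable_flatKernel hy hn).const_mul (postLoc 0 0 y n - c))).congr
    (ae_of_all _ fun p => ?_)
  simp only [Pi.add_apply, flatKernel, postKernel]
  ring

lemma integrable_snd_sub_mul_flatKernel (hy : y 0 ≠ y 1) (hn : 6 ≤ n) (c : ℝ) :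
    Integrable (fun p => (p.2 - c) * flatKernel y n p) pairMeasure := by
  have h := integrable_snd_mul_nigKernel (loc := postLoc 0 0 y n) (flat_params hn).1
    (flat_params hn).2 (flat_postScale_pos hy hn)
  refine (h.sub ((integrable_flatKernel hy hn).const_mul c)).congr (ae_of_all _ fun p => ?_)
  simp only [Pi.sub_apply, flatKernel, postKernel]
  ring

/-- The expectation of `g` under the normalised flat posterior. -/
noncomputable def flatMean (y : ℕ → ℝ) (n : ℕ) (g : ℝ × ℝ → ℝ) : ℝ :=
  (∫ p, g p * flatKernel y n p ∂pairMeasure) / ∫ p, flatKernel y n p ∂pairMeasure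

lemma abs_mul_flatKernel_ae (g : ℝ × ℝ → ℝ) :
    (fun p => |g p * flatKernel y n p|) =ᵐ[pairMeasure] fun p => |g p| * flatKernel y n p := by
  filter_upwards [ae_pairMeasure] with p hp
  rw [abs_mul, abs_of_pos (flatKernel_pos p hp)]

lemma integrable_abs_mul_flatKernel {g : ℝ × ℝ → ℝ}
    (hg : Integrable (fun p => g p * flatKernel y n p) pairMeasure) :
    Integrable (fun p => |g p| * flatKernel y n p) pairMeasure :=
  hg.abs.congr (abs_mul_flatKernel_ae g)

lemma flatMean_nonneg (hy : y 0 ≠ y 1) (hn : 6 ≤ n) {g : ℝ × ℝ → ℝ} (hg : ∀ p, 0 ≤ g p) :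
    0 ≤ flatMean y n g := by
  refine div_nonneg (integral_nonneg_of_ae ?_) (integral_flatKernel_pos hy hn).le
  filter_upwards [flatKernel_nonneg_ae] with p hp using mul_nonneg (hg p) hp

/-- Cauchy-Schwarz in additive form: |g| ≤ (ε + g² / ε) / 2, with ε left free. -/
lemma flatMean_abs_le (hy : y 0 ≠ y 1) (hn : 6 ≤ n) {g : ℝ × ℝ → ℝ}
    (hg : Integrable (fun p => g p * flatKernel y n p) pairMeasure)
    (hg2 : Integrable (fun p => g p ^ 2 * flatKernel y n p) pairMeasure) {ε : ℝ} (hε : 0 < ε) :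
    flatMean y n (fun p => |g p|) ≤ (ε + flatMean y n (fun p => g p ^ 2) / ε) / 2 := by
  have hZ := integral_flatKernel_pos hy hn
  have h : ∫ p, |g p| * flatKernel y n p ∂pairMeasure ≤
      ∫ p, (ε / 2 * flatKernel y n p + 1 / (2 * ε) * (g p ^ 2 * flatKernel y n p))
        ∂pairMeasure := by
    refine integral_mono_ae (integrable_abs_mul_flatKernel hg)
      (((integrable_flatKernel hy hn).const_mul _).add (hg2.const_mul _)) ?_
    filter_upwards [ae_pairMeasure] with p hp
    have h1 : |g p| ≤ ε / 2 + 1 / (2 * ε) * g p ^ 2 := by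
      have h2 : 0 ≤ (|g p| - ε) ^ 2 / (2 * ε) := by positivity
      have h3 : (|g p| - ε) ^ 2 / (2 * ε) = ε / 2 + 1 / (2 * ε) * g p ^ 2 - |g p| := by
        rw [← sq_abs (g p)]; field_simp; ring
      linarith
    have := mul_le_mul_of_nonneg_right h1 (flatKernel_pos (y := y) (n := n) p hp).le
    linarith
  rw [integral_add ((integrable_flatKernel hy hn).const_mul _) (hg2.const_mul _),
    integral_const_mul, integral_const_mul] at h
  rw [flatMean, div_le_iff₀ hZ]
  refine h.trans (le_of_eq ?_)
  rw [flatMean]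
  field_simp

lemma flatMean_fst_sub_sq (hy : y 0 ≠ y 1) (hn : 6 ≤ n) :
    Integrable (fun p => (p.1 - sampleMean y n) ^ 2 * flatKernel y n p) pairMeasure ∧
    flatMean y n (fun p => (p.1 - sampleMean y n) ^ 2) =
      postScale 0 0 0 y n / (-3 / 2 + n / 2 - 1) / n := by
  have hZ := integral_flatKernel_pos hy hn
  have h1 := integrable_fst_sub_sq_mul_nigKernel (loc := postLoc 0 0 y n) (flat_params hn).1
    (flat_params hn).2 (flat_postScale_pos hy hn)
  have h2 := integral_fst_sub_sq_mul_nigKernel (loc := postLoc 0 0 y n) (flat_params hn).1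
    (flat_params hn).2 (flat_postScale_pos hy hn)
  rw [postLoc_flat] at h1 h2
  have e : flatKernel y n = fun p => nigKernel (sampleMean y n) (0 + n) (-3 / 2 + n / 2)
      (postScale 0 0 0 y n) p.1 p.2 := by
    funext p; rw [flatKernel, postKernel, postLoc_flat]
  refine ⟨by rw [e]; exact h1, ?_⟩
  rw [flatMean, div_eq_iff hZ.ne', e, h2, div_div, zero_add]

/-- The second moment of the variance needs a shape above 2, hence eight observations; this is
harmless, since it only enters a limit. The moment is written as a product of two quotients of the
form covered by `tendsto_postVar`. -/
lemma flatMean_snd_sub_sq (hy : y 0 ≠ y 1) (hn : 8 ≤ n) (c : ℝ) :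
    Integrable (fun p => (p.2 - c) ^ 2 * flatKernel y n p) pairMeasure ∧
    flatMean y n (fun p => (p.2 - c) ^ 2) =
      postScale 0 0 0 y n / (-3 / 2 + n / 2 - 1) * (postScale 0 0 0 y n / (-5 / 2 + n / 2 - 1)) -
        2 * c * (postScale 0 0 0 y n / (-3 / 2 + n / 2 - 1)) + c ^ 2 := by
  have hn6 : 6 ≤ n := by omega
  have ha : (2 : ℝ) < -3 / 2 + n / 2 := by
    have : (8 : ℝ) ≤ n := by exact_mod_cast hn
    linarith
  have hZ := integral_flatKernel_pos hy hn6
  have hb := flat_postScale_pos hy hn6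
  have hl := (flat_params hn6).1
  have i0 := integrable_flatKernel hy hn6
  have i1 : Integrable (fun p => p.2 * flatKernel y n p) pairMeasure :=
    integrable_snd_mul_nigKernel hl (flat_params hn6).2 hb
  have i2 : Integrable (fun p => p.2 ^ 2 * flatKernel y n p) pairMeasure :=
    integrable_snd_sq_mul_nigKernel hl ha hb
  have j1 : ∫ p, p.2 * flatKernel y n p ∂pairMeasure = _ * ∫ p, flatKernel y n p ∂pairMeasure :=
    integral_snd_mul_nigKernel hl (flat_params hn6).2 hb
  have j2 : ∫ p, p.2 ^ 2 * flatKernel y n p ∂pairMeasure =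
      _ * ∫ p, flatKernel y n p ∂pairMeasure := integral_snd_sq_mul_nigKernel hl ha hb
  have e : (fun p => (p.2 - c) ^ 2 * flatKernel y n p) = fun p =>
      p.2 ^ 2 * flatKernel y n p - 2 * c * (p.2 * flatKernel y n p) + c ^ 2 * flatKernel y n p := by
    funext p; ring
  refine ⟨by rw [e]; exact (i2.sub (i1.const_mul _)).add (i0.const_mul _), ?_⟩
  rw [flatMean, div_eq_iff hZ.ne', e, integral_add (by exact i2.sub (i1.const_mul _))
      (i0.const_mul _),
    integral_sub i2 (i1.const_mul _), integral_const_mul, integral_const_mul, j1, j2]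
  have e1 : (-5 / 2 + (n : ℝ) / 2 - 1) = -3 / 2 + n / 2 - 2 := by ring
  rw [e1, div_mul_div_comm]
  ring

lemma RegularSample.exists_flatMean_fst_le (h : RegularSample m v y) :
    ∃ C, 0 ≤ C ∧ ∀ n, 6 ≤ n → flatMean y n (fun p => |p.1 - sampleMean y n|) ≤ C / √n := by
  obtain ⟨K, hK0, hK⟩ := exists_bound_of_tendsto (h.tendsto_postVar 0 0 (-3 / 2) 0)
  refine ⟨(1 + K) / 2, by positivity, fun n hn => ?_⟩
  have hn' : (0 : ℝ) < n := by exact_mod_cast (show 0 < n by omega)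
  have hs : 0 < √(n : ℝ) := Real.sqrt_pos.2 hn'
  -- The choice ε = 1 / √n balances the two terms, as the second moment is of order 1 / n.
  have h1 := flatMean_abs_le h.ne hn (integrable_fst_sub_mul_flatKernel h.ne hn _)
    (flatMean_fst_sub_sq h.ne hn).1 (ε := 1 / √n) (by positivity)
  rw [(flatMean_fst_sub_sq h.ne hn).2] at h1
  refine h1.trans ?_
  have h2 : postScale 0 0 0 y n / (-3 / 2 + n / 2 - 1) / n / (1 / √n) ≤ K / √n := by
    have h3 : postScale 0 0 0 y n / (-3 / 2 + n / 2 - 1) / n / (1 / √n) =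
        postScale 0 0 0 y n / (-3 / 2 + n / 2 - 1) / √n := by
      rw [div_div_eq_mul_div, div_one, div_mul, Real.div_sqrt]
    rw [h3]
    gcongr
    exact (le_abs_self _).trans (hK n)
  rw [show (1 + K) / 2 / √n = (1 / √n + K / √n) / 2 by ring]
  linarith

lemma RegularSample.tendsto_flatMean_snd (h : RegularSample m v y) :
    Tendsto (fun n => flatMean y n (fun p => |p.2 - v|)) atTop (𝓝 0) := by
  have h1 := ((h.tendsto_postVar 0 0 (-3 / 2) 0).mul (h.tendsto_postVar 0 0 (-5 / 2) 0)).sub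
    ((h.tendsto_postVar 0 0 (-3 / 2) 0).const_mul (2 * v)) |>.add_const (v ^ 2)
  rw [show v * v - 2 * v * v + v ^ 2 = 0 by ring] at h1
  rw [Metric.tendsto_atTop]
  intro ε hε
  obtain ⟨T, hT⟩ := eventually_atTop.1 (h1.eventually (gt_mem_nhds (show 0 < ε ^ 2 / 4 by positivity)))
  refine ⟨max T 8, fun n hn => ?_⟩
  have hn8 : 8 ≤ n := (le_max_right _ _).trans hn
  have hn6 : 6 ≤ n := by omega
  have hsq := flatMean_snd_sub_sq h.ne hn8 v
  have h2 := flatMean_abs_le h.ne hn6 (integrable_snd_sub_mul_flatKernel h.ne hn6 _) hsq.1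
    (half_pos hε)
  have h3 := hT n ((le_max_left _ _).trans hn)
  rw [← hsq.2] at h3
  have h4 : flatMean y n (fun p => (p.2 - v) ^ 2) / (ε / 2) < ε / 2 := by
    rw [div_lt_iff₀ (by positivity)]
    linarith
  rw [Real.dist_eq, sub_zero, abs_of_nonneg (flatMean_nonneg h.ne hn6 fun p => abs_nonneg _)]
  linarith

/-- The flat posterior does not lose mass outside a neighbourhood of the true parameters. -/
lemma RegularSample.exists_mass_le (h : RegularSample m v y) {R : Set (ℝ × ℝ)}
    (hR : MeasurableSet R) {e : ℝ} (he : 0 < e) (hev : e < v)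
    (hsub : Icc (m - e) (m + e) ×ˢ Icc (v - e) (v + e) ⊆ R) :
    ∃ κ > 0, ∀ n, 6 ≤ n → κ * ∫ p, flatKernel y n p ∂pairMeasure ≤
      ∫ p, R.indicator (flatKernel y n) p ∂pairMeasure := by
  set r : ℕ → ℝ := fun n => (∫ p, R.indicator (flatKernel y n) p ∂pairMeasure) /
    ∫ p, flatKernel y n p ∂pairMeasure with hr
  obtain ⟨C, hC0, hC⟩ := h.exists_flatMean_fst_le
  have hpos : ∀ n, 6 ≤ n → 0 < r n := fun n hn => by
    refine div_pos ?_ (integral_flatKernel_pos h.ne hn)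
    rw [integral_indicator hR, setIntegral_pos_iff_support_of_nonneg_ae
      (ae_restrict_of_ae flatKernel_nonneg_ae) (integrable_flatKernel h.ne hn).integrableOn]
    rw [pairMeasure_eq, Measure.restrict_apply' measurableSet_snd_pos]
    have h1 : Icc (m - e) (m + e) ×ˢ Icc (v - e) (v + e) ⊆
        (Function.support (flatKernel y n) ∩ R) ∩ {p : ℝ × ℝ | 0 < p.2} := by
      intro p hp
      have hp2 : 0 < p.2 := by linarith [hp.2.1]
      exact ⟨⟨(flatKernel_pos p hp2).ne', hsub hp⟩, hp2⟩
    refine lt_of_lt_of_le ?_ (measure_mono h1)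
    rw [Measure.volume_eq_prod, Measure.prod_prod, Real.volume_Icc, Real.volume_Icc]
    refine ENNReal.mul_pos ?_ ?_ <;> · simp; linarith
  -- Markov's inequality: outside `R` the deviations of the mean and of the variance add up to at
  -- least `e`. Thus the mass of `R` tends to 1. Since it is positive for every single `n`, it is
  -- bounded below.
  have hlow : ∀ n : ℕ, 6 ≤ n → 1 - (C / √n + |sampleMean y n - m| + flatMean y n (fun p => |p.2 - v|)) / e
      ≤ r n := by
    intro n hn
    have hZ := integral_flatKernel_pos h.ne hn
    have i0 := integrable_flatKernel h.ne hn
    have i1 := integrable_abs_mul_flatKernel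
      (integrable_fst_sub_mul_flatKernel h.ne hn (sampleMean y n))
    have i2 := integrable_abs_mul_flatKernel (integrable_snd_sub_mul_flatKernel h.ne hn v)
    have h1 : ∫ p, (flatKernel y n p - (1 / e * (|p.1 - sampleMean y n| * flatKernel y n p) +
        |sampleMean y n - m| / e * flatKernel y n p + 1 / e * (|p.2 - v| * flatKernel y n p)))
        ∂pairMeasure ≤ ∫ p, R.indicator (flatKernel y n) p ∂pairMeasure := by
      refine integral_mono_ae (i0.sub (((i1.const_mul _).add (i0.const_mul _)).add
        (i2.const_mul _))) (i0.indicator hR) ?_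
      filter_upwards [ae_pairMeasure] with p hp
      have hf := flatKernel_pos (y := y) (n := n) p hp
      have hnn : 0 ≤ 1 / e * (|p.1 - sampleMean y n| * flatKernel y n p) +
        |sampleMean y n - m| / e * flatKernel y n p + 1 / e * (|p.2 - v| * flatKernel y n p) := by
        positivity
      by_cases hpR : p ∈ R
      · rw [indicator_of_mem hpR]
        linarith
      · rw [indicator_of_notMem hpR]
        have h2 : e ≤ |p.1 - sampleMean y n| + |sampleMean y n - m| + |p.2 - v| := by
          by_contra hlt
          push Not at hlt
          have h3 := abs_sub_le p.1 (sampleMean y n) m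
          have h4 : |p.1 - m| ≤ e := by linarith [abs_nonneg (p.2 - v)]
          have h5 : |p.2 - v| ≤ e := by
            linarith [abs_nonneg (p.1 - sampleMean y n), abs_nonneg (sampleMean y n - m)]
          rw [abs_le] at h4 h5
          exact hpR (hsub ⟨⟨by linarith, by linarith⟩, ⟨by linarith, by linarith⟩⟩)
        have h3 : 1 ≤ (|p.1 - sampleMean y n| + |sampleMean y n - m| + |p.2 - v|) / e := by
          rwa [one_le_div he]
        have h4 := mul_le_mul_of_nonneg_right h3 hf.le
        have h5 : (|p.1 - sampleMean y n| + |sampleMean y n - m| + |p.2 - v|) / e *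
            flatKernel y n p = 1 / e * (|p.1 - sampleMean y n| * flatKernel y n p) +
            |sampleMean y n - m| / e * flatKernel y n p +
            1 / e * (|p.2 - v| * flatKernel y n p) := by ring
        linarith
    rw [integral_sub i0 (by exact ((i1.const_mul _).add (i0.const_mul _)).add (i2.const_mul _)),
      integral_add (by exact (i1.const_mul _).add (i0.const_mul _)) (i2.const_mul _),
      integral_add (i1.const_mul _) (i0.const_mul _), integral_const_mul, integral_const_mul,
      integral_const_mul] at h1
    have h2 : ∀ g : ℝ × ℝ → ℝ, ∫ p, g p * flatKernel y n p ∂pairMeasure =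
        flatMean y n g * ∫ p, flatKernel y n p ∂pairMeasure := fun g => by
      rw [flatMean, div_mul_cancel₀ _ hZ.ne']
    rw [h2 fun p => |p.1 - sampleMean y n|, h2 fun p => |p.2 - v|] at h1
    rw [hr]
    simp only
    rw [le_div_iff₀ hZ]
    refine le_trans ?_ h1
    have h3 : flatMean y n (fun p => |p.1 - sampleMean y n|) / e *
        (∫ p, flatKernel y n p ∂pairMeasure) ≤
        C / √n / e * ∫ p, flatKernel y n p ∂pairMeasure := by
      gcongr; exact hC n hn
    generalize flatMean y n (fun p => |p.1 - sampleMean y n|) = A at h3 ⊢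
    generalize flatMean y n (fun p => |p.2 - v|) = B
    generalize ∫ p, flatKernel y n p ∂pairMeasure = Z at h3 ⊢
    have h4 : (1 - (C / √n + |sampleMean y n - m| + B) / e) * Z =
        Z - (C / √n / e * Z + |sampleMean y n - m| / e * Z + 1 / e * (B * Z)) := by ring
    have h5 : 1 / e * (A * Z) = A / e * Z := by ring
    rw [h4, h5]
    linarith
  have hup : ∀ n, 6 ≤ n → r n ≤ 1 := fun n hn => by
    refine div_le_one_of_le₀ ?_ (integral_flatKernel_pos h.ne hn).le
    refine integral_mono_ae ((integrable_flatKernel h.ne hn).indicator hR)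
      (integrable_flatKernel h.ne hn) ?_
    filter_upwards [flatKernel_nonneg_ae] with p hp
    exact indicator_le_self' (fun _ _ => hp) _
  have hlim : Tendsto r atTop (𝓝 1) := by
    have h1 : Tendsto (fun n : ℕ => C / √(n : ℝ)) atTop (𝓝 0) :=
      tendsto_const_nhds.div_atTop (Real.tendsto_sqrt_atTop.comp tendsto_natCast_atTop_atTop)
    have h2 : Tendsto (fun n => |sampleMean y n - m|) atTop (𝓝 0) := by
      simpa using (h.mean.sub_const m).abs
    have h3 := (((h1.add h2).add h.tendsto_flatMean_snd).div_const e).const_sub 1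
    rw [show (1 : ℝ) - (0 + 0 + 0) / e = 1 by simp] at h3
    refine tendsto_of_tendsto_of_tendsto_of_le_of_le' h3 tendsto_const_nhds ?_ ?_
    · filter_upwards [eventually_ge_atTop 6] with n hn using hlow n hn
    · filter_upwards [eventually_ge_atTop 6] with n hn using hup n hn
  obtain ⟨κ, hκ, hκ'⟩ := exists_pos_lower_bound one_pos hlim hpos
  exact ⟨κ, hκ, fun n hn => (le_div_iff₀ (integral_flatKernel_pos h.ne hn)).1 (hκ' n hn)⟩

end FlatPrior

/-! ### Consistency under a general bounded prior -/

section RegularPrior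

variable {k : ℕ} {m v : Fin k → ℝ} {prior : (Fin k → ℝ) × (Fin k → ℝ) → ℝ} {x : Fin k → ℕ → ℝ}
  {N : Fin k → ℕ} {n₀ : ℕ}

lemma expectation_likelihood_eq (hN : ∀ i, N i ≠ 0) (f : (Fin k → ℝ) × (Fin k → ℝ) → ℝ) :
    (∫ θ in paramSpace k, f θ * (prior θ * likelihood x N θ)) /
      ∫ θ in paramSpace k, prior θ * likelihood x N θ =
    (∫ θ in paramSpace k, f θ * (prior θ * ∏ j, flatKernel (x j) (N j) (θ.1 j, θ.2 j))) /
      ∫ θ in paramSpace k, prior θ * ∏ j, flatKernel (x j) (N j) (θ.1 j, θ.2 j) := by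
  have h1 : ∫ θ in paramSpace k, f θ * (prior θ * likelihood x N θ) = likConst N *
      ∫ θ in paramSpace k, f θ * (prior θ * ∏ j, flatKernel (x j) (N j) (θ.1 j, θ.2 j)) := by
    rw [← integral_const_mul]
    refine setIntegral_congr_fun (measurableSet_paramSpace k) fun θ hθ => ?_
    simp only [likelihood_eq_prod_flatKernel hN hθ]
    ring
  have h2 : ∫ θ in paramSpace k, prior θ * likelihood x N θ = likConst N *
      ∫ θ in paramSpace k, prior θ * ∏ j, flatKernel (x j) (N j) (θ.1 j, θ.2 j) := by
    rw [← integral_const_mul]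
    refine setIntegral_congr_fun (measurableSet_paramSpace k) fun θ hθ => ?_
    simp only [likelihood_eq_prod_flatKernel hN hθ]
    ring
  rw [h1, h2, mul_div_mul_left _ _ (likConst_pos N).ne']

/-- The product of the likelihoods of all designs, up to a constant. -/
noncomputable def flatProd (x : Fin k → ℕ → ℝ) (N : Fin k → ℕ)
    (θ : (Fin k → ℝ) × (Fin k → ℝ)) : ℝ := ∏ j, flatKernel (x j) (N j) (θ.1 j, θ.2 j)

lemma flatProd_nonneg {θ : (Fin k → ℝ) × (Fin k → ℝ)} (hθ : θ ∈ paramSpace k) :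
    0 ≤ flatProd x N θ := Finset.prod_nonneg fun j _ => (flatKernel_pos _ (hθ j)).le

lemma integrableOn_prior_mul {C : ℝ} (hprior : ∀ θ ∈ paramSpace k, |prior θ| ≤ C)
    (hmeas : AEStronglyMeasurable prior (volume.restrict (paramSpace k)))
    {F : (Fin k → ℝ) × (Fin k → ℝ) → ℝ} (hF : IntegrableOn F (paramSpace k)) :
    IntegrableOn (fun θ => prior θ * F θ) (paramSpace k) :=
  hF.bdd_mul hmeas ((ae_restrict_mem (measurableSet_paramSpace k)).mono hprior)

/-- A prior that lies between multiples of the flat prior, the lower bound being local, changes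
posterior expectations by a bounded factor. -/
lemma post_expectation_bounds {c C κ : ℝ} {R : Set (ℝ × ℝ)} (hR : MeasurableSet R) (hc : 0 < c)
    (hκ : 0 < κ) (hnonneg : ∀ θ ∈ paramSpace k, 0 ≤ prior θ)
    (hC : ∀ θ ∈ paramSpace k, prior θ ≤ C)
    (hlow : ∀ θ : (Fin k → ℝ) × (Fin k → ℝ), (∀ j, (θ.1 j, θ.2 j) ∈ R) → c ≤ prior θ)
    (hmeas : AEStronglyMeasurable prior (volume.restrict (paramSpace k)))
    (hx : ∀ j, x j 0 ≠ x j 1) (hN : ∀ j, 6 ≤ N j)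
    (hmass : ∀ j, κ * ∫ p, flatKernel (x j) (N j) p ∂pairMeasure ≤
      ∫ p, R.indicator (flatKernel (x j) (N j)) p ∂pairMeasure) :
    0 < ∫ θ in paramSpace k, prior θ * flatProd x N θ ∧
    (∀ (i : Fin k) (f : ℝ × ℝ → ℝ),
      Integrable (fun p => f p * flatKernel (x i) (N i) p) pairMeasure →
      IntegrableOn (fun θ => f (θ.1 i, θ.2 i) * (prior θ * flatProd x N θ)) (paramSpace k) ∧
      |∫ θ in paramSpace k, f (θ.1 i, θ.2 i) * (prior θ * flatProd x N θ)| ≤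
        C / (c * κ ^ k) * flatMean (x i) (N i) (fun p => |f p|) *
          ∫ θ in paramSpace k, prior θ * flatProd x N θ) ∧
    (∀ (i : Fin k) (f : ℝ × ℝ → ℝ) (lo : ℝ), 0 < lo → (∀ p ∈ R, lo ≤ f p) →
      (∀ p : ℝ × ℝ, 0 < p.2 → 0 ≤ f p) →
      Integrable (fun p => f p * flatKernel (x i) (N i) p) pairMeasure →
      lo * (c * κ ^ k / C) * (∫ θ in paramSpace k, prior θ * flatProd x N θ) ≤
      ∫ θ in paramSpace k, f (θ.1 i, θ.2 i) * (prior θ * flatProd x N θ)) := by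
  have hk := fun j => integrable_flatKernel (hx j) (hN j)
  have hZ := fun j => integral_flatKernel_pos (hx j) (hN j)
  have hprior : ∀ θ ∈ paramSpace k, |prior θ| ≤ C := fun θ hθ => by
    rw [abs_of_nonneg (hnonneg θ hθ)]; exact hC θ hθ
  have iF : IntegrableOn (flatProd x N) (paramSpace k) := integrableOn_paramSpace_prod hk
  have iP := integrableOn_prior_mul hprior hmeas iF
  have eF : ∫ θ in paramSpace k, flatProd x N θ =
      ∏ j, ∫ p, flatKernel (x j) (N j) p ∂pairMeasure :=
    integral_paramSpace_prod fun j => flatKernel (x j) (N j)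
  set Z := ∏ j, ∫ p, flatKernel (x j) (N j) p ∂pairMeasure with hZdef
  have hZpos : 0 < Z := Finset.prod_pos fun j _ => hZ j
  -- the mass of the region
  set W : (Fin k → ℝ) × (Fin k → ℝ) → ℝ :=
    fun θ => ∏ j, R.indicator (flatKernel (x j) (N j)) (θ.1 j, θ.2 j) with hW
  have iW : IntegrableOn W (paramSpace k) :=
    integrableOn_paramSpace_prod (g := fun j => R.indicator (flatKernel (x j) (N j)))
      fun j => (hk j).indicator hR
  have eW : κ ^ k * Z ≤ ∫ θ in paramSpace k, W θ := by
    rw [hW, integral_paramSpace_prod fun j => R.indicator (flatKernel (x j) (N j))]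
    have : κ ^ k * Z = ∏ j : Fin k, κ * ∫ p, flatKernel (x j) (N j) p ∂pairMeasure := by
      rw [Finset.prod_mul_distrib, Finset.prod_const, Finset.card_univ, Fintype.card_fin]
    rw [this]
    exact Finset.prod_le_prod (fun j _ => (mul_pos hκ (hZ j)).le) fun j _ => hmass j
  have hWle : ∀ θ ∈ paramSpace k, c * W θ ≤ prior θ * flatProd x N θ := by
    intro θ hθ
    by_cases h : ∀ j, (θ.1 j, θ.2 j) ∈ R
    · have : W θ = flatProd x N θ := Finset.prod_congr rfl fun j _ => indicator_of_mem (h j) _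
      rw [this]
      exact mul_le_mul_of_nonneg_right (hlow θ h) (flatProd_nonneg hθ)
    · push Not at h
      obtain ⟨j, hj⟩ := h
      have : W θ = 0 := Finset.prod_eq_zero (Finset.mem_univ j) (indicator_of_notMem hj _)
      rw [this, mul_zero]
      exact mul_nonneg (hnonneg θ hθ) (flatProd_nonneg hθ)
  -- The normaliser lies between `c * κ ^ k * Z` and `C * Z`. The lower bound keeps only the
  -- parameters all of whose pairs lie in `R`, each coordinate contributing a share of at least `κ`.
  set D := ∫ θ in paramSpace k, prior θ * flatProd x N θ with hD
  have hDlow : c * κ ^ k * Z ≤ D := by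
    have h1 : c * ∫ θ in paramSpace k, W θ ≤ D := by
      rw [← integral_const_mul]
      exact setIntegral_mono_on (iW.const_mul c) iP (measurableSet_paramSpace k) hWle
    nlinarith
  have hDpos : 0 < D := lt_of_lt_of_le (by positivity) hDlow
  have hDup : D ≤ C * Z := by
    rw [← eF, ← integral_const_mul]
    exact setIntegral_mono_on iP (iF.const_mul C) (measurableSet_paramSpace k) fun θ hθ =>
      mul_le_mul_of_nonneg_right (hC θ hθ) (flatProd_nonneg hθ)
  have hCpos : 0 < C := pos_of_mul_pos_left (hDpos.trans_le hDup) hZpos.le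
  have hint : ∀ (i : Fin k) (f : ℝ × ℝ → ℝ),
      Integrable (fun p => f p * flatKernel (x i) (N i) p) pairMeasure →
      IntegrableOn (fun θ => f (θ.1 i, θ.2 i) * (prior θ * flatProd x N θ)) (paramSpace k) := by
    intro i f hf
    have h1 := integrableOn_paramSpace_mul_prod hk hf
    refine (integrableOn_prior_mul hprior hmeas h1).congr_fun (fun θ _ => ?_)
      (measurableSet_paramSpace k)
    simp only [flatProd]
    ring
  refine ⟨hDpos, fun i f hf => ⟨hint i f hf, ?_⟩, fun i f lo hlo hfR hf0 hf => ?_⟩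
  · have hfa := integrable_abs_mul_flatKernel hf
    have h1 : |∫ θ in paramSpace k, f (θ.1 i, θ.2 i) * (prior θ * flatProd x N θ)| ≤
        ∫ θ in paramSpace k, C * (|f (θ.1 i, θ.2 i)| * flatProd x N θ) := by
      refine abs_integral_le_integral_abs.trans ?_
      refine setIntegral_mono_on (hint i f hf).abs
        ((integrableOn_paramSpace_mul_prod hk hfa).const_mul C) (measurableSet_paramSpace k)
        fun θ hθ => ?_
      rw [abs_mul, abs_mul, abs_of_nonneg (flatProd_nonneg hθ)]
      have := mul_le_mul_of_nonneg_left (hprior θ hθ)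
        (mul_nonneg (abs_nonneg (f (θ.1 i, θ.2 i))) (flatProd_nonneg (x := x) (N := N) hθ))
      linarith
    rw [integral_const_mul] at h1
    have h2 : ∫ θ in paramSpace k, |f (θ.1 i, θ.2 i)| * flatProd x N θ =
        flatMean (x i) (N i) (fun p => |f p|) * Z := by
      have h3 := integral_paramSpace_mul_prod (fun j => flatKernel (x j) (N j)) i fun p => |f p|
      refine h3.trans ?_
      rw [hZdef, ← Finset.mul_prod_erase _ _ (Finset.mem_univ i), ← mul_assoc, flatMean,
        div_mul_cancel₀ _ (hZ i).ne']
    rw [h2] at h1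
    refine h1.trans ?_
    have h4 : C * (flatMean (x i) (N i) (fun p => |f p|) * Z) =
        C / (c * κ ^ k) * flatMean (x i) (N i) (fun p => |f p|) * (c * κ ^ k * Z) := by
      field_simp
    rw [h4]
    exact mul_le_mul_of_nonneg_left hDlow
      (mul_nonneg (by positivity) (flatMean_nonneg (hx i) (hN i) fun p => abs_nonneg _))
  · have h1 : lo * (c * ∫ θ in paramSpace k, W θ) ≤
        ∫ θ in paramSpace k, f (θ.1 i, θ.2 i) * (prior θ * flatProd x N θ) := by
      rw [← integral_const_mul, ← integral_const_mul]
      refine setIntegral_mono_on ((iW.const_mul c).const_mul lo) (hint i f hf)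
        (measurableSet_paramSpace k) fun θ hθ => ?_
      by_cases h : (θ.1 i, θ.2 i) ∈ R
      · have hnn : 0 ≤ prior θ * flatProd x N θ := mul_nonneg (hnonneg θ hθ) (flatProd_nonneg hθ)
        exact (mul_le_mul_of_nonneg_left (hWle θ hθ) hlo.le).trans
          (mul_le_mul_of_nonneg_right (hfR _ h) hnn)
      · have : W θ = 0 := Finset.prod_eq_zero (Finset.mem_univ i) (indicator_of_notMem h _)
        rw [this, mul_zero, mul_zero]
        exact mul_nonneg (hf0 _ (hθ i)) (mul_nonneg (hnonneg θ hθ) (flatProd_nonneg hθ))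
    refine le_trans ?_ h1
    calc lo * (c * κ ^ k / C) * D ≤ lo * (c * κ ^ k / C) * (C * Z) := by gcongr
      _ = lo * (c * (κ ^ k * Z)) := by field_simp
      _ ≤ _ := by gcongr

/-- The flat posterior is a product, so the expected deviations of the mean and of the variance of
design `i` depend on its own sample only. Even for a correlated prior, the actual expectations are
larger by at most a factor not depending on the sample sizes. The variance estimates stay away from
zero because `R` keeps a fixed share of the posterior mass and variances in `R` are bounded below.
-/
theorem IsRegularPrior.consistentEstimates (h : IsRegularPrior m v prior) (hn₀ : 6 ≤ n₀)
    (hv : ∀ i, 0 < v i) (hx : ∀ i, RegularSample (m i) (v i) (x i)) :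
    ConsistentEstimates v prior n₀ x := by
  obtain ⟨C, hC⟩ := h.bounded
  obtain ⟨c, hc, e, he, hev, hlow⟩ := h.lower_bound
  have hmeas : AEStronglyMeasurable prior (volume.restrict (paramSpace k)) :=
    h.uniformContinuousOn.continuousOn.aestronglyMeasurable (measurableSet_paramSpace k)
  set R : Set (ℝ × ℝ) := Icc ((⨅ j, m j) - e) ((⨆ j, m j) + e) ×ˢ
    Icc ((⨅ j, v j) - e) ((⨆ j, v j) + e + ((⨆ j, m j) - (⨅ j, m j) + 2 * e) ^ 2) with hRdef
  have hR : MeasurableSet R := measurableSet_Icc.prod measurableSet_Icc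
  have hlow' : ∀ θ : (Fin k → ℝ) × (Fin k → ℝ), (∀ j, (θ.1 j, θ.2 j) ∈ R) → c ≤ prior θ :=
    fun θ hθ => hlow θ fun j => hθ j
  have hb : ∀ (u : Fin k → ℝ) i, ⨅ j, u j ≤ u i ∧ u i ≤ ⨆ j, u j := fun u i =>
    ⟨ciInf_le (finite_range u).bddBelow i, le_ciSup (finite_range u).bddAbove i⟩
  have hmass : ∀ i, ∃ κ > 0, ∀ n, 6 ≤ n → κ * ∫ p, flatKernel (x i) n p ∂pairMeasure ≤
      ∫ p, R.indicator (flatKernel (x i) n) p ∂pairMeasure := fun i => by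
    refine (hx i).exists_mass_le hR he (by linarith [(hb v i).1, hv i]) (prod_mono ?_ ?_)
    · exact Icc_subset_Icc (by linarith [(hb m i).1]) (by linarith [(hb m i).2])
    · exact Icc_subset_Icc (by linarith [(hb v i).1])
        (by nlinarith [(hb v i).2, sq_nonneg ((⨆ j, m j) - (⨅ j, m j) + 2 * e)])
  choose κ hκ hκ' using hmass
  rcases isEmpty_or_nonempty (Fin k) with hE | hE
  · exact ⟨⟨0, fun _ _ i => (hE.false i).elim⟩, ⟨1, one_pos, fun _ _ i => (hE.false i).elim⟩,
      ⟨fun _ _ => 0, fun i => (hE.false i).elim, fun _ _ i => (hE.false i).elim⟩⟩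
  obtain ⟨i₀, hi₀⟩ := exists_eq_ciInf_of_finite (f := κ)
  obtain ⟨i₁, hi₁⟩ := exists_eq_ciInf_of_finite (f := v)
  have hκm : 0 < ⨅ j, κ j := by rw [← hi₀]; exact hκ i₀
  have hvm : 0 < ⨅ j, v j := by rw [← hi₁]; exact hv i₁
  have key := fun (N : Fin k → ℕ) (hN : ∀ i, n₀ ≤ N i) =>
    post_expectation_bounds (x := x) (N := N) hR hc hκm h.nonneg hC hlow' hmeas
      (fun j => (hx j).ne) (fun j => hn₀.trans (hN j)) fun j =>
        (mul_le_mul_of_nonneg_right (hb κ j).1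
          (integral_flatKernel_pos (hx j).ne (hn₀.trans (hN j))).le).trans
          (hκ' j (N j) (hn₀.trans (hN j)))
  have hN0 : ∀ N : Fin k → ℕ, (∀ i, n₀ ≤ N i) → ∀ i, N i ≠ 0 := fun N hN i => by
    have := hN i; omega
  have hN6 : ∀ N : Fin k → ℕ, (∀ i, n₀ ≤ N i) → ∀ i, 6 ≤ N i := fun N hN i => hn₀.trans (hN i)
  have hM : ∀ (N : Fin k → ℕ), (∀ i, n₀ ≤ N i) → ∀ i, postMean prior x N i =
      (∫ θ in paramSpace k, θ.1 i * (prior θ * flatProd x N θ)) /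
        ∫ θ in paramSpace k, prior θ * flatProd x N θ := fun N hN i => by
    rw [postMean_eq, expectation_likelihood_eq (hN0 N hN)]; rfl
  have hV : ∀ (N : Fin k → ℕ), (∀ i, n₀ ≤ N i) → ∀ i, postVar prior x N i =
      (∫ θ in paramSpace k, θ.2 i * (prior θ * flatProd x N θ)) /
        ∫ θ in paramSpace k, prior θ * flatProd x N θ := fun N hN i => by
    rw [postVar_eq, expectation_likelihood_eq (hN0 N hN)]; rfl
  have hdiff : ∀ (N : Fin k → ℕ), (∀ i, n₀ ≤ N i) → ∀ i (f : ℝ × ℝ → ℝ) (s : ℝ),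
      (∀ s, Integrable (fun p => (f p - s) * flatKernel (x i) (N i) p) pairMeasure) →
      |(∫ θ in paramSpace k, f (θ.1 i, θ.2 i) * (prior θ * flatProd x N θ)) /
        (∫ θ in paramSpace k, prior θ * flatProd x N θ) - s| ≤
      C / (c * (⨅ j, κ j) ^ k) * flatMean (x i) (N i) (fun p => |f p - s|) := by
    intro N hN i f s hint
    obtain ⟨hD, h1, -⟩ := key N hN
    obtain ⟨h2, h3⟩ := h1 i (fun p => f p - s) (hint s)
    obtain ⟨h4, -⟩ := h1 i f (by simpa using hint 0)
    obtain ⟨h5, -⟩ := h1 i (fun _ => 1) (by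
      simpa using integrable_flatKernel (hx i).ne (hN6 N hN i))
    simp only [one_mul] at h5
    have h6 : ∫ θ in paramSpace k, (f (θ.1 i, θ.2 i) - s) * (prior θ * flatProd x N θ) =
        (∫ θ in paramSpace k, f (θ.1 i, θ.2 i) * (prior θ * flatProd x N θ)) -
          s * ∫ θ in paramSpace k, prior θ * flatProd x N θ := by
      rw [← integral_const_mul, ← integral_sub h4 (h5.const_mul s)]
      congr 1
      ext θ
      ring
    rw [h6] at h3
    rw [div_sub' hD.ne', abs_div, abs_of_pos hD, div_le_iff₀ hD, mul_comm _ s]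
    exact h3
  have hCpos : 0 ≤ C := by
    have hθ : ((fun _ => 0, fun _ => 1) : (Fin k → ℝ) × (Fin k → ℝ)) ∈ paramSpace k :=
      fun _ => one_pos
    exact (h.nonneg _ hθ).trans (hC _ hθ)
  refine ⟨?_, ?_, ?_⟩
  · choose K hK0 hK using fun i => (hx i).exists_flatMean_fst_le
    refine ⟨C / (c * (⨅ j, κ j) ^ k) * ∑ i, K i, fun N hN i => ?_⟩
    rw [hM N hN, mul_div_assoc]
    refine (hdiff N hN i (fun p => p.1) _ fun s =>
      integrable_fst_sub_mul_flatKernel (hx i).ne (hN6 N hN i) s).trans ?_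
    refine mul_le_mul_of_nonneg_left ((hK i _ (hN6 N hN i)).trans ?_) (by positivity)
    gcongr
    exact Finset.single_le_sum (fun j _ => hK0 j) (Finset.mem_univ i)
  · have hCpos' : 0 < C := by
      refine hCpos.lt_of_ne fun h0 => ?_
      obtain ⟨hD, -, -⟩ := key (fun _ => n₀) fun _ => le_rfl
      refine hD.ne' (setIntegral_eq_zero_of_forall_eq_zero fun θ hθ => ?_)
      rw [le_antisymm (h0 ▸ hC θ hθ) (h.nonneg θ hθ), zero_mul]
    refine ⟨((⨅ j, v j) - e) * (c * (⨅ j, κ j) ^ k / C), mul_pos (by linarith) (by positivity),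
      fun N hN i => ?_⟩
    obtain ⟨hD, -, h1⟩ := key N hN
    rw [hV N hN, le_div_iff₀ hD]
    exact h1 i (fun p => p.2) _ (by linarith) (fun p hp => hp.2.1) (fun p hp => hp.le)
      (by simpa using integrable_snd_sub_mul_flatKernel (hx i).ne (hN6 N hN i) 0)
  · refine ⟨fun i n => C / (c * (⨅ j, κ j) ^ k) * flatMean (x i) n (fun p => |p.2 - v i|),
      fun i => ?_, fun N hN i => ?_⟩
    · simpa using (hx i).tendsto_flatMean_snd.const_mul (C / (c * (⨅ j, κ j) ^ k))
    · rw [hV N hN]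
      exact hdiff N hN i (fun p => p.2) _ fun s =>
        integrable_snd_sub_mul_flatKernel (hx i).ne (hN6 N hN i) s

end RegularPrior

/-! ### Ville's inequality and Gaussian random walks -/

section MaximalInequality

variable {Ω : Type*} [MeasurableSpace Ω] {P : Measure Ω} [IsProbabilityMeasure P]

lemma martingale_prod {W : ℕ → Ω → ℝ} (hmeas : ∀ l, Measurable (W l)) (hind : iIndepFun W P)
    (hint : ∀ l, Integrable (W l) P) (hone : ∀ l, ∫ ω, W l ω ∂P = 1) :
    Martingale (fun n => ∏ l ∈ Finset.range (n + 1), W l)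
      (Filtration.natural W fun l => (hmeas l).stronglyMeasurable) P := by
  set 𝒢 := Filtration.natural W fun l => (hmeas l).stronglyMeasurable
  have had : ∀ l n, l ≤ n → StronglyMeasurable[𝒢 n] (W l) := fun l n h =>
    (Filtration.stronglyAdapted_natural (fun l => (hmeas l).stronglyMeasurable) l).mono (𝒢.mono h)
  have hadp : ∀ n, StronglyMeasurable[𝒢 n] (∏ l ∈ Finset.range (n + 1), W l) := fun n =>
    Finset.stronglyMeasurable_prod _ fun l hl => had l n (by simpa [Nat.lt_succ_iff] using hl)
  have hi : ∀ n, Integrable (∏ l ∈ Finset.range (n + 1), W l) P := by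
    intro n
    induction n with
    | zero => simpa using hint 0
    | succ n ih =>
      rw [Finset.prod_range_succ]
      exact (hind.indepFun_prod_range_succ hmeas (n + 1)).integrable_mul ih (hint _)
  refine martingale_nat hadp hi fun n => ?_
  rw [Finset.prod_range_succ _ (n + 1)]
  have h1 := condExp_mul_of_stronglyMeasurable_left (hadp n)
    (by rw [← Finset.prod_range_succ]; exact hi (n + 1)) (hint (n + 1))
  have h2 : P[W (n + 1) | 𝒢 n] =ᵐ[P] fun _ => ∫ ω, W (n + 1) ω ∂P :=
    condExp_indep_eq (hmeas (n + 1)).comap_le (𝒢.le n)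
      (comap_measurable (W (n + 1))).stronglyMeasurable
      (hind.indep_comap_natural_of_lt (fun l => (hmeas l).stronglyMeasurable) (Nat.lt_succ_self n))
  filter_upwards [h1, h2] with ω h1 h2
  rw [h1, Pi.mul_apply, h2, hone, mul_one]

/-- Ville's inequality for a product of independent nonnegative random variables of mean one. -/
lemma measure_exists_le_prod_le {W : ℕ → Ω → ℝ} (hmeas : ∀ l, Measurable (W l))
    (hnonneg : ∀ l ω, 0 ≤ W l ω) (hind : iIndepFun W P)
    (hint : ∀ l, Integrable (W l) P) (hone : ∀ l, ∫ ω, W l ω ∂P = 1) {ε : ℝ} (hε : 0 < ε) :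
    P {ω | ∃ n, ε ≤ ∏ l ∈ Finset.range (n + 1), W l ω} ≤ ENNReal.ofReal (1 / ε) := by
  lift ε to NNReal using hε.le
  have hM := martingale_prod hmeas hind hint hone
  have hnn : ∀ n ω, 0 ≤ (∏ l ∈ Finset.range (n + 1), W l) ω := fun n ω => by
    rw [Finset.prod_apply]; exact Finset.prod_nonneg fun l _ => hnonneg l ω
  have hI : ∀ n, ∫ ω, (∏ l ∈ Finset.range (n + 1), W l) ω ∂P = 1 := fun n => by
    have h := hM.setIntegral_eq (Nat.zero_le n) (MeasurableSet.univ)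
    simp only [Measure.restrict_univ] at h
    rw [← h]
    simpa using hone 0
  -- Doob's maximal inequality bounds the probability of crossing up to time `n`, uniformly in `n`,
  -- and these events increase to the event of ever crossing.
  set A : ℕ → Set Ω := fun n => {ω | ∃ j ≤ n, ε ≤ ∏ l ∈ Finset.range (j + 1), W l ω} with hA
  have hAm : Monotone A := fun a b hab ω ⟨j, hj, h⟩ => ⟨j, hj.trans hab, h⟩
  have hU : {ω | ∃ n, ε ≤ ∏ l ∈ Finset.range (n + 1), W l ω} = ⋃ n, A n := by
    ext ω
    simp only [hA, mem_ofPred_eq, mem_iUnion]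
    exact ⟨fun ⟨n, h⟩ => ⟨n, n, le_rfl, h⟩, fun ⟨n, j, _, h⟩ => ⟨j, h⟩⟩
  rw [hU, hAm.measure_iUnion]
  refine iSup_le fun n => ?_
  have h := maximal_ineq hM.submartingale (fun n ω => hnn n ω) (ε := ε) n
  have hs : {ω | (ε : ℝ) ≤ (Finset.range (n + 1)).sup' Finset.nonempty_range_add_one
      fun k => (∏ l ∈ Finset.range (k + 1), W l) ω} = A n := by
    ext ω
    simp only [hA, mem_ofPred_eq, Finset.le_sup'_iff, Finset.mem_range, Nat.lt_succ_iff,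
      Finset.prod_apply]
  rw [hs] at h
  have h2 : ∫ ω in A n, (∏ l ∈ Finset.range (n + 1), W l) ω ∂P ≤ 1 := by
    rw [← hI n]
    exact setIntegral_le_integral (hM.integrable n) (ae_of_all _ (hnn n))
  rw [← ENNReal.ofReal_coe_nnreal] at h
  rw [one_div, ENNReal.ofReal_inv_of_pos hε, ← one_div, ENNReal.le_div_iff_mul_le
    (Or.inl (by simpa using hε.ne')) (Or.inl ENNReal.ofReal_ne_top), mul_comm]
  exact h.trans (ENNReal.ofReal_le_one.2 h2)

end MaximalInequality

section GaussianSums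

variable {Ω : Type*} [MeasurableSpace Ω] {P : Measure Ω} [IsProbabilityMeasure P]
  {Z : ℕ → Ω → ℝ} {v : NNReal}

lemma hasLaw_sum_gaussian (hmeas : ∀ l, Measurable (Z l)) (hind : iIndepFun Z P)
    (hlaw : ∀ l, HasLaw (Z l) (gaussianReal 0 v) P) (n : ℕ) :
    HasLaw (∑ l ∈ Finset.range n, Z l) (gaussianReal 0 (n * v)) P := by
  induction n with
  | zero =>
    have : gaussianReal 0 ((0 : ℕ) * v) = Measure.dirac 0 := by simp
    rw [this, Finset.sum_range_zero]
    exact hasLaw_dirac_of_ae_eq ae_eq_rfl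
  | succ n ih =>
    rw [Finset.sum_range_succ]
    have h := gaussianReal_add_gaussianReal_of_indepFun
      (hind.indepFun_sum_range_succ hmeas n) ih.map_eq (hlaw n).map_eq
    rw [zero_add, ← add_one_mul, ← Nat.cast_succ] at h
    exact ⟨ih.aemeasurable.add (hmeas n).aemeasurable, h⟩

/-- The probability that a Gaussian random walk is below `-L √s` at time `s` does not depend on
`s` and is positive. -/
lemma exists_measure_sum_le (hmeas : ∀ l, Measurable (Z l)) (hind : iIndepFun Z P)
    (hlaw : ∀ l, HasLaw (Z l) (gaussianReal 0 v) P) (hv : v ≠ 0) (L : ℝ) :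
    ∃ p, p ≠ 0 ∧ ∀ s : ℕ, 0 < s → P {ω | ∑ l ∈ Finset.range s, Z l ω ≤ -L * √s} = p := by
  refine ⟨gaussianReal 0 v (Iic (-L)), fun h => ?_, fun s hs => ?_⟩
  · have := gaussianReal_absolutelyContinuous' 0 hv h
    simp at this
  · have hs' : (0 : ℝ) < s := by exact_mod_cast hs
    have hs2 : 0 < √(s : ℝ) := Real.sqrt_pos.2 hs'
    have h := hasLaw_sum_gaussian hmeas hind hlaw s
    have h2 := gaussianReal_const_mul h (1 / √s)
    have e : {ω | ∑ l ∈ Finset.range s, Z l ω ≤ -L * √s} =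
        {ω | 1 / √s * (∑ l ∈ Finset.range s, Z l) ω ∈ Iic (-L)} := by
      ext ω
      simp only [mem_ofPred_eq, mem_Iic, Finset.sum_apply]
      rw [one_div, ← div_eq_inv_mul, div_le_iff₀ hs2]
    rw [e]
    refine (h2.measure_eq (p := fun x => x ∈ Iic (-L)) measurableSet_Iic).trans ?_
    have e2 : NNReal.mk ((1 / √(s : ℝ)) ^ 2) (sq_nonneg _) * (s * v) = v := by
      ext
      push_cast
      rw [div_pow, Real.sq_sqrt hs'.le]
      field_simp
    rw [mul_zero, e2]
    rfl

/-- A Gaussian random walk stays above a line of slope `-M / √s` from time `s / q` on, with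
probability close to one uniformly in `s`. -/
lemma measure_exists_sum_lt_le (hmeas : ∀ l, Measurable (Z l)) (hind : iIndepFun Z P)
    (hlaw : ∀ l, HasLaw (Z l) (gaussianReal 0 v) P) {q : ℕ} (hq : 0 < q) {c : ℝ} (hc : 0 ≤ c)
    {s : ℕ} (hs : 0 < s) :
    P {ω | ∃ n : ℕ, s ≤ q * n ∧ ∑ l ∈ Finset.range n, Z l ω < -(v / 2 + c * q) * n / √s} ≤
      ENNReal.ofReal (Real.exp (-c)) := by
  have hs' : (0 : ℝ) < s := by exact_mod_cast hs
  have hs2 : 0 < √(s : ℝ) := Real.sqrt_pos.2 hs'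
  have hq' : (0 : ℝ) < q := by exact_mod_cast hq
  -- With S_n the walk, exp(-r S_n - n v r² / 2) is a martingale of mean one. If the walk is below
  -- the line at some n ≥ s / q, the exponent is at least c q n r² = c q n / s ≥ c.
  set r := 1 / √(s : ℝ) with hr
  have hr2 : r ^ 2 = 1 / s := by rw [hr, div_pow, Real.sq_sqrt hs'.le, one_pow]
  have hmgf : ∀ l, ∫ ω, Real.exp (-r * Z l ω) ∂P = Real.exp (v * r ^ 2 / 2) := fun l => by
    have h := mgf_gaussianReal (hlaw l).map_eq (-r)
    rw [mgf] at h
    rw [h]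
    congr 1
    ring
  have hint : ∀ l, Integrable (fun ω => Real.exp (-r * Z l ω)) P := fun l => by
    refine Integrable.of_integral_ne_zero ?_
    rw [hmgf]; positivity
  set W : ℕ → Ω → ℝ := fun l ω => Real.exp (-(v * r ^ 2 / 2)) * Real.exp (-r * Z l ω) with hW
  have hprod : ∀ n ω, ∏ l ∈ Finset.range n, W l ω =
      Real.exp (-(n * (v * r ^ 2 / 2)) - r * ∑ l ∈ Finset.range n, Z l ω) := by
    intro n ω
    simp only [hW]
    rw [Finset.prod_mul_distrib, Finset.prod_const, Finset.card_range, ← Real.exp_sum,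
      ← Real.exp_nat_mul, ← Real.exp_add, ← Finset.mul_sum]
    congr 1
    ring
  have hville := measure_exists_le_prod_le (P := P) (W := W)
    (fun l => by have := hmeas l; simp only [hW]; fun_prop)
    (fun l ω => by positivity)
    (hind.comp (fun _ z => Real.exp (-(v * r ^ 2 / 2)) * Real.exp (-r * z)) fun _ => by fun_prop)
    (fun l => (hint l).const_mul _)
    (fun l => by
      simp only [hW]
      rw [integral_const_mul, hmgf, ← Real.exp_add, neg_add_cancel, Real.exp_zero])
    (Real.exp_pos c)
  rw [one_div, ← Real.exp_neg] at hville
  refine (measure_mono ?_).trans hville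
  rintro ω ⟨n, hn, h⟩
  have hn0 : n ≠ 0 := by rintro rfl; simp at hn; omega
  obtain ⟨n', rfl⟩ := Nat.exists_eq_succ_of_ne_zero hn0
  refine ⟨n', ?_⟩
  rw [← Nat.succ_eq_add_one, hprod, Real.exp_le_exp]
  set N : ℝ := ((n'.succ : ℕ) : ℝ)
  have hN : (s : ℝ) ≤ q * N := by
    have : ((s : ℕ) : ℝ) ≤ ((q * n'.succ : ℕ) : ℝ) := by exact_mod_cast hn
    rwa [Nat.cast_mul] at this
  have h1 : r * ∑ l ∈ Finset.range n'.succ, Z l ω ≤ r * (-(v / 2 + c * q) * N / √s) :=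
    mul_le_mul_of_nonneg_left h.le (by positivity)
  have h2 : r * (-(v / 2 + c * q) * N / √s) = -(v / 2 + c * q) * N * r ^ 2 := by
    rw [hr]; ring
  have h3 : c ≤ c * q * N * r ^ 2 := by
    rw [hr2, mul_one_div, le_div_iff₀ hs', mul_assoc]
    exact mul_le_mul_of_nonneg_left hN hc
  rw [h2] at h1
  linarith

end GaussianSums

/-! ### Oscillation of the sample means -/

section Oscillation

variable {k : ℕ}

/-- The partial sums `S` of design `i` are low at time `s`, while those of the others are not low
from time `s / q` on. -/
def LowAt (q : ℕ) (M L : ℝ) (i : Fin k) (S : Fin k → ℕ → ℝ) (s : ℕ) : Prop :=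
  S i s ≤ -L * √s ∧ ∀ j, j ≠ i → ∀ n : ℕ, s ≤ q * n → -M * n / √s ≤ S j n

/-- A bounded error `K` is eventually below √s, and also below n / √s for all n ≥ s / q. It is
therefore absorbed by changing each constant by one. -/
lemma frequently_lowAt_of_abs_sub_le {q : ℕ} (hq : 0 < q) {M L K : ℝ} {i : Fin k}
    {S S' : Fin k → ℕ → ℝ} (hK : ∀ j n, |S j n - S' j n| ≤ K)
    (h : ∃ᶠ s in atTop, LowAt q M (L + 1) i S s) : ∃ᶠ s in atTop, LowAt q (M + 1) L i S' s := by
  have hs : Tendsto (fun s : ℕ => √(s : ℝ)) atTop atTop :=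
    Real.tendsto_sqrt_atTop.comp tendsto_natCast_atTop_atTop
  have hev := (hs.eventually_ge_atTop (K * q)).and ((hs.eventually_ge_atTop K).and
    (eventually_gt_atTop 0))
  refine (h.and_eventually hev).mono ?_
  rintro s ⟨⟨h1, h2⟩, h3, h4, h5⟩
  have h5' : (0 : ℝ) < s := by exact_mod_cast h5
  have hss : 0 < √(s : ℝ) := Real.sqrt_pos.2 h5'
  have hq' : (0 : ℝ) < q := by exact_mod_cast hq
  refine ⟨?_, fun j hj n hn => ?_⟩
  · have := (abs_le.1 (hK i s)).1
    linarith
  · have h6 := (abs_le.1 (hK j n)).2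
    have h7 := h2 j hj n hn
    have h8 : (s : ℝ) ≤ q * n := by exact_mod_cast hn
    have h9 : K ≤ n / √s := by
      rw [le_div_iff₀ hss]
      have h10 : K * q * √s ≤ √s * √s := mul_le_mul_of_nonneg_right h3 hss.le
      rw [Real.mul_self_sqrt h5'.le] at h10
      refine le_of_mul_le_mul_left ?_ hq'
      linarith
    have h10 : -(M + 1) * n / √s = -M * n / √s - n / √s := by ring
    linarith

/-- The sum of the terms with index in `[a, n)`. -/
def sumFrom (z : Fin k → ℕ → ℝ) (a : ℕ) (j : Fin k) (n : ℕ) : ℝ := ∑ l ∈ Finset.Ico a n, z j l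

lemma abs_sumFrom_sub_le (z : Fin k → ℕ → ℝ) (a : ℕ) (j : Fin k) (n : ℕ) :
    |sumFrom z 0 j n - sumFrom z a j n| ≤ ∑ j, ∑ l ∈ Finset.range a, |z j l| := by
  have h : ∀ b ≤ a, |∑ l ∈ Finset.range b, z j l| ≤ ∑ j, ∑ l ∈ Finset.range a, |z j l| := by
    intro b hb
    refine (Finset.abs_sum_le_sum_abs _ _).trans ?_
    refine (Finset.sum_le_sum_of_subset_of_nonneg (Finset.range_subset_range.2 hb)
      fun _ _ _ => abs_nonneg _).trans ?_
    exact Finset.single_le_sum (f := fun j => ∑ l ∈ Finset.range a, |z j l|)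
      (fun _ _ => Finset.sum_nonneg fun _ _ => abs_nonneg _) (Finset.mem_univ j)
  rcases le_total n a with hn | hn
  · rw [sumFrom, sumFrom, Finset.Ico_eq_empty_of_le hn, Finset.sum_empty, sub_zero,
      ← Finset.range_eq_Ico]
    exact h n hn
  · rw [sumFrom, sumFrom, ← Finset.sum_Ico_consecutive _ (Nat.zero_le a) hn, add_sub_cancel_right,
      ← Finset.range_eq_Ico]
    exact h a le_rfl

section Measurability

variable {Ω : Type*} [MeasurableSpace Ω] {S : Fin k → ℕ → Ω → ℝ} {q : ℕ} {M L : ℝ} {i : Fin k}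

lemma measurableSet_forall_le (hS : ∀ j, j ≠ i → ∀ n, Measurable (S j n)) (s : ℕ) :
    MeasurableSet {ω | ∀ j, j ≠ i → ∀ n : ℕ, s ≤ q * n → -M * n / √s ≤ S j n ω} := by
  simp only [ofPred_forall]
  exact MeasurableSet.iInter fun j => MeasurableSet.iInter fun hj => MeasurableSet.iInter fun n =>
    MeasurableSet.iInter fun _ => measurableSet_le measurable_const (hS j hj n)

lemma measurableSet_lowAt (hS : ∀ j n, Measurable (S j n)) (s : ℕ) :
    MeasurableSet {ω | LowAt q M L i (fun j n => S j n ω) s} :=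
  (measurableSet_le (hS i s) measurable_const).inter
    (measurableSet_forall_le (fun j _ n => hS j n) s)

lemma measurableSet_frequently {E : ℕ → Ω → Prop} (hE : ∀ s, MeasurableSet {ω | E s ω}) :
    MeasurableSet {ω | ∃ᶠ s in atTop, E s ω} := by
  have : {ω | ∃ᶠ s in atTop, E s ω} = ⋂ a : ℕ, ⋃ s : ℕ, ⋃ _ : a ≤ s, {ω | E s ω} := by
    ext ω; simp [frequently_atTop]
  rw [this]
  exact MeasurableSet.iInter fun a => MeasurableSet.iUnion fun s => MeasurableSet.iUnion fun _ =>
    hE s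

/-- Continuity from above along the decreasing unions of late events; each union contains an event
of probability at least `p`. -/
lemma le_measure_frequently {P : Measure Ω} [IsFiniteMeasure P] {E : ℕ → Ω → Prop}
    (hE : ∀ s, MeasurableSet {ω | E s ω}) {p : ENNReal} {s₀ : ℕ}
    (h : ∀ s, s₀ ≤ s → p ≤ P {ω | E s ω}) : p ≤ P {ω | ∃ᶠ s in atTop, E s ω} := by
  have e : {ω | ∃ᶠ s in atTop, E s ω} = ⋂ a : ℕ, ⋃ s : ℕ, ⋃ _ : a ≤ s, {ω | E s ω} := by
    ext ω; simp [frequently_atTop]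
  have hanti : Antitone fun a : ℕ => ⋃ s : ℕ, ⋃ _ : a ≤ s, {ω | E s ω} := fun a b hab =>
    iUnion_mono fun s => iUnion_mono' fun hs => ⟨hab.trans hs, subset_rfl⟩
  rw [e, hanti.measure_iInter (fun a => (MeasurableSet.iUnion fun s =>
    MeasurableSet.iUnion fun _ => hE s).nullMeasurableSet) ⟨0, measure_ne_top _ _⟩]
  refine le_iInf fun a => (h (max a s₀) (le_max_right _ _)).trans (measure_mono ?_)
  exact subset_iUnion₂_of_subset (max a s₀) (le_max_left _ _) subset_rfl

end Measurability

variable {Ω : Type*}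

/-- The σ-algebra generated by the observations with index in `A`. -/
abbrev obsAlgebra (Z : Fin k → ℕ → Ω → ℝ) (A : Set (Fin k × ℕ)) : MeasurableSpace Ω :=
  ⨆ p ∈ A, MeasurableSpace.comap (Z p.1 p.2) inferInstance

lemma measurable_obsAlgebra {Z : Fin k → ℕ → Ω → ℝ} {A : Set (Fin k × ℕ)} {j : Fin k} {l : ℕ}
    (h : (j, l) ∈ A) : Measurable[obsAlgebra Z A] (Z j l) :=
  (comap_measurable (Z j l)).mono
    (le_iSup₂_of_le (f := fun (p : Fin k × ℕ) (_ : p ∈ A) =>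
      MeasurableSpace.comap (Z p.1 p.2) inferInstance) (j, l) h le_rfl) le_rfl

lemma measurable_sumFrom {Z : Fin k → ℕ → Ω → ℝ} {A : Set (Fin k × ℕ)} {a : ℕ} {j : Fin k}
    (h : ∀ l, a ≤ l → (j, l) ∈ A) (n : ℕ) :
    Measurable[obsAlgebra Z A] fun ω => sumFrom (fun j l => Z j l ω) a j n :=
  Finset.measurable_sum _ fun l hl => measurable_obsAlgebra (h l (Finset.mem_Ico.1 hl).1)

lemma obsAlgebra_mono {Z : Fin k → ℕ → Ω → ℝ} {A B : Set (Fin k × ℕ)} (h : A ⊆ B) :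
    obsAlgebra Z A ≤ obsAlgebra Z B := biSup_mono h

lemma obsAlgebra_le [mΩ : MeasurableSpace Ω] {Z : Fin k → ℕ → Ω → ℝ}
    (hZ : ∀ j l, Measurable (Z j l)) (A : Set (Fin k × ℕ)) : obsAlgebra Z A ≤ mΩ :=
  iSup₂_le fun p _ => (hZ p.1 p.2).comap_le

variable [MeasurableSpace Ω] {P : Measure Ω} {Z : Fin k → ℕ → Ω → ℝ} {v : Fin k → NNReal}

lemma indep_obsAlgebra (hZ : ∀ j l, Measurable (Z j l))
    (hind : iIndepFun (fun p : Fin k × ℕ => Z p.1 p.2) P) {A B : Set (Fin k × ℕ)}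
    (h : Disjoint A B) : Indep (obsAlgebra Z A) (obsAlgebra Z B) P :=
  indep_iSup_of_disjoint (m := fun p : Fin k × ℕ => MeasurableSpace.comap (Z p.1 p.2) inferInstance)
    (fun p => (hZ p.1 p.2).comap_le) hind h

lemma iIndepFun_row (hind : iIndepFun (fun p : Fin k × ℕ => Z p.1 p.2) P) (j : Fin k) :
    iIndepFun (Z j) P :=
  hind.precomp (g := fun l : ℕ => ((j, l) : Fin k × ℕ)) fun a b h => by simpa using h

variable [IsProbabilityMeasure P]

/-- A zero-one law: the occurrence of infinitely many low times has probability zero or one, up to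
a change of constants. -/
lemma ae_frequently_lowAt (hZ : ∀ j l, Measurable (Z j l))
    (hind : iIndepFun (fun p : Fin k × ℕ => Z p.1 p.2) P) {q : ℕ} (hq : 0 < q) {M L : ℝ}
    {i : Fin k}
    (hpos : P {ω | ∃ᶠ s in atTop, LowAt q M (L + 1 + 1) i (sumFrom (fun j l => Z j l ω) 0) s} ≠ 0) :
    ∀ᵐ ω ∂P, ∃ᶠ s in atTop, LowAt q (M + 1 + 1) L i (sumFrom (fun j l => Z j l ω) 0) s := by
  -- `U a` uses sums started at index `a`. Requiring it for all large `a` gives an event that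
  -- depends on no finite set of observations, so that Kolmogorov's law applies. Restarting the sums
  -- and undoing this changes the constants once each.
  set U : ℕ → Ω → Prop := fun a ω =>
    ∃ᶠ s in atTop, LowAt q (M + 1) (L + 1) i (sumFrom (fun j l => Z j l ω) a) s with hU
  set T : Set Ω := {ω | ∀ᶠ a in atTop, U a ω} with hT
  have hTmeas : ∀ r : ℕ, MeasurableSet[obsAlgebra Z {p | r ≤ p.2}] T := by
    intro r
    have e : T = ⋃ b : ℕ, ⋂ a : ℕ, ⋂ _ : b ≤ a, ⋂ _ : r ≤ a, {ω | U a ω} := by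
      ext ω
      simp only [hT, mem_ofPred_eq, eventually_atTop, mem_iUnion, mem_iInter]
      exact ⟨fun ⟨b, h⟩ => ⟨b, fun a ha _ => h a ha⟩, fun ⟨b, h⟩ =>
        ⟨max b r, fun a ha => h a ((le_max_left _ _).trans ha) ((le_max_right _ _).trans ha)⟩⟩
    rw [e]
    refine MeasurableSet.iUnion fun b => MeasurableSet.iInter fun a => MeasurableSet.iInter fun _ =>
      MeasurableSet.iInter fun hr => ?_
    exact @measurableSet_frequently Ω (obsAlgebra Z {p | r ≤ p.2}) _ fun s =>
      @measurableSet_lowAt k Ω (obsAlgebra Z {p | r ≤ p.2}) _ q (M + 1) (L + 1) i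
        (fun j n => measurable_sumFrom (fun l hl => hr.trans hl) n) s
  have h01 : P T = 0 ∨ P T = 1 := by
    refine measure_zero_or_one_of_measurableSet_limsup (f := cofinite) (p := Set.Finite)
      (s := fun p : Fin k × ℕ => MeasurableSpace.comap (Z p.1 p.2) inferInstance)
      (ns := fun t : Finset (Fin k × ℕ) => (t : Set (Fin k × ℕ)))
      (fun p => (hZ p.1 p.2).comap_le) hind (fun t ht => ht.compl_mem_cofinite)
      (Monotone.directed_le fun s t h => Finset.coe_subset.2 h) (fun t => t.finite_toSet)
      (fun p => ⟨{p}, by simp⟩) ?_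
    rw [limsup_eq_iInf_iSup, MeasurableSpace.measurableSet_iInf]
    intro B
    rw [MeasurableSpace.measurableSet_iInf]
    intro hB
    obtain ⟨r, hr⟩ := (Set.Finite.image Prod.snd (mem_cofinite.1 hB)).bddAbove
    refine obsAlgebra_mono (Z := Z) (A := {p | r + 1 ≤ p.2}) (B := B) (fun p hp => ?_) _
      (hTmeas (r + 1))
    by_contra hpB
    have h1 : p.2 ≤ r := hr ⟨p, hpB, rfl⟩
    have h2 : r + 1 ≤ p.2 := hp
    omega
  have h1 : P T = 1 := by
    refine h01.resolve_left fun h0 => hpos (measure_mono_null (fun ω hω => ?_) h0)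
    exact Eventually.of_forall fun a =>
      frequently_lowAt_of_abs_sub_le hq (abs_sumFrom_sub_le _ a) hω
  have hTm : MeasurableSet T := obsAlgebra_le hZ _ _ (hTmeas 0)
  filter_upwards [(prob_compl_eq_zero_iff hTm).2 h1] with ω hω
  obtain ⟨a, ha⟩ := Eventually.exists (show ∀ᶠ a in atTop, U a ω from hω)
  refine frequently_lowAt_of_abs_sub_le hq (K := ∑ j, ∑ l ∈ Finset.range a, |Z j l ω|)
    (fun j n => ?_) ha
  rw [abs_sub_comm]
  exact abs_sumFrom_sub_le (fun j l => Z j l ω) a j n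

/-- A union bound over the designs in `measure_exists_sum_lt_le` with c = log (2 k), so that each of
them contributes at most 1 / (2 k). -/
lemma half_le_measure_forall_le (hZ : ∀ j l, Measurable (Z j l))
    (hind : iIndepFun (fun p : Fin k × ℕ => Z p.1 p.2) P)
    (hlaw : ∀ j l, HasLaw (Z j l) (gaussianReal 0 (v j)) P) {q : ℕ} (hq : 0 < q) (i : Fin k)
    {s : ℕ} (hs : 1 ≤ s) :
    1 / 2 ≤ P {ω | ∀ j, j ≠ i → ∀ n : ℕ, s ≤ q * n →
      -(∑ j, (v j : ℝ) / 2 + Real.log (2 * k) * q) * n / √s ≤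
        sumFrom (fun j l => Z j l ω) 0 j n} := by
  have hk : (0 : ℝ) < k := by exact_mod_cast i.pos
  have hk1 : (1 : ℝ) ≤ k := by exact_mod_cast i.pos
  set F : Set Ω := {ω | ∀ j, j ≠ i → ∀ n : ℕ, s ≤ q * n →
      -(∑ j, (v j : ℝ) / 2 + Real.log (2 * k) * q) * n / √s ≤
        sumFrom (fun j l => Z j l ω) 0 j n} with hF
  have hlog : 0 ≤ Real.log (2 * k) := Real.log_nonneg (by linarith)
  set G : Fin k → Set Ω := fun j => {ω | ∃ n : ℕ, s ≤ q * n ∧ ∑ l ∈ Finset.range n, Z j l ω <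
        -((v j : ℝ) / 2 + Real.log (2 * k) * q) * n / √s} with hG
  have hsub : Fᶜ ⊆ ⋃ j : Fin k, G j := by
    intro ω hω
    simp only [hF, mem_compl_iff, mem_ofPred_eq, not_forall, not_le] at hω
    obtain ⟨j, hj, n, hn, h⟩ := hω
    refine mem_iUnion.2 ⟨j, n, hn, ?_⟩
    rw [Finset.range_eq_Ico]
    refine lt_of_lt_of_le h ?_
    have h1 : (v j : ℝ) / 2 ≤ ∑ j, (v j : ℝ) / 2 :=
      Finset.single_le_sum (f := fun j => (v j : ℝ) / 2) (fun j _ => by positivity)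
        (Finset.mem_univ j)
    gcongr
  have hFc : P Fᶜ ≤ 1 / 2 := by
    refine (measure_mono hsub).trans ((measure_iUnion_le _).trans ?_)
    have h1 : ∀ j, P (G j) ≤ ENNReal.ofReal (Real.exp (-Real.log (2 * k))) := fun j =>
      measure_exists_sum_lt_le (hZ j) (iIndepFun_row hind j) (hlaw j) hq hlog hs
    refine (ENNReal.tsum_le_tsum h1).trans ?_
    rw [tsum_fintype, Finset.sum_const, Finset.card_univ, Fintype.card_fin, nsmul_eq_mul,
      Real.exp_neg, Real.exp_log (by positivity), ← ENNReal.ofReal_natCast k,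
      ← ENNReal.ofReal_mul hk.le]
    have : (k : ℝ) * (2 * (k : ℝ))⁻¹ = 1 / 2 := by field_simp
    rw [this, ENNReal.ofReal_div_of_pos two_pos]
    simp
  have hFm : MeasurableSet F :=
    measurableSet_forall_le (S := fun j n ω => sumFrom (fun j l => Z j l ω) 0 j n)
      (fun j _ n => Finset.measurable_sum _ fun l _ => hZ j l) s
  have h1 : P F + P Fᶜ = 1 := prob_add_prob_compl hFm
  by_contra h
  push Not at h
  have h2 : P F + P Fᶜ < 1 / 2 + 1 / 2 :=
    ENNReal.add_lt_add_of_lt_of_le (measure_ne_top _ _) h hFc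
  rw [h1, ENNReal.add_halves] at h2
  exact lt_irrefl _ h2

/-- The condition on design `i` and that on the others involve disjoint sets of observations and are
independent. The first has a positive probability that does not depend on `s`, the second at least
1/2. The order of quantifiers matters: `M` serves all `L`. -/
lemma exists_le_measure_lowAt (hZ : ∀ j l, Measurable (Z j l))
    (hind : iIndepFun (fun p : Fin k × ℕ => Z p.1 p.2) P)
    (hlaw : ∀ j l, HasLaw (Z j l) (gaussianReal 0 (v j)) P) (hv : ∀ j, v j ≠ 0)
    {q : ℕ} (hq : 0 < q) : ∃ M : ℝ, ∀ (L : ℝ) (i : Fin k), ∃ p : ENNReal, p ≠ 0 ∧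
      ∀ s, 1 ≤ s → p ≤ P {ω | LowAt q M L i (sumFrom (fun j l => Z j l ω) 0) s} := by
  refine ⟨∑ j, (v j : ℝ) / 2 + Real.log (2 * k) * q, fun L i => ?_⟩
  obtain ⟨p, hp, hps⟩ := exists_measure_sum_le (hZ i) (iIndepFun_row hind i) (hlaw i) (hv i) L
  refine ⟨p * (1 / 2), mul_ne_zero hp (by simp), fun s hs => ?_⟩
  have hPF := half_le_measure_forall_le hZ hind hlaw hq i hs
  generalize ∑ j, (v j : ℝ) / 2 + Real.log (2 * k) * q = M at hPF ⊢
  have hHm : MeasurableSet[obsAlgebra Z {p | p.1 = i}]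
      {ω | sumFrom (fun j l => Z j l ω) 0 i s ≤ -L * √s} :=
    (measurable_sumFrom (fun l _ => rfl) s) measurableSet_Iic
  have hFm := @measurableSet_forall_le k Ω (obsAlgebra Z {p | p.1 ≠ i})
    (fun j n ω => sumFrom (fun j l => Z j l ω) 0 j n) q M i
      (fun j hj n => measurable_sumFrom (fun l _ => hj) n) s
  have hI : Indep (obsAlgebra Z {p | p.1 = i}) (obsAlgebra Z {p | p.1 ≠ i}) P :=
    indep_obsAlgebra hZ hind (Set.disjoint_left.2 fun p h1 h2 => h2 h1)
  have hHF := (Indep_iff _ _ P).1 hI _ _ hHm hFm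
  have hPH : P {ω | sumFrom (fun j l => Z j l ω) 0 i s ≤ -L * √s} = p := by
    rw [← hps s hs]
    simp only [sumFrom, ← Finset.range_eq_Ico]
  refine le_trans ?_ (hHF.symm.le.trans (measure_mono fun ω h => ⟨h.1, h.2⟩))
  rw [hPH]
  exact mul_le_mul_right hPF p

/-- A positive probability, bounded below uniformly in the time, passes to infinitely many times,
and the zero-one law raises it to one. There are only countably many choices of `q`, `L` and `i`.
Dividing the centred sums by the sample sizes gives the sample means. -/
theorem ae_oscillatingMeans {m : Fin k → ℝ} {X : Fin k → ℕ → Ω → ℝ}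
    (hX : ∀ j l, Measurable (X j l)) (hind : iIndepFun (fun p : Fin k × ℕ => X p.1 p.2) P)
    (hlaw : ∀ j l, HasLaw (X j l) (gaussianReal (m j) (v j)) P) (hv : ∀ j, v j ≠ 0) :
    ∀ᵐ ω ∂P, OscillatingMeans m fun j l => X j l ω := by
  set Z : Fin k → ℕ → Ω → ℝ := fun j l ω => X j l ω - m j with hZdef
  have hZ : ∀ j l, Measurable (Z j l) := fun j l => (hX j l).sub_const _
  have hindZ : iIndepFun (fun p : Fin k × ℕ => Z p.1 p.2) P :=
    hind.comp (fun p x => x - m p.1) fun p => by fun_prop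
  have hlawZ : ∀ j l, HasLaw (Z j l) (gaussianReal 0 (v j)) P := fun j l => by
    have := gaussianReal_sub_const (hlaw j l) (m j)
    rwa [sub_self] at this
  have key : ∀ q : ℕ, 0 < q → ∃ M : ℝ, ∀ (L : ℕ) (i : Fin k), ∀ᵐ ω ∂P,
      ∃ᶠ s in atTop, LowAt q M L i (sumFrom (fun j l => Z j l ω) 0) s := by
    intro q hq
    obtain ⟨M, hM⟩ := exists_le_measure_lowAt hZ hindZ hlawZ hv hq
    refine ⟨M + 1 + 1, fun L i => ae_frequently_lowAt hZ hindZ hq ?_⟩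
    obtain ⟨p, hp, hps⟩ := hM (L + 1 + 1) i
    refine (lt_of_lt_of_le (pos_iff_ne_zero.2 hp) (le_measure_frequently (fun s => ?_) hps)).ne'
    exact measurableSet_lowAt (S := fun j n ω => sumFrom (fun j l => Z j l ω) 0 j n)
      (fun j n => Finset.measurable_sum _ fun l _ => hZ j l) s
  choose! M hM using key
  have hall : ∀ᵐ ω ∂P, ∀ (q : ℕ), 0 < q → ∀ (L : ℕ) (i : Fin k),
      ∃ᶠ s in atTop, LowAt q (M q) L i (sumFrom (fun j l => Z j l ω) 0) s := by
    rw [ae_all_iff]; intro q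
    rw [ae_all_iff]; intro hq
    rw [ae_all_iff]; intro L
    rw [ae_all_iff]; intro i
    exact hM q hq L i
  filter_upwards [hall] with ω hω q hq
  refine ⟨M q, fun L i => ((hω q hq L i).and_eventually (eventually_gt_atTop 0)).mono ?_⟩
  rintro s ⟨⟨h1, h2⟩, hs⟩
  have hs' : (0 : ℝ) < s := by exact_mod_cast hs
  have hss : 0 < √(s : ℝ) := Real.sqrt_pos.2 hs'
  have hmean : ∀ j n, 0 < n → sampleMean (fun l => X j l ω) n =
      m j + sumFrom (fun j l => Z j l ω) 0 j n / n := by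
    intro j n hn
    have hn' : (0 : ℝ) < n := by exact_mod_cast hn
    simp only [sampleMean, sumFrom, hZdef, ← Finset.range_eq_Ico, Finset.sum_sub_distrib,
      Finset.sum_const, Finset.card_range, nsmul_eq_mul]
    field_simp
    ring
  refine ⟨?_, fun j hj n hn => ?_⟩
  · rw [hmean i s hs]
    have h3 : sumFrom (fun j l => Z j l ω) 0 i s / s ≤ -L * √s / s := by gcongr
    have h4 : -(L : ℝ) * √s / s = -(L / √s) := by
      rw [mul_div_assoc, Real.sqrt_div_self, neg_mul, div_eq_mul_inv]
    linarith
  · have hn0 : 0 < n := by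
      rcases Nat.eq_zero_or_pos n with h | h
      · subst h; omega
      · exact h
    have hn' : (0 : ℝ) < n := by exact_mod_cast hn0
    rw [hmean j n hn0]
    have h3 : -M q * n / √s / n ≤ sumFrom (fun j l => Z j l ω) 0 j n / n := by
      gcongr; exact h2 j hj n hn
    have h4 : -M q * n / √s / n = -(M q / √s) := by field_simp
    linarith

end Oscillation

/-! ### Almost sure convergence of the sample moments -/

section RegularSample

variable {Ω : Type*} [MeasurableSpace Ω] {P : Measure Ω} [IsProbabilityMeasure P]
  {Y : ℕ → Ω → ℝ} {m : ℝ} {v : NNReal}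

/-- Two independent random variables, one of which has no atoms, almost surely differ. -/
lemma ae_ne_of_indepFun {X Y : Ω → ℝ} (hX : Measurable X) (hY : Measurable Y)
    (hind : IndepFun X Y P) [NullSingletonClass (P.map Y)] : ∀ᵐ ω ∂P, X ω ≠ Y ω := by
  have h1 : P.map (fun ω => (X ω, Y ω)) = (P.map X).prod (P.map Y) :=
    (indepFun_iff_map_prod_eq_prod_map_map hX.aemeasurable hY.aemeasurable).1 hind
  have hm : MeasurableSet {p : ℝ × ℝ | p.1 = p.2} := measurableSet_eq_fun measurable_fst measurable_snd
  have h2 : P.map (fun ω => (X ω, Y ω)) {p : ℝ × ℝ | p.1 = p.2} = 0 := by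
    rw [h1, Measure.measure_prod_null hm]
    refine ae_of_all _ fun a => ?_
    have : Prod.mk a ⁻¹' {p : ℝ × ℝ | p.1 = p.2} = {a} := by
      ext b; simp [eq_comm]
    simp only [this, measure_singleton, Pi.zero_apply]
  rw [Measure.map_apply (hX.prodMk hY) hm] at h2
  rw [ae_iff]
  simpa using! h2

/-- The strong law for the observations and for their squares. The first two observations differ
because a nondegenerate normal law has no atoms. -/
lemma ae_regularSample (hmeas : ∀ l, Measurable (Y l)) (hind : iIndepFun Y P)
    (hlaw : ∀ l, HasLaw (Y l) (gaussianReal m v) P) (hv : v ≠ 0) :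
    ∀ᵐ ω ∂P, RegularSample m v fun l => Y l ω := by
  have hid : ∀ l, IdentDistrib (Y l) (Y 0) P P := fun l =>
    ⟨(hmeas l).aemeasurable, (hmeas 0).aemeasurable, (hlaw l).map_eq.trans (hlaw 0).map_eq.symm⟩
  have hL2 : MemLp (Y 0) 2 P := by
    have := memLp_id_gaussianReal (μ := m) (v := v) 2
    rw [← (hlaw 0).map_eq] at this
    exact (memLp_map_measure_iff (by fun_prop) (hmeas 0).aemeasurable).1 this
  have hE : ∫ ω, Y 0 ω ∂P = m := by
    have := (hlaw 0).integral_eq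
    rwa [integral_id_gaussianReal] at this
  have hE2 : ∫ ω, Y 0 ω ^ 2 ∂P = v + m ^ 2 := by
    have h1 := (hlaw 0).variance_eq
    rw [variance_id_gaussianReal, variance_eq_sub hL2, hE] at h1
    simp only [Pi.pow_apply] at h1
    linarith
  have s1 := strong_law_ae_real Y (hL2.integrable (by norm_num))
    (fun a b hab => hind.indepFun hab) hid
  have s2 := strong_law_ae_real (fun l ω => Y l ω ^ 2) hL2.integrable_sq
    (fun a b hab => (hind.indepFun hab).comp (φ := fun x => x ^ 2) (ψ := fun x => x ^ 2)
      (by fun_prop) (by fun_prop)) (fun l => (hid l).comp (u := fun x => x ^ 2) (by fun_prop))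
  have : NullSingletonClass (P.map (Y 1)) := by
    rw [(hlaw 1).map_eq]; exact nullSingletonClass_gaussianReal hv
  filter_upwards [s1, s2, ae_ne_of_indepFun (hmeas 0) (hmeas 1) (hind.indepFun zero_ne_one)] with
    ω h1 h2 h3
  exact ⟨by rwa [hE] at h1, by rwa [hE2] at h2, h3⟩

end RegularSample

end OCBA

/-! ### Conclusion -/

theorem theorem3 {k : ℕ} (hk : 2 ≤ k) (m v : Fin k → ℝ) (hv : ∀ i, 0 < v i)
    (best : Fin k) (hbest : ∀ i, i ≠ best → m i < m best)
    {Ω : Type*} [MeasurableSpace Ω] (P : Measure Ω) [IsProbabilityMeasure P]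
    (X : Fin k → ℕ → Ω → ℝ)
    (hlaw : ∀ i l, HasLaw (X i l) (gaussianReal (m i) (v i).toNNReal) P)
    (hindep : iIndepFun (fun p : Fin k × ℕ => X p.1 p.2) P)
    (prior : (Fin k → ℝ) × (Fin k → ℝ) → ℝ) (n₀ : ℕ)
    (hprior : (OCBA.IsRegularPrior m v prior ∧ 6 ≤ n₀) ∨
      (OCBA.IsConjugatePrior n₀ prior ∧ 1 ≤ n₀)) :
    ∃ αs : Fin k → ℝ,
      OCBA.IsOptimalAllocation m v best αs ∧
      (∀ β, OCBA.IsOptimalAllocation m v best β → β = αs) ∧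
      ∀ᵐ ω ∂P, ∀ B I : ℕ → Fin k, OCBA.IsRun prior n₀ (fun i l => X i l ω) B I →
        ∀ ε : ℝ, 0 < ε → ∃ M M' : ℕ, M ≤ M' ∧
          (∀ t, M ≤ t → ∀ i j, i ≠ best → j ≠ best →
            |OCBA.estScaledRate prior (fun i l => X i l ω) (OCBA.count n₀ I t) (B t) i -
              OCBA.estScaledRate prior (fun i l => X i l ω) (OCBA.count n₀ I t) (B t) j| ≤ ε) ∧
          (∀ t, M' ≤ t → ∀ i,
            |OCBA.proportion (OCBA.count n₀ I t) i - αs i| ≤ ε) := by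
  have hn₀ : 1 ≤ n₀ := by rcases hprior with h | h <;> omega
  obtain ⟨α, hα⟩ := OCBA.exists_isOptimalAllocation (m := m) (b := best) hv
  refine ⟨α, hα, fun β hβ => OCBA.IsOptimalAllocation.unique hv hbest hk hβ hα, ?_⟩
  have hv' : ∀ i, (v i).toNNReal ≠ 0 := fun i => by simpa using hv i
  -- The observations are only almost everywhere measurable. They are replaced by measurable
  -- versions, which almost surely agree with them for all indices at once.
  choose Y hYm hXY using fun i l => (hlaw i l).aemeasurable
  have hYlaw : ∀ i l, HasLaw (Y i l) (gaussianReal (m i) (v i).toNNReal) P := fun i l =>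
    (hlaw i l).congr (hXY i l).symm
  have hYind : iIndepFun (fun p : Fin k × ℕ => Y p.1 p.2) P :=
    (iIndepFun_congr fun p : Fin k × ℕ => hXY p.1 p.2).1 hindep
  have h1 : ∀ᵐ ω ∂P, ∀ i l, X i l ω = Y i l ω :=
    ae_all_iff.2 fun i => ae_all_iff.2 fun l => hXY i l
  have h2 : ∀ᵐ ω ∂P, ∀ i, OCBA.RegularSample (m i) (v i).toNNReal fun l => Y i l ω :=
    ae_all_iff.2 fun i =>
      OCBA.ae_regularSample (hYm i) (OCBA.iIndepFun_row hYind i) (hYlaw i) (hv' i)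
  have h3 := OCBA.ae_oscillatingMeans hYm hYind hYlaw hv'
  filter_upwards [h1, h2, h3] with ω h1 h2 h3 B I hrun ε hε
  have hreg : ∀ i, OCBA.RegularSample (m i) (v i) fun l => X i l ω := fun i => by
    have h := h2 i
    rw [Real.coe_toNNReal _ (hv i).le] at h
    rwa [show (fun l => X i l ω) = fun l => Y i l ω from funext (h1 i)]
  have hosc : OCBA.OscillatingMeans m fun i l => X i l ω := by
    rwa [show (fun i l => X i l ω) = fun i l => Y i l ω from funext fun i => funext (h1 i)]
  have hest : OCBA.ConsistentEstimates v prior n₀ fun i l => X i l ω := by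
    rcases hprior with ⟨h, hn⟩ | ⟨h, hn⟩
    · exact h.consistentEstimates hn hv hreg
    · exact h.consistentEstimates hn hv hreg
  exact OCBA.run_converges hk hv hbest hn₀ hα hest (fun i => (hreg i).mean) hosc hrun hε
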